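/- Let $n\ge 1$. Let $\mathcal D^n$ be the set of $n$-tuples $f=(f_1,\dots,f_n)$ of cadlag functions $f_i:[0,\infty)\to\mathbb R$ without negative jumps, where we set $f_i(0^-)=0$, so that in particular $f_i(0)\ge 0$. For $f\in\mathcal D^n$ let $df$ be the finitely additive signed measure on $[0,\infty)\times\{1,\dots,n\}$ with $df([a,b]\times\{i\})=f_i(b)-f_i(a^-)$. For $0\le x\le y$, a path from $(x,n)$ to $(y,1)$ is a set $\pi=\bigcup_{i=1}^n [t_i,t_{i-1}]\times\{i\}$ with $x=t_n\le t_{n-1}\le\cdots\le t_1\le t_0=y$. Put $f[(x,n)\to(y,1)]=\sup_\pi df(\pi)$, the supremum over all such paths. A path $\pi$ is to the left of a path $\rho$ if for all $(s,\ell)\in\pi$ and $(t,m)\in\rho$ we have $\ell\le m$ or $s\le t$. A disjoint $k$-tuple from $(x,n)^k$ to $(y,1)^k$ is a tuple $(\pi_1,\dots,\pi_k)$ of paths from $(x,n)$ to $(y,1)$ such that for all $i<j$ the path $\pi_i$ is to the left of $\pi_j$ and $\pi_i\cap\pi_j$ is finite. Put $f[(x,n)^k\to(y,1)^k]=\sup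 df(\pi_1\cup\dots\cup\pi_k)$, the supremum over disjoint $k$-tuples (so the value is $0$ for $k=0$); a tuple that attains it is called an optimizer. The melon $Wf=(Wf_1,\dots,Wf_n)$ of $f\in\mathcal D^n$ is defined by $$Wf_k(y)=f[(0,n)^k\to(y,1)^k]-f[(0,n)^{k-1}\to(y,1)^{k-1}],\qquad 1\le k\le n,\ y\ge 0.$$ Let $\mathcal D^n_\uparrow$ be the set of $f\in\mathcal D^n$ with $f_{i-1}(y^-)\ge f_i(y)$ for all $2\le i\le n$ and $y\ge 0$. Let $\mathcal D^n_{\downarrow-}$ be the set of $f\in\mathcal D^n$ such that for every $k\in\{1,\dots,n\}$ there are times $T_m\to\infty$ and optimizers $\pi^m=(\pi^m_1,\dots,\pi^m_k)$ for $f$ from $(0,n)^k$ to $(T_m,1)^k$ whose jump times converge in $[0,\infty]$ to those of the $k$ lowest constant paths $[0,\infty)\times\{i\}$, $i=n-k+1,\dots,n$; that is, for each $j\in\{1,\dots,k\}$, as $m\to\infty$ the time $t_i$ of $\pi^m_j$ tends to $0$ for $i\ge n-k+j$ and to $\infty$ for $i<n-k+j$. Let $\mathcal D^n_\downarrow$ be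 the closure of $\mathcal D^n_{\downarrow-}$ in $\mathcal D^n$ for the topology of uniform convergence on $[0,\infty)$. Theorem. All the suprema above (for $f\in\mathcal D^n$, $0\le x\le y$ and $0\le k\le n$) are over nonempty sets and finite, $W$ maps $\mathcal D^n$ to $\mathcal D^n$, and: (i) (Isometry) $f[(x,n)\to(y,1)]=Wf[(x,n)\to(y,1)]$ for all $f\in\mathcal D^n$ and $0\le x\le y$. (ii) (Idempotence) $W(Wf)=Wf$ for all $f\in\mathcal D^n$. (iii) (Image) $W(\mathcal D^n)=\mathcal D^n_\uparrow$. (iv) (Bijection) $W$ restricts to a bijection from $\mathcal D^n_\downarrow$ onto $\mathcal D^n_\uparrow$. -/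

import Mathlib

open Set Filter Topology
open scoped NNReal ENNReal

namespace Melon

noncomputable section

/-- The left limit `g(x⁻)` of a function on `[0, ∞)`, with the convention `g(0⁻) = 0`. -/
def leftVal (g : ℝ≥0 → ℝ) (x : ℝ≥0) : ℝ :=
  if x = 0 then 0 else Function.leftLim g x

/-- `g : [0, ∞) → ℝ` is cadlag without negative jumps. Since `g(0⁻) = 0`, the value `g 0` is
the jump at `0`, so that `0 ≤ g 0` is part of the condition. -/
structure IsCadlagPos (g : ℝ≥0 → ℝ) : Prop where
  right_cont : ∀ x, ContinuousWithinAt g (Ici x) x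
  left_lim : ∀ x, ∃ l, Tendsto g (𝓝[<] x) (𝓝 l)
  jump_nonneg : ∀ x, leftVal g x ≤ g x

/-- The space `𝒟ⁿ`. Lines are indexed from the top: the index `i : Fin n` is line `i + 1`. -/
def D (n : ℕ) : Set (Fin n → ℝ≥0 → ℝ) := {f | ∀ i, IsCadlagPos (f i)}

open Classical in
/-- The indicator of a proposition. -/
def ind (p : Prop) : ℝ := if p then 1 else 0

theorem ind_of {p : Prop} (h : p) : ind p = 1 := if_pos h

theorem ind_of_not {p : Prop} (h : ¬ p) : ind p = 0 := if_neg h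

theorem ind_congr {p q : Prop} (h : p ↔ q) : ind p = ind q := congrArg ind (propext h)

/-- The finitely additive signed measure `dg` on finite unions of compact intervals, written as
a sum over boundary points: a right boundary point `x` that belongs to `A` contributes `g(x)`,
a left boundary point `x` that belongs to `A` contributes `-g(x⁻)`. It is determined by the
identities `dg_Icc` and `dg_union_add_dg_inter` below. -/
def dg (g : ℝ≥0 → ℝ) (A : Set ℝ≥0) : ℝ :=
  ∑ᶠ x : ℝ≥0,
    (g x * (ind (x ∈ A) - ind (∀ᶠ z in 𝓝[>] x, z ∈ A)) +
      leftVal g x * (ind (∀ᶠ z in 𝓝[<] x, z ∈ A) - ind (x ∈ A)))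

theorem dg_empty (g : ℝ≥0 → ℝ) : dg g ∅ = 0 := by
  unfold dg
  refine finsum_eq_zero_of_forall_eq_zero fun x => ?_
  have h1 : ¬ ∀ᶠ z in 𝓝[>] x, z ∈ (∅ : Set ℝ≥0) := by
    intro h
    obtain ⟨z, hz⟩ := h.exists
    exact hz
  by_cases hx : x = 0
  · rw [ind_of_not h1, ind_of_not (notMem_empty x)]
    simp [leftVal, hx]
  · have hx' : 0 < x := pos_iff_ne_zero.mpr hx
    have : (𝓝[<] x).NeBot := nhdsLT_neBot_of_exists_lt ⟨0, hx'⟩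
    have h2 : ¬ ∀ᶠ z in 𝓝[<] x, z ∈ (∅ : Set ℝ≥0) := by
      intro h
      obtain ⟨z, hz⟩ := h.exists
      exact hz
    rw [ind_of_not h1, ind_of_not h2, ind_of_not (notMem_empty x)]
    simp

/-- `dg([a, b]) = g(b) - g(a⁻)`. -/
theorem dg_Icc (g : ℝ≥0 → ℝ) {a b : ℝ≥0} (hab : a ≤ b) :
    dg g (Icc a b) = g b - leftVal g a := by
  have hR : ∀ x, (∀ᶠ z in 𝓝[>] x, z ∈ Icc a b) ↔ a ≤ x ∧ x < b := by
    intro x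
    constructor
    · intro h
      refine ⟨?_, ?_⟩
      · by_contra! hlt
        obtain ⟨z, hz, hz'⟩ :=
          (h.and (mem_nhdsWithin_of_mem_nhds (Iio_mem_nhds hlt))).exists
        exact absurd hz.1 (not_le.mpr hz')
      · obtain ⟨z, hz, hz'⟩ := (h.and self_mem_nhdsWithin).exists
        exact lt_of_lt_of_le hz' hz.2
    · rintro ⟨h1, h2⟩
      filter_upwards [self_mem_nhdsWithin, mem_nhdsWithin_of_mem_nhds (Iio_mem_nhds h2)]
        with z hz hz'
      exact ⟨h1.trans (le_of_lt hz), le_of_lt hz'⟩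
  have hL : ∀ x, x ≠ 0 → ((∀ᶠ z in 𝓝[<] x, z ∈ Icc a b) ↔ a < x ∧ x ≤ b) := by
    intro x hx
    have : (𝓝[<] x).NeBot := nhdsLT_neBot_of_exists_lt ⟨0, pos_iff_ne_zero.mpr hx⟩
    constructor
    · intro h
      refine ⟨?_, ?_⟩
      · obtain ⟨z, hz, hz'⟩ := (h.and self_mem_nhdsWithin).exists
        exact lt_of_le_of_lt hz.1 hz'
      · by_contra! hlt
        obtain ⟨z, hz, hz'⟩ :=
          (h.and (mem_nhdsWithin_of_mem_nhds (Ioi_mem_nhds hlt))).exists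
        exact absurd hz.2 (not_le.mpr hz')
    · rintro ⟨h1, h2⟩
      filter_upwards [self_mem_nhdsWithin, mem_nhdsWithin_of_mem_nhds (Ioi_mem_nhds h1)]
        with z hz hz'
      exact ⟨le_of_lt hz', (le_of_lt hz).trans h2⟩
  have key : ∀ x,
      (g x * (ind (x ∈ Icc a b) - ind (∀ᶠ z in 𝓝[>] x, z ∈ Icc a b)) +
        leftVal g x * (ind (∀ᶠ z in 𝓝[<] x, z ∈ Icc a b) - ind (x ∈ Icc a b))) =
      (if x = b then g b else 0) + (if x = a then - leftVal g a else 0) := by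
    intro x
    have e1 : g x * (ind (x ∈ Icc a b) - ind (∀ᶠ z in 𝓝[>] x, z ∈ Icc a b)) =
        if x = b then g b else 0 := by
      rw [ind_congr (hR x), ind_congr mem_Icc]
      by_cases hxb : x = b
      · subst hxb; simp [ind, hab]
      · have : x ≤ b ↔ x < b := ⟨fun h => lt_of_le_of_ne h hxb, le_of_lt⟩
        simp [hxb, this]
    have e2 : leftVal g x * (ind (∀ᶠ z in 𝓝[<] x, z ∈ Icc a b) - ind (x ∈ Icc a b)) =
        if x = a then - leftVal g a else 0 := by
      by_cases hx : x = 0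
      · subst hx
        by_cases ha : (0 : ℝ≥0) = a
        · subst ha; simp [leftVal]
        · simp [leftVal, ha]
      · rw [ind_congr (hL x hx), ind_congr mem_Icc]
        by_cases hxa : x = a
        · subst hxa; simp [ind, hab]
        · have : a ≤ x ↔ a < x := ⟨fun h => lt_of_le_of_ne h (Ne.symm hxa), le_of_lt⟩
          simp [hxa, this]
    rw [e1, e2]
  unfold dg
  rw [finsum_congr key, finsum_add_distrib, finsum_eq_single _ b, finsum_eq_single _ a]
  · simp; ring
  · intro x hx; simp [hx]
  · intro x hx; simp [hx]
  · exact (finite_singleton b).subset fun x hx => by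
      by_contra h; exact hx (if_neg h)
  · exact (finite_singleton a).subset fun x hx => by
      by_contra h; exact hx (if_neg h)

/-- Sets that are locally constant off a finite set, and eventually constant on the left and on
the right of every point. -/
def IsElementary (A : Set ℝ≥0) : Prop :=
  (∃ E : Set ℝ≥0, E.Finite ∧ ∀ x ∉ E, ∀ᶠ z in 𝓝 x, (z ∈ A ↔ x ∈ A)) ∧
    ∀ x, ((∀ᶠ z in 𝓝[>] x, z ∈ A) ∨ ∀ᶠ z in 𝓝[>] x, z ∉ A) ∧
      ((∀ᶠ z in 𝓝[<] x, z ∈ A) ∨ ∀ᶠ z in 𝓝[<] x, z ∉ A)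

theorem isElementary_empty : IsElementary ∅ :=
  ⟨⟨∅, finite_empty, fun x _ => by simp⟩, fun x => ⟨Or.inr (by simp), Or.inr (by simp)⟩⟩

theorem IsElementary.compl {A : Set ℝ≥0} (hA : IsElementary A) : IsElementary Aᶜ := by
  obtain ⟨⟨E, hE, h⟩, h'⟩ := hA
  refine ⟨⟨E, hE, fun x hx => ?_⟩, fun x => ⟨?_, ?_⟩⟩
  · filter_upwards [h x hx] with z hz
    simp [hz]
  · simpa using (h' x).1.symm
  · simpa using (h' x).2.symm

theorem IsElementary.inter {A B : Set ℝ≥0} (hA : IsElementary A) (hB : IsElementary B) :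
    IsElementary (A ∩ B) := by
  obtain ⟨⟨E, hE, h⟩, h'⟩ := hA
  obtain ⟨⟨F, hF, k⟩, k'⟩ := hB
  have aux : ∀ l : Filter ℝ≥0, ((∀ᶠ z in l, z ∈ A) ∨ ∀ᶠ z in l, z ∉ A) →
      ((∀ᶠ z in l, z ∈ B) ∨ ∀ᶠ z in l, z ∉ B) →
      ((∀ᶠ z in l, z ∈ A ∩ B) ∨ ∀ᶠ z in l, z ∉ A ∩ B) := by
    rintro l (a | a) (b | b)
    · exact Or.inl (a.and b)
    · exact Or.inr (b.mono fun z hz hz' => hz hz'.2)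
    · exact Or.inr (a.mono fun z hz hz' => hz hz'.1)
    · exact Or.inr (a.mono fun z hz hz' => hz hz'.1)
  refine ⟨⟨E ∪ F, hE.union hF, fun x hx => ?_⟩, fun x =>
    ⟨aux _ (h' x).1 (k' x).1, aux _ (h' x).2 (k' x).2⟩⟩
  simp only [mem_union, not_or] at hx
  filter_upwards [h x hx.1, k x hx.2] with z h1 h2
  simp [h1, h2]

theorem IsElementary.union {A B : Set ℝ≥0} (hA : IsElementary A) (hB : IsElementary B) :
    IsElementary (A ∪ B) := by
  have := (hA.compl.inter hB.compl).compl
  rwa [← compl_union, compl_compl] at this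

theorem isElementary_Icc (a b : ℝ≥0) : IsElementary (Icc a b) := by
  have hI : ∀ c : ℝ≥0, IsElementary (Ici c) := by
    intro c
    refine ⟨⟨{c}, finite_singleton c, fun x hx => ?_⟩, fun x => ⟨?_, ?_⟩⟩
    · rcases lt_or_gt_of_ne (show x ≠ c from hx) with h | h
      · filter_upwards [Iio_mem_nhds h] with z hz
        simp only [mem_Ici, not_le.mpr (mem_Iio.mp hz), not_le.mpr h]
      · filter_upwards [Ioi_mem_nhds h] with z hz
        simp only [mem_Ici, (mem_Ioi.mp hz).le, h.le]
    · rcases lt_or_ge x c with h | h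
      · exact Or.inr (mem_nhdsWithin_of_mem_nhds (by
          filter_upwards [Iio_mem_nhds h] with z hz using not_le.mpr (mem_Iio.mp hz)))
      · exact Or.inl (by
          filter_upwards [self_mem_nhdsWithin] with z hz using h.trans (le_of_lt hz))
    · rcases le_or_gt x c with h | h
      · exact Or.inr (by
          filter_upwards [self_mem_nhdsWithin] with z hz using not_le.mpr (lt_of_lt_of_le hz h))
      · exact Or.inl (mem_nhdsWithin_of_mem_nhds (by
          filter_upwards [Ioi_mem_nhds h] with z hz using le_of_lt (mem_Ioi.mp hz)))
  have hJ : IsElementary (Iic b) := by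
    refine ⟨⟨{b}, finite_singleton b, fun x hx => ?_⟩, fun x => ⟨?_, ?_⟩⟩
    · rcases lt_or_gt_of_ne (show x ≠ b from hx) with h | h
      · filter_upwards [Iio_mem_nhds h] with z hz
        simp only [mem_Iic, (mem_Iio.mp hz).le, h.le]
      · filter_upwards [Ioi_mem_nhds h] with z hz
        simp only [mem_Iic, not_le.mpr (mem_Ioi.mp hz), not_le.mpr h]
    · rcases lt_or_ge x b with h | h
      · exact Or.inl (mem_nhdsWithin_of_mem_nhds (by
          filter_upwards [Iio_mem_nhds h] with z hz using le_of_lt (mem_Iio.mp hz)))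
      · exact Or.inr (by
          filter_upwards [self_mem_nhdsWithin] with z hz using not_le.mpr (lt_of_le_of_lt h hz))
    · rcases le_or_gt x b with h | h
      · exact Or.inl (by
          filter_upwards [self_mem_nhdsWithin] with z hz using (le_of_lt hz).trans h)
      · exact Or.inr (mem_nhdsWithin_of_mem_nhds (by
          filter_upwards [Ioi_mem_nhds h] with z hz using not_le.mpr (mem_Ioi.mp hz)))
  exact (hI a).inter hJ

theorem finite_support_dg (g : ℝ≥0 → ℝ) {A : Set ℝ≥0} (hA : IsElementary A) :
    (Function.support fun x : ℝ≥0 =>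
      (g x * (ind (x ∈ A) - ind (∀ᶠ z in 𝓝[>] x, z ∈ A)) +
        leftVal g x * (ind (∀ᶠ z in 𝓝[<] x, z ∈ A) - ind (x ∈ A)))).Finite := by
  obtain ⟨⟨E, hE, h⟩, -⟩ := hA
  refine hE.subset fun x hx => ?_
  by_contra hxE
  apply hx
  have hgen : ∀ l : Filter ℝ≥0, l.NeBot → l ≤ 𝓝 x →
      ((∀ᶠ z in l, z ∈ A) ↔ x ∈ A) := by
    intro l hl hle
    have h1 : ∀ᶠ z in l, (z ∈ A ↔ x ∈ A) := hle (h x hxE)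
    constructor
    · intro h2
      obtain ⟨z, hz, hz'⟩ := (h1.and h2).exists
      exact hz.mp hz'
    · intro h2
      exact h1.mono fun z hz => hz.mpr h2
  have e1 := hgen (𝓝[>] x) inferInstance nhdsWithin_le_nhds
  by_cases hx0 : x = 0
  · subst hx0; simp [e1, leftVal]
  · have e2 := hgen (𝓝[<] x) (nhdsLT_neBot_of_exists_lt ⟨0, pos_iff_ne_zero.mpr hx0⟩)
      nhdsWithin_le_nhds
    simp [e1, e2]

/-- Finite additivity, in the form of inclusion and exclusion. -/
theorem dg_union_add_dg_inter (g : ℝ≥0 → ℝ) {A B : Set ℝ≥0}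
    (hA : IsElementary A) (hB : IsElementary B) :
    dg g (A ∪ B) + dg g (A ∩ B) = dg g A + dg g B := by
  have pt : ∀ x, ind (x ∈ A ∪ B) + ind (x ∈ A ∩ B) = ind (x ∈ A) + ind (x ∈ B) := by
    intro x
    by_cases a : x ∈ A <;> by_cases b : x ∈ B <;> simp [ind, a, b]
  have germ : ∀ l : Filter ℝ≥0, ((∀ᶠ z in l, z ∈ A) ∨ ∀ᶠ z in l, z ∉ A) →
      ind (∀ᶠ z in l, z ∈ A ∪ B) + ind (∀ᶠ z in l, z ∈ A ∩ B) =
        ind (∀ᶠ z in l, z ∈ A) + ind (∀ᶠ z in l, z ∈ B) := by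
    intro l hl
    rcases l.eq_or_neBot with rfl | hne
    · simp [ind]
    rcases hl with a | a
    · have h1 : ∀ᶠ z in l, z ∈ A ∪ B := a.mono fun z hz => Or.inl hz
      have h2 : (∀ᶠ z in l, z ∈ A ∩ B) ↔ ∀ᶠ z in l, z ∈ B :=
        ⟨fun h => h.mono fun z hz => hz.2, fun h => a.and h⟩
      rw [ind_of h1, ind_congr h2, ind_of a]
    · have h0 : ¬ ∀ᶠ z in l, z ∈ A := fun h => by
        obtain ⟨z, hz, hz'⟩ := (a.and h).exists
        exact hz hz'
      have h1 : (∀ᶠ z in l, z ∈ A ∪ B) ↔ ∀ᶠ z in l, z ∈ B :=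
        ⟨fun h => (a.and h).mono fun z hz => hz.2.resolve_left hz.1,
          fun h => h.mono fun z hz => Or.inr hz⟩
      have h2 : ¬ ∀ᶠ z in l, z ∈ A ∩ B := fun h => h0 (h.mono fun z hz => hz.1)
      rw [ind_congr h1, ind_of_not h2, ind_of_not h0]
      ring
  unfold dg
  rw [← finsum_add_distrib (finite_support_dg g (hA.union hB)) (finite_support_dg g (hA.inter hB)),
    ← finsum_add_distrib (finite_support_dg g hA) (finite_support_dg g hB)]
  refine finsum_congr fun x => ?_
  have p := pt x
  have r := germ (𝓝[>] x) (hA.2 x).1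
  have l := germ (𝓝[<] x) (hA.2 x).2
  linear_combination (g x - leftVal g x) * p - g x * r + leftVal g x * l

/-- A path from `(x, n)` to `(y, 1)`, given by its times `x = t_n ≤ ⋯ ≤ t_1 ≤ t_0 = y`. -/
@[ext]
structure UpPath (n : ℕ) (x y : ℝ≥0) where
  times : Fin (n + 1) → ℝ≥0
  antitone : Antitone times
  times_zero : times 0 = y
  times_last : times (Fin.last n) = x

namespace UpPath

variable {n : ℕ} {x y : ℝ≥0}

/-- The interval that the path spends on a line; on line `i` it is `[t_i, t_{i-1}]`. -/
def interval (π : UpPath n x y) (i : Fin n) : Set ℝ≥0 :=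
  Icc (π.times i.succ) (π.times i.castSucc)

/-- The path as a subset of `[0, ∞) × {1, …, n}`. -/
def carrier (π : UpPath n x y) : Set (ℝ≥0 × Fin n) := {p | p.1 ∈ π.interval p.2}

/-- `π` is to the left of `ρ`. -/
def LeftOf (π ρ : UpPath n x y) : Prop :=
  ∀ p ∈ π.carrier, ∀ q ∈ ρ.carrier, p.2 ≤ q.2 ∨ p.1 ≤ q.1

/-- `π` and `ρ` are essentially disjoint. -/
def EssDisjoint (π ρ : UpPath n x y) : Prop := (π.carrier ∩ ρ.carrier).Finite

/-- The length `df(π)` of a path. -/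
def length (f : Fin n → ℝ≥0 → ℝ) (π : UpPath n x y) : ℝ := ∑ i, dg (f i) (π.interval i)

end UpPath

/-- Disjoint `k`-tuples of paths from `(x, n)^k` to `(y, 1)^k`. -/
def IsDisjointTuple {n k : ℕ} {x y : ℝ≥0} (π : Fin k → UpPath n x y) : Prop :=
  ∀ i j, i < j → (π i).LeftOf (π j) ∧ (π i).EssDisjoint (π j)

/-- The length `df(π_1 ∪ ⋯ ∪ π_k)` of a `k`-tuple of paths. -/
def tupleLength {n k : ℕ} {x y : ℝ≥0} (f : Fin n → ℝ≥0 → ℝ) (π : Fin k → UpPath n x y) : ℝ :=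
  ∑ i, dg (f i) (⋃ j, (π j).interval i)

/-- The lengths of all paths from `(x, n)` to `(y, 1)`. -/
def pathLengths {n : ℕ} (f : Fin n → ℝ≥0 → ℝ) (x y : ℝ≥0) : Set ℝ :=
  range fun π : UpPath n x y => π.length f

/-- The lengths of all disjoint `k`-tuples from `(x, n)^k` to `(y, 1)^k`. -/
def tupleLengths {n : ℕ} (f : Fin n → ℝ≥0 → ℝ) (k : ℕ) (x y : ℝ≥0) : Set ℝ :=
  {L | ∃ π : Fin k → UpPath n x y, IsDisjointTuple π ∧ tupleLength f π = L}

/-- The last passage value `f[(x, n) → (y, 1)]`, for `x ≤ y`. -/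
def lpp {n : ℕ} (f : Fin n → ℝ≥0 → ℝ) (x y : ℝ≥0) : ℝ := sSup (pathLengths f x y)

/-- The last passage value `f[(x, n)^k → (y, 1)^k]`, for `x ≤ y` and `k ≤ n`. -/
def multiLpp {n : ℕ} (f : Fin n → ℝ≥0 → ℝ) (k : ℕ) (x y : ℝ≥0) : ℝ :=
  sSup (tupleLengths f k x y)

/-- The convention `f[p^0 → q^0] = 0` holds. -/
theorem multiLpp_zero {n : ℕ} (f : Fin n → ℝ≥0 → ℝ) (x y : ℝ≥0) : multiLpp f 0 x y = 0 := by
  have h : tupleLengths f 0 x y = {0} := by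
    ext L
    simp only [tupleLengths, tupleLength, IsDisjointTuple, mem_ofPred_eq, mem_singleton_iff]
    simp [dg_empty, eq_comm]
  simp [multiLpp, h]

/-- The melon map. The index `k : Fin n` is line `k + 1`. -/
def W {n : ℕ} (f : Fin n → ℝ≥0 → ℝ) : Fin n → ℝ≥0 → ℝ := fun k y =>
  multiLpp f ((k : ℕ) + 1) 0 y - multiLpp f (k : ℕ) 0 y

/-- The Pitman ordered elements of `𝒟ⁿ`: `f_i(y⁻) ≥ f_{i+1}(y)` for all `y` and all `i < n`. -/
def Dup (n : ℕ) : Set (Fin n → ℝ≥0 → ℝ) :=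
  {f | f ∈ D n ∧ ∀ i j : Fin n, (i : ℕ) + 1 = j → ∀ y, f j y ≤ leftVal (f i) y}

/-- The times in `[0, ∞]` of the `j`-th path of the rightmost `k`-tuple from `(0, n)^k` to
`(∞, 1)^k`. It jumps at time `0` to the line with index `n - k + j`, where it stays for ever. -/
def lowestTimes (n k : ℕ) (j : Fin k) (i : Fin (n + 1)) : ℝ≥0∞ :=
  if (i : ℕ) ≤ n - k + j then ⊤ else 0

/-- The space `𝒟ⁿ_{↓-}`: for every `k`, the `k` lowest constant paths are the limit, in the sense
of jump times in `[0, ∞]`, of disjoint optimizers from `(0, n)^k` to `(T_m, 1)^k` for some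
sequence `T_m → ∞`. -/
def DdownMinus (n : ℕ) : Set (Fin n → ℝ≥0 → ℝ) :=
  {f | f ∈ D n ∧ ∀ k : ℕ, 1 ≤ k → k ≤ n →
    ∃ (T : ℕ → ℝ≥0) (π : ∀ m, Fin k → UpPath n 0 (T m)),
      Tendsto T atTop atTop ∧
      (∀ m, IsDisjointTuple (π m) ∧ tupleLength f (π m) = multiLpp f k 0 (T m)) ∧
      ∀ j i, Tendsto (fun m => ((π m j).times i : ℝ≥0∞)) atTop (𝓝 (lowestTimes n k j i))}

/-- The space `𝒟ⁿ_↓`: the closure of `𝒟ⁿ_{↓-}` in `𝒟ⁿ` for the uniform topology. -/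
def Ddown (n : ℕ) : Set (Fin n → ℝ≥0 → ℝ) :=
  {f | f ∈ D n ∧ ∀ ε : ℝ, 0 < ε → ∃ h ∈ DdownMinus n, ∀ i t, |f i t - h i t| ≤ ε}

end

end Melon

namespace Melon

noncomputable section

/-! A disjoint tuple of paths amounts to an interlaced array of jump times (`IsInterlaced`), and its
length is the `weight` of that array. Everything rests on the Pitman transform `(f, g) ↦ (f + S, g -
S)` of two adjacent lines, where `S` is the running maximum of the gain `g(s) - f(s⁻)` of a crossing
at time `s`. With all other jump times frozen, the crossings of the different paths range over
independent intervals. On each interval the optimal gain changes by a boundary term, and the sum of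
these terms cancels against the change at the outer ends. So the transform preserves all last
passage values (`isometric_pitman`).

Sorting the lines by such transforms yields an ordered family `G` with the same values
(`exists_ordered_isometric`). For ordered lines no crossing has a positive gain, so from time `0` it
is optimal to jump at once, and the value for `k` paths is the sum of the top `k` lines. Hence `W f
= G` (`W_of_ordered`), which gives isometry, idempotence and the image (`W_spec`, `W_of_mem_Dup`).

For the bijection, write `L(x, T)` for the value of `k + 1` paths and let `lowSum F d k x` be the
sum of the left values at `x` of the lowest `k + 1` lines. Always `lowSum F d k x ≤ L(0, T) - L(x,
T)` (`lastPassage_add_lowSum_le`), and for families in `Ddown` the two sides agree up to an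
arbitrarily small error at arbitrarily late `T` (`Recurrent`). So last passage values determine such
a family (`Recurrent.eq`). Conversely, stopping `g` at time `m` and sorting backwards with a reverse
Pitman transform gives lines for which equality holds at `T = m`. As `m → ∞` these converge
monotonically, in terms of `lowSum`, to a recurrent family with the values of `g`
(`exists_recurrent`). Recurrent families lie in the closure `Ddown` because a small bounded bonus
for late jumps forces optimizers to jump late (`Recurrent.hasLateOptimizers_add_bonus`). -/

theorem nhdsLT_neBot_of_ne_zero {x : ℝ≥0} (hx : x ≠ 0) : (𝓝[<] x).NeBot :=
  nhdsLT_neBot_of_exists_lt ⟨0, pos_iff_ne_zero.mpr hx⟩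

@[simp]
theorem leftVal_zero (g : ℝ≥0 → ℝ) : leftVal g 0 = 0 := if_pos rfl

theorem leftVal_of_ne (g : ℝ≥0 → ℝ) {x : ℝ≥0} (hx : x ≠ 0) :
    leftVal g x = Function.leftLim g x := if_neg hx

theorem leftVal_eq_of_tendsto {g : ℝ≥0 → ℝ} {x : ℝ≥0} (hx : x ≠ 0) {l : ℝ}
    (h : Tendsto g (𝓝[<] x) (𝓝 l)) : leftVal g x = l := by
  have := nhdsLT_neBot_of_ne_zero hx
  rw [leftVal_of_ne g hx, leftLim_eq_of_tendsto h]

/-! ### Cadlag functions without negative jumps and their left limits -/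

namespace IsCadlagPos

variable {f g : ℝ≥0 → ℝ}

theorem tendsto_left (hg : IsCadlagPos g) {x : ℝ≥0} (hx : x ≠ 0) :
    Tendsto g (𝓝[<] x) (𝓝 (leftVal g x)) := by
  rw [leftVal_of_ne g hx]
  exact tendsto_leftLim_of_tendsto (hg.left_lim x)

theorem tendsto_right (hg : IsCadlagPos g) (x : ℝ≥0) : Tendsto g (𝓝[>] x) (𝓝 (g x)) :=
  (hg.right_cont x).tendsto.mono_left (nhdsWithin_mono _ Ioi_subset_Ici_self)

theorem nonneg_zero (hg : IsCadlagPos g) : 0 ≤ g 0 := by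
  simpa using hg.jump_nonneg 0

theorem leftVal_le_of_forall_lt (hg : IsCadlagPos g) {x : ℝ≥0} (hx : x ≠ 0) {c : ℝ}
    (h : ∀ s < x, g s ≤ c) : leftVal g x ≤ c := by
  have := nhdsLT_neBot_of_ne_zero hx
  exact le_of_tendsto (hg.tendsto_left hx) (by
    filter_upwards [self_mem_nhdsWithin] with s hs using h s hs)

theorem abs_leftVal_sub_le (hf : IsCadlagPos f) (hg : IsCadlagPos g) {x : ℝ≥0} {c : ℝ}
    (hc : 0 ≤ c) (h : ∀ s < x, |f s - g s| ≤ c) : |leftVal f x - leftVal g x| ≤ c := by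
  rcases eq_or_ne x 0 with rfl | hx
  · simpa using hc
  have := nhdsLT_neBot_of_ne_zero hx
  exact le_of_tendsto ((hf.tendsto_left hx).sub (hg.tendsto_left hx)).abs (by
    filter_upwards [self_mem_nhdsWithin] with s hs using h s hs)

theorem leftVal_add (hf : IsCadlagPos f) (hg : IsCadlagPos g) (x : ℝ≥0) :
    leftVal (fun s => f s + g s) x = leftVal f x + leftVal g x := by
  rcases eq_or_ne x 0 with rfl | hx
  · simp
  exact leftVal_eq_of_tendsto hx ((hf.tendsto_left hx).add (hg.tendsto_left hx))

theorem leftVal_sub (hf : IsCadlagPos f) (hg : IsCadlagPos g) (x : ℝ≥0) :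
    leftVal (fun s => f s - g s) x = leftVal f x - leftVal g x := by
  rcases eq_or_ne x 0 with rfl | hx
  · simp
  exact leftVal_eq_of_tendsto hx ((hf.tendsto_left hx).sub (hg.tendsto_left hx))

theorem add (hf : IsCadlagPos f) (hg : IsCadlagPos g) : IsCadlagPos fun s => f s + g s where
  right_cont x := (hf.right_cont x).add (hg.right_cont x)
  left_lim x := by
    obtain ⟨a, ha⟩ := hf.left_lim x
    obtain ⟨b, hb⟩ := hg.left_lim x
    exact ⟨_, ha.add hb⟩
  jump_nonneg x := by
    rw [hf.leftVal_add hg]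
    exact add_le_add (hf.jump_nonneg x) (hg.jump_nonneg x)

theorem sub (hf : IsCadlagPos f) (hg : IsCadlagPos g)
    (h : ∀ x, g x - leftVal g x ≤ f x - leftVal f x) : IsCadlagPos fun s => f s - g s where
  right_cont x := (hf.right_cont x).sub (hg.right_cont x)
  left_lim x := by
    obtain ⟨a, ha⟩ := hf.left_lim x
    obtain ⟨b, hb⟩ := hg.left_lim x
    exact ⟨_, ha.sub hb⟩
  jump_nonneg x := by
    rw [hf.leftVal_sub hg]
    linarith [h x]

theorem tendsto_leftVal_left (hg : IsCadlagPos g) {x : ℝ≥0} (hx : x ≠ 0) :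
    Tendsto (leftVal g) (𝓝[<] x) (𝓝 (leftVal g x)) := by
  refine (closed_nhds_basis _).tendsto_right_iff.2 ?_
  rintro s ⟨s_mem, s_closed⟩
  obtain ⟨a, ha, hu⟩ := (mem_nhdsLT_iff_exists_Ioo_subset' (pos_iff_ne_zero.mpr hx)).1
    (hg.tendsto_left hx s_mem)
  filter_upwards [Ioo_mem_nhdsLT ha] with c hc
  have hc0 : c ≠ 0 := (lt_of_le_of_lt zero_le hc.1).ne'
  have := nhdsLT_neBot_of_ne_zero hc0
  exact s_closed.mem_of_tendsto (hg.tendsto_left hc0) (by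
    filter_upwards [Ioo_mem_nhdsLT hc.1] with d hd using hu ⟨hd.1, hd.2.trans hc.2⟩)

theorem tendsto_leftVal_right (hg : IsCadlagPos g) (x : ℝ≥0) :
    Tendsto (leftVal g) (𝓝[>] x) (𝓝 (g x)) := by
  refine (closed_nhds_basis _).tendsto_right_iff.2 ?_
  rintro s ⟨s_mem, s_closed⟩
  obtain ⟨a, ha, hu⟩ := mem_nhdsGT_iff_exists_Ioo_subset.1 (hg.tendsto_right x s_mem)
  filter_upwards [Ioo_mem_nhdsGT ha] with c hc
  have hc0 : c ≠ 0 := (lt_of_le_of_lt zero_le hc.1).ne'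
  have := nhdsLT_neBot_of_ne_zero hc0
  exact s_closed.mem_of_tendsto (hg.tendsto_left hc0) (by
    filter_upwards [Ioo_mem_nhdsLT hc.1] with d hd using hu ⟨hd.1, hd.2.trans hc.2⟩)

/-- A right continuous function is the right limit of its own left values. This matters because
`lowSum` sees only left values. -/
theorem eq_of_leftVal_eq (hf : IsCadlagPos f) (hg : IsCadlagPos g)
    (h : ∀ x, leftVal f x = leftVal g x) : f = g := by
  have e : leftVal f = leftVal g := funext h
  funext x
  exact tendsto_nhds_unique (hf.tendsto_leftVal_right x) (e ▸ hg.tendsto_leftVal_right x)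

theorem abs_sub_le_of_leftVal (hf : IsCadlagPos f) (hg : IsCadlagPos g) {x y : ℝ≥0} {c : ℝ}
    (hxy : x < y) (h : ∀ s ≤ y, |leftVal f s - leftVal g s| ≤ c) : |f x - g x| ≤ c :=
  le_of_tendsto ((hf.tendsto_leftVal_right x).sub (hg.tendsto_leftVal_right x)).abs (by
    filter_upwards [Ioo_mem_nhdsGT hxy] with s hs using h s hs.2.le)

theorem of_monotone (hm : Monotone g) (h0 : 0 ≤ g 0)
    (hr : ∀ x, ContinuousWithinAt g (Ici x) x) : IsCadlagPos g where
  right_cont := hr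
  left_lim x := ⟨_, hm.tendsto_leftLim x⟩
  jump_nonneg x := by
    rcases eq_or_ne x 0 with rfl | hx
    · simpa using h0
    · rw [leftVal_of_ne g hx]
      exact hm.leftLim_le le_rfl

theorem zero : IsCadlagPos fun _ => (0 : ℝ) :=
  of_monotone monotone_const le_rfl fun _ => continuousWithinAt_const

theorem le_leftVal_of_monotone (hm : Monotone g) {s x : ℝ≥0} (h : s < x) : g s ≤ leftVal g x := by
  rw [leftVal_of_ne g (lt_of_le_of_lt zero_le h).ne']
  exact hm.le_leftLim h

end IsCadlagPos

/-! ### Semicontinuity of the gain of a crossing -/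

/-- The gain of a path that leaves the lower line `g` and enters the upper line `f` at time `s`. -/
def jumpGain (f g : ℝ≥0 → ℝ) (s : ℝ≥0) : ℝ := g s - leftVal f s

theorem IsCadlagPos.leftVal_sub_leftVal_le_jumpGain {g : ℝ≥0 → ℝ} (hg : IsCadlagPos g)
    (f : ℝ≥0 → ℝ) (x : ℝ≥0) : leftVal g x - leftVal f x ≤ jumpGain f g x :=
  sub_le_sub_right (hg.jump_nonneg x) _

theorem IsCadlagPos.sub_le_jumpGain {f : ℝ≥0 → ℝ} (hf : IsCadlagPos f) (g : ℝ≥0 → ℝ)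
    (x : ℝ≥0) : g x - f x ≤ jumpGain f g x :=
  sub_le_sub_left (hf.jump_nonneg x) _

section JumpGain

variable {f g : ℝ≥0 → ℝ} (hf : IsCadlagPos f) (hg : IsCadlagPos g)
include hf hg

theorem tendsto_jumpGain_left {x : ℝ≥0} (hx : x ≠ 0) :
    Tendsto (jumpGain f g) (𝓝[<] x) (𝓝 (leftVal g x - leftVal f x)) :=
  (hg.tendsto_left hx).sub (hf.tendsto_leftVal_left hx)

theorem tendsto_jumpGain_right (x : ℝ≥0) :
    Tendsto (jumpGain f g) (𝓝[>] x) (𝓝 (g x - f x)) :=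
  (hg.tendsto_right x).sub (hf.tendsto_leftVal_right x)

/-- Without negative jumps, the value `g x - leftVal f x` dominates both one-sided limits of the
gain, `leftVal g x - leftVal f x` and `g x - f x`. Maximal gains over compact intervals are
therefore attained. -/
theorem upperSemicontinuous_jumpGain : UpperSemicontinuous (jumpGain f g) := by
  intro x c hc
  have h1 : ∀ᶠ s in 𝓝[>] x, jumpGain f g s < c :=
    (tendsto_jumpGain_right hf hg x).eventually_lt_const ((hf.sub_le_jumpGain g x).trans_lt hc)
  have h2 : ∀ᶠ s in 𝓝[<] x, jumpGain f g s < c := by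
    rcases eq_or_ne x 0 with rfl | hx
    · simp
    · exact (tendsto_jumpGain_left hf hg hx).eventually_lt_const
        ((hg.leftVal_sub_leftVal_le_jumpGain f x).trans_lt hc)
  have h3 : ∀ᶠ s in 𝓝[≠] x, jumpGain f g s < c := by
    rw [← nhdsLT_sup_nhdsGT]
    exact eventually_sup.2 ⟨h2, h1⟩
  rw [eventually_nhdsWithin_iff] at h3
  filter_upwards [h3] with s hs
  rcases eq_or_ne s x with rfl | hne
  · exact hc
  · exact hs hne

theorem exists_jumpGain_max (y : ℝ≥0) : ∃ s ≤ y, ∀ r ≤ y, jumpGain f g r ≤ jumpGain f g s := by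
  obtain ⟨s, hs, hmax⟩ := UpperSemicontinuousOn.exists_isMaxOn (s := Icc 0 y)
    ⟨0, by simp⟩ isCompact_Icc ((upperSemicontinuous_jumpGain hf hg).upperSemicontinuousOn _)
  exact ⟨s, hs.2, fun r hr => hmax (show r ∈ Icc 0 y from ⟨zero_le, hr⟩)⟩

theorem exists_last_le_jumpGain {y : ℝ≥0} {c : ℝ} (h : ∃ s ≤ y, c ≤ jumpGain f g s) :
    ∃ s ≤ y, c ≤ jumpGain f g s ∧ ∀ r ≤ y, s < r → jumpGain f g r < c := by
  have hK : IsCompact (Icc 0 y ∩ jumpGain f g ⁻¹' Ici c) :=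
    isCompact_Icc.inter_right ((upperSemicontinuous_jumpGain hf hg).isClosed_preimage c)
  obtain ⟨r, hr, hc⟩ := h
  obtain ⟨s, hs, hmax⟩ := hK.exists_isGreatest ⟨r, ⟨zero_le, hr⟩, hc⟩
  refine ⟨s, hs.1.2, hs.2, fun t ht hst => ?_⟩
  by_contra! hct
  exact absurd (hmax ⟨⟨zero_le, ht⟩, hct⟩) (not_le.mpr hst)

end JumpGain

/-! ### The running maximum and the two lines of the Pitman transform -/

/-- The running maximum of the jump gain. -/
def runMax (f g : ℝ≥0 → ℝ) (y : ℝ≥0) : ℝ := sSup (jumpGain f g '' Iic y)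

section RunMax

variable {f g : ℝ≥0 → ℝ} (hf : IsCadlagPos f) (hg : IsCadlagPos g)
include hf hg

theorem isGreatest_runMax (y : ℝ≥0) : IsGreatest (jumpGain f g '' Iic y) (runMax f g y) := by
  obtain ⟨s, hs, hmax⟩ := exists_jumpGain_max hf hg y
  have : IsGreatest (jumpGain f g '' Iic y) (jumpGain f g s) :=
    ⟨⟨s, hs, rfl⟩, by rintro _ ⟨r, hr, rfl⟩; exact hmax r hr⟩
  rwa [runMax, this.csSup_eq]

theorem jumpGain_le_runMax {s y : ℝ≥0} (h : s ≤ y) : jumpGain f g s ≤ runMax f g y :=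
  (isGreatest_runMax hf hg y).2 ⟨s, h, rfl⟩

theorem exists_jumpGain_eq_runMax (y : ℝ≥0) : ∃ s ≤ y, jumpGain f g s = runMax f g y :=
  (isGreatest_runMax hf hg y).1

theorem monotone_runMax : Monotone (runMax f g) := by
  intro x y hxy
  obtain ⟨s, hs, e⟩ := exists_jumpGain_eq_runMax hf hg x
  exact e ▸ jumpGain_le_runMax hf hg (hs.trans hxy)

theorem runMax_zero : runMax f g 0 = g 0 := by
  obtain ⟨s, hs, e⟩ := exists_jumpGain_eq_runMax hf hg 0
  obtain rfl : s = 0 := le_antisymm hs zero_le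
  rw [← e, jumpGain, leftVal_zero, sub_zero]

theorem isCadlagPos_runMax : IsCadlagPos (runMax f g) := by
  have hm := monotone_runMax hf hg
  refine .of_monotone hm (by rw [runMax_zero hf hg]; exact hg.nonneg_zero) fun x => ?_
  rw [← continuousWithinAt_Ioi_iff_Ici]
  refine tendsto_order.2 ⟨fun c hc => ?_, fun c hc => ?_⟩
  · filter_upwards [self_mem_nhdsWithin] with s hs using hc.trans_le (hm (le_of_lt hs))
  · have h1 := (tendsto_jumpGain_right hf hg x).eventually_lt_const
      (((hf.sub_le_jumpGain g x).trans (jumpGain_le_runMax hf hg le_rfl)).trans_lt hc)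
    obtain ⟨b, hb, hsub⟩ := mem_nhdsGT_iff_exists_Ioo_subset.1 h1
    filter_upwards [Ioo_mem_nhdsGT hb] with s hs
    obtain ⟨r, hr, e⟩ := exists_jumpGain_eq_runMax hf hg s
    rw [← e]
    rcases le_or_gt r x with h | h
    · exact (jumpGain_le_runMax hf hg h).trans_lt hc
    · exact hsub ⟨h, hr.trans_lt hs.2⟩

theorem leftVal_runMax_mono {s x : ℝ≥0} (h : s < x) : runMax f g s ≤ leftVal (runMax f g) x :=
  IsCadlagPos.le_leftVal_of_monotone (monotone_runMax hf hg) h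

theorem leftVal_runMax_nonneg (x : ℝ≥0) : 0 ≤ leftVal (runMax f g) x := by
  rcases eq_or_ne x 0 with rfl | hx
  · simp
  · refine le_trans ?_ (leftVal_runMax_mono hf hg (pos_iff_ne_zero.mpr hx))
    rw [runMax_zero hf hg]
    exact hg.nonneg_zero

/-- The maximum over `[0, x]` is attained either before `x`, and then `runMax` does not jump at `x`,
or at `x` itself. -/
theorem runMax_eq (x : ℝ≥0) :
    runMax f g x = leftVal (runMax f g) x ∨ runMax f g x = jumpGain f g x := by
  obtain ⟨s, hs, e⟩ := exists_jumpGain_eq_runMax hf hg x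
  rcases hs.lt_or_eq with h | rfl
  · left
    refine le_antisymm ?_ ((isCadlagPos_runMax hf hg).jump_nonneg x)
    rw [← e]
    exact (jumpGain_le_runMax hf hg le_rfl).trans (leftVal_runMax_mono hf hg h)
  · exact Or.inr e.symm

theorem leftVal_sub_le_leftVal_runMax (x : ℝ≥0) :
    leftVal g x - leftVal f x ≤ leftVal (runMax f g) x := by
  rcases eq_or_ne x 0 with rfl | hx
  · simp
  have := nhdsLT_neBot_of_ne_zero hx
  exact le_of_tendsto_of_tendsto (tendsto_jumpGain_left hf hg hx)
    ((isCadlagPos_runMax hf hg).tendsto_left hx)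
    (Eventually.of_forall fun s => jumpGain_le_runMax hf hg le_rfl)

/-- The supremum over times before `x` is either attained or only approached as `s ↑ x`, where the
gain tends to `leftVal g x - leftVal f x`. -/
theorem leftVal_runMax_attained {x : ℝ≥0} (hx : x ≠ 0) :
    leftVal (runMax f g) x ≤ leftVal g x - leftVal f x ∨
      ∃ s < x, leftVal (runMax f g) x ≤ jumpGain f g s := by
  have := nhdsLT_neBot_of_ne_zero hx
  by_contra! hcon
  obtain ⟨h1, h2⟩ := hcon
  obtain ⟨c, hc1, hc2⟩ := exists_between h1
  obtain ⟨a, ha, hsub⟩ := (mem_nhdsLT_iff_exists_Ioo_subset' (pos_iff_ne_zero.mpr hx)).1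
    ((tendsto_jumpGain_left hf hg hx).eventually_lt_const hc1)
  obtain ⟨r, hr, e⟩ := exists_jumpGain_eq_runMax hf hg a
  have h3 : max c (runMax f g a) < leftVal (runMax f g) x :=
    max_lt hc2 (e ▸ h2 r (hr.trans_lt ha))
  refine absurd ((isCadlagPos_runMax hf hg).leftVal_le_of_forall_lt hx
    (c := max c (runMax f g a)) fun s hs => ?_) (not_le.mpr h3)
  obtain ⟨q, hq, e'⟩ := exists_jumpGain_eq_runMax hf hg s
  rw [← e']
  rcases le_or_gt q a with h | h
  · exact (jumpGain_le_runMax hf hg h).trans (le_max_right _ _)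
  · exact le_max_of_le_left (le_of_lt (hsub ⟨h, hq.trans_lt hs⟩))

/-- The upper line of the Pitman transform. -/
theorem isCadlagPos_pitmanTop : IsCadlagPos fun s => f s + runMax f g s :=
  hf.add (isCadlagPos_runMax hf hg)

/-- The lower line of the Pitman transform. -/
theorem isCadlagPos_pitmanBot : IsCadlagPos fun s => g s - runMax f g s := by
  -- If `runMax` jumps at `x`, it jumps to `g x - leftVal f x` from at least `leftVal g x - leftVal
  -- f x`, hence by no more than `g` does.
  refine hg.sub (isCadlagPos_runMax hf hg) fun x => ?_
  have h1 := hg.jump_nonneg x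
  have h2 := leftVal_sub_le_leftVal_runMax hf hg x
  rcases runMax_eq hf hg x with h | h
  · linarith
  · rw [h, jumpGain]
    linarith

end RunMax

/-! ### Optimal crossing of a single path between two lines -/

open Classical in
/-- The contribution of one crossing time `t ∈ [a, b]` from the lower line `g` to the upper line
`f`. Under `lf` the point `a` of the upper line, and under `rf` the point `b` of the lower line,
is already covered by a neighbouring path. -/
def crossGain (f g : ℝ≥0 → ℝ) (lf rf : Prop) (a b t : ℝ≥0) : ℝ :=
  (if rf ∧ t = b then leftVal g t else g t) - (if lf ∧ t = a then f t else leftVal f t)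

open Classical in
/-- The value at the left end of the interval of crossing times. -/
def leftEnd (S : ℝ≥0 → ℝ) (lf : Prop) (a : ℝ≥0) : ℝ := if lf then S a else leftVal S a

open Classical in
/-- The value at the right end of the interval of crossing times. -/
def rightEnd (S : ℝ≥0 → ℝ) (rf : Prop) (b : ℝ≥0) : ℝ := if rf then leftVal S b else S b

section CrossGain

variable {f g : ℝ≥0 → ℝ} (hf : IsCadlagPos f) (hg : IsCadlagPos g)
include hf hg

open Classical in
theorem crossGain_pitman (lf rf : Prop) (a b t : ℝ≥0) :
    crossGain (fun s => f s + runMax f g s) (fun s => g s - runMax f g s) lf rf a b t =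
      crossGain f g lf rf a b t -
        (if lf ∧ t = a then runMax f g t else leftVal (runMax f g) t) -
        (if rf ∧ t = b then leftVal (runMax f g) t else runMax f g t) := by
  have hS := isCadlagPos_runMax hf hg
  simp only [crossGain, hf.leftVal_add hS, hg.leftVal_sub hS]
  split_ifs <;> ring

/-- If the running maximum grows across the interval, its final value is reached by a crossing
inside: times before `a` gain at most `leftEnd`. -/
theorem exists_crossGain_eq_rightEnd {lf rf : Prop} {a b : ℝ≥0} (hab : a ≤ b)
    (hne : ¬ (lf ∧ rf ∧ a = b))
    (hlt : leftEnd (runMax f g) lf a < rightEnd (runMax f g) rf b) :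
    ∃ t, a ≤ t ∧ t ≤ b ∧ rightEnd (runMax f g) rf b ≤ crossGain f g lf rf a b t := by
  have hl : leftVal (runMax f g) a ≤ leftEnd (runMax f g) lf a := by
    unfold leftEnd; split_ifs
    · exact (isCadlagPos_runMax hf hg).jump_nonneg a
    · exact le_rfl
  have key : ∀ s ≤ b, ¬ (rf ∧ s = b) → rightEnd (runMax f g) rf b ≤ jumpGain f g s →
      ∃ t, a ≤ t ∧ t ≤ b ∧ rightEnd (runMax f g) rf b ≤ crossGain f g lf rf a b t := by
    intro s hs hsr hle
    have has : a ≤ s := by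
      by_contra! h
      exact absurd (hle.trans ((jumpGain_le_runMax hf hg le_rfl).trans
        ((leftVal_runMax_mono hf hg h).trans hl))) (not_le.mpr hlt)
    have hsl : ¬ (lf ∧ s = a) := by
      rintro ⟨h1, rfl⟩
      rw [leftEnd, if_pos h1] at hlt
      exact absurd (hle.trans (jumpGain_le_runMax hf hg le_rfl)) (not_le.mpr hlt)
    refine ⟨s, has, hs, ?_⟩
    rwa [crossGain, if_neg hsr, if_neg hsl]
  by_cases hrf : rf
  · have e : rightEnd (runMax f g) rf b = leftVal (runMax f g) b := if_pos hrf
    have hb : b ≠ 0 := by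
      rintro rfl
      rw [e, leftVal_zero] at hlt
      exact absurd ((leftVal_runMax_nonneg hf hg a).trans hl) (not_le.mpr hlt)
    rcases leftVal_runMax_attained hf hg hb with h | ⟨s, hs, h⟩
    · refine ⟨b, hab, le_rfl, ?_⟩
      rwa [crossGain, if_pos ⟨hrf, rfl⟩, if_neg fun h' => hne ⟨h'.1, hrf, h'.2.symm⟩, e]
    · exact key s hs.le (fun h' => hs.ne h'.2) (e ▸ h)
  · obtain ⟨s, hs, h⟩ := exists_jumpGain_eq_runMax hf hg b
    refine key s hs (fun h' => hrf h'.1) ?_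
    rw [rightEnd, if_neg hrf, h]

open Classical in
-- The crossing is placed where the running maximum first rises above its initial value. Up to there
-- the maximum is at most `leftEnd`, while the gain of the crossing already reaches the maximum
-- after it.
theorem exists_first_record {lf rf : Prop} {a b : ℝ≥0} (hab : a ≤ b)
    (hlt : leftEnd (runMax f g) lf a < rightEnd (runMax f g) rf b) :
    ∃ t, a ≤ t ∧ t ≤ b ∧
      (if lf ∧ t = a then runMax f g t else leftVal (runMax f g) t) ≤
        leftEnd (runMax f g) lf a ∧
      (if rf ∧ t = b then leftVal (runMax f g) t else runMax f g t) ≤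
        crossGain f g lf rf a b t := by
  have hS := isCadlagPos_runMax hf hg
  set c := leftEnd (runMax f g) lf a with hc
  have hl : leftVal (runMax f g) a ≤ c := by
    rw [hc]; unfold leftEnd; split_ifs
    · exact hS.jump_nonneg a
    · exact le_rfl
  set K : Set ℝ≥0 := {s | a ≤ s ∧ s ≤ b ∧ leftVal (runMax f g) s ≤ c} with hK
  have hKa : a ∈ K := ⟨le_rfl, hab, hl⟩
  have hKb : BddAbove K := ⟨b, fun s hs => hs.2.1⟩
  set t := sSup K with ht
  have hat : a ≤ t := le_csSup hKb hKa
  have htb : t ≤ b := csSup_le ⟨a, hKa⟩ fun s hs => hs.2.1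
  have htc : leftVal (runMax f g) t ≤ c := by
    rcases eq_or_ne t 0 with h | h
    · rw [h, leftVal_zero]
      exact (leftVal_runMax_nonneg hf hg a).trans hl
    · refine hS.leftVal_le_of_forall_lt h fun s hs => ?_
      obtain ⟨r, hr, hsr⟩ := exists_lt_of_lt_csSup ⟨a, hKa⟩ hs
      exact (leftVal_runMax_mono hf hg hsr).trans hr.2.2
  have hm : (if lf ∧ t = a then runMax f g t else leftVal (runMax f g) t) ≤ c := by
    split_ifs with h
    · rw [hc, leftEnd, if_pos h.1, h.2]
    · exact htc
  refine ⟨t, hat, htb, hm, ?_⟩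
  have hnotlf : ∀ v, c < v → runMax f g t = v → ¬ (lf ∧ t = a) := by
    rintro v hv e ⟨h1, h2⟩
    rw [hc, leftEnd, if_pos h1, ← h2, e] at hv
    exact lt_irrefl _ hv
  rcases htb.eq_or_lt with htb' | htb'
  · by_cases hrf : rf
    · rw [rightEnd, if_pos hrf, ← htb'] at hlt
      exact absurd htc (not_le.mpr hlt)
    · rw [rightEnd, if_neg hrf, ← htb'] at hlt
      rw [crossGain, if_neg (fun h => hrf h.1), if_neg (fun h => hrf h.1),
        if_neg (hnotlf _ hlt rfl)]
      rcases runMax_eq hf hg t with h | h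
      · exact absurd (h ▸ htc) (not_le.mpr hlt)
      · exact h.le
  · rw [crossGain, if_neg (fun h => htb'.ne h.2), if_neg (fun h => htb'.ne h.2)]
    have hgain : g t - f t ≤ g t - if lf ∧ t = a then f t else leftVal f t := by
      split_ifs
      · exact le_rfl
      · exact hf.sub_le_jumpGain g t
    rcases le_or_gt (runMax f g t) c with h | h
    · refine le_trans ?_ hgain
      -- If `g t - f t < runMax f g t`, then just after `t` the gain stays below the current
      -- maximum, the maximum does not move, and `K` extends beyond its supremum `t`.
      by_contra! hcon
      obtain ⟨d, hd, hsub⟩ := mem_nhdsGT_iff_exists_Ioo_subset.1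
        ((tendsto_jumpGain_right hf hg t).eventually_lt_const hcon)
      obtain ⟨s, hs1, hs2⟩ := exists_between (lt_min hd htb')
      have hsK : s ∉ K := fun hs => absurd (le_csSup hKb hs) (not_le.mpr hs1)
      refine hsK ⟨hat.trans hs1.le, (hs2.trans_le (min_le_right _ _)).le, ?_⟩
      refine hS.leftVal_le_of_forall_lt (lt_of_le_of_lt zero_le hs1).ne' fun r hr => ?_
      obtain ⟨q, hq, e⟩ := exists_jumpGain_eq_runMax hf hg r
      rw [← e]
      rcases le_or_gt q t with h' | h'
      · exact (jumpGain_le_runMax hf hg h').trans h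
      · exact (le_of_lt (hsub ⟨h', hq.trans_lt (hr.trans (hs2.trans_le (min_le_left _ _)))⟩)).trans
          h
    · rw [if_neg (hnotlf _ h rfl)]
      rcases runMax_eq hf hg t with h' | h'
      · exact absurd (h' ▸ htc) (not_le.mpr h)
      · exact h'.le

open Classical in
-- All bounds come from monotonicity of `runMax` and from its being an upper bound of the gain. On a
-- one-point interval covered from both sides, the second inequality would be reversed; hence `hne`.
theorem record_bounds {lf rf : Prop} {a b t : ℝ≥0} (hne : ¬ (lf ∧ rf ∧ a = b))
    (hat : a ≤ t) (htb : t ≤ b) :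
    leftEnd (runMax f g) lf a ≤ (if lf ∧ t = a then runMax f g t else leftVal (runMax f g) t) ∧
    (if lf ∧ t = a then runMax f g t else leftVal (runMax f g) t) ≤
      (if rf ∧ t = b then leftVal (runMax f g) t else runMax f g t) ∧
    (if rf ∧ t = b then leftVal (runMax f g) t else runMax f g t) ≤
      rightEnd (runMax f g) rf b ∧
    crossGain f g lf rf a b t ≤
      (if rf ∧ t = b then leftVal (runMax f g) t else runMax f g t) := by
  have hS := isCadlagPos_runMax hf hg
  have hm := monotone_runMax hf hg
  refine ⟨?_, ?_, ?_, ?_⟩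
  · rcases hat.eq_or_lt with rfl | h
    · unfold leftEnd
      by_cases lf <;> simp [*]
    · rw [if_neg fun h' => h.ne' h'.2]
      refine le_trans ?_ (leftVal_runMax_mono hf hg h)
      unfold leftEnd
      split_ifs
      · exact le_rfl
      · exact hS.jump_nonneg a
  · split_ifs with h1 h2
    · exact absurd ⟨h1.1, h2.1, h1.2.symm.trans h2.2⟩ hne
    · exact le_rfl
    · exact le_rfl
    · exact hS.jump_nonneg t
  · rcases htb.eq_or_lt with rfl | h
    · unfold rightEnd
      by_cases rf <;> simp [*]
    · rw [if_neg fun h' => h.ne h'.2]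
      unfold rightEnd
      split_ifs
      · exact leftVal_runMax_mono hf hg h
      · exact hm h.le
  · unfold crossGain
    split_ifs with h1 h2 h2
    · exact absurd ⟨h2.1, h1.1, h2.2.symm.trans h1.2⟩ hne
    · exact leftVal_sub_le_leftVal_runMax hf hg t
    · exact (hf.sub_le_jumpGain g t).trans (jumpGain_le_runMax hf hg le_rfl)
    · exact jumpGain_le_runMax hf hg le_rfl

/-- The optimal crossing gain changes under the Pitman transform by a boundary term. -/
theorem exists_crossGain_pitman_ge (lf rf : Prop) {a b t : ℝ≥0} (hat : a ≤ t) (htb : t ≤ b) :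
    ∃ t', a ≤ t' ∧ t' ≤ b ∧
      crossGain f g lf rf a b t - leftEnd (runMax f g) lf a - rightEnd (runMax f g) rf b ≤
      crossGain (fun s => f s + runMax f g s) (fun s => g s - runMax f g s) lf rf a b t' := by
  by_cases hne : lf ∧ rf ∧ a = b
  · obtain ⟨h1, h2, rfl⟩ := hne
    obtain rfl := le_antisymm hat htb
    refine ⟨a, le_rfl, le_rfl, ?_⟩
    rw [crossGain_pitman hf hg]
    simp [leftEnd, rightEnd, h1, h2]
  obtain ⟨b1, b2, b3, b4⟩ := record_bounds hf hg hne hat htb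
  -- Without a new record all the bounds coincide and `t` itself serves. With one, the old optimum
  -- is at most `rightEnd` and the first record achieves at least `-leftEnd` after the transform.
  rcases le_or_gt (rightEnd (runMax f g) rf b) (leftEnd (runMax f g) lf a) with h | h
  · refine ⟨t, hat, htb, ?_⟩
    rw [crossGain_pitman hf hg]
    linarith
  · obtain ⟨t', h1, h2, h3, h4⟩ := exists_first_record hf hg (hat.trans htb) h
    refine ⟨t', h1, h2, ?_⟩
    rw [crossGain_pitman hf hg]
    linarith

theorem exists_crossGain_ge_pitman (lf rf : Prop) {a b t : ℝ≥0} (hat : a ≤ t) (htb : t ≤ b) :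
    ∃ t', a ≤ t' ∧ t' ≤ b ∧
      crossGain (fun s => f s + runMax f g s) (fun s => g s - runMax f g s) lf rf a b t ≤
      crossGain f g lf rf a b t' - leftEnd (runMax f g) lf a - rightEnd (runMax f g) rf b := by
  by_cases hne : lf ∧ rf ∧ a = b
  · obtain ⟨h1, h2, rfl⟩ := hne
    obtain rfl := le_antisymm hat htb
    refine ⟨a, le_rfl, le_rfl, ?_⟩
    rw [crossGain_pitman hf hg]
    simp [leftEnd, rightEnd, h1, h2]
  obtain ⟨b1, b2, b3, b4⟩ := record_bounds hf hg hne hat htb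
  -- With a new record, no crossing gains more than `-leftEnd` after the transform, while some
  -- crossing gains at least `rightEnd` before it.
  rcases le_or_gt (rightEnd (runMax f g) rf b) (leftEnd (runMax f g) lf a) with h | h
  · refine ⟨t, hat, htb, ?_⟩
    rw [crossGain_pitman hf hg]
    linarith
  · obtain ⟨t', h1, h2, h3⟩ := exists_crossGain_eq_rightEnd hf hg (hat.trans htb) hne h
    refine ⟨t', h1, h2, ?_⟩
    rw [crossGain_pitman hf hg]
    linarith

end CrossGain

/-! ### Tuples of paths as arrays of jump times; tuples on two lines -/

/-- The weight of the gap between two consecutive intervals on a line, the first ending at `b` and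
the second starting at `a`. -/
def gapWeight (g : ℝ≥0 → ℝ) (b a : ℝ≥0) : ℝ := if b < a then g b - leftVal g a else 0

/-- The weight of the union of the intervals `[a 0, b 0], …, [a k, b k]`. -/
def lineWeight (g : ℝ≥0 → ℝ) (k : ℕ) (a b : ℕ → ℝ≥0) : ℝ :=
  g (b k) - leftVal g (a 0) + ∑ j ∈ Finset.range k, gapWeight g (b j) (a (j + 1))

/-- The jump times of a disjoint `(k + 1)`-tuple of paths from `(x, n)` to `(y, 1)`. -/
structure IsInterlaced (n k : ℕ) (x y : ℝ≥0) (T : ℕ → ℕ → ℝ≥0) : Prop where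
  top : ∀ j ≤ k, T j 0 = y
  bot : ∀ j ≤ k, T j n = x
  anti : ∀ j ≤ k, ∀ l < n, T j (l + 1) ≤ T j l
  inter : ∀ j < k, ∀ l < n, T j l ≤ T (j + 1) (l + 1)

/-- The length of the `(k + 1)`-tuple of paths with jump times `T`. -/
def weight (F : ℕ → ℝ≥0 → ℝ) (n k : ℕ) (T : ℕ → ℕ → ℝ≥0) : ℝ :=
  ∑ l ∈ Finset.range n, lineWeight (F l) k (fun j => T j (l + 1)) fun j => T j l

section TwoLines

variable {k : ℕ} (p q : ℕ → ℝ≥0)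

/-- The crossing time of path `j` is covered by path `j - 1` at its left end. -/
def leftFlag (j : ℕ) : Prop := 0 < j ∧ p j ≤ q (j - 1)

/-- The crossing time of path `j` is covered by path `j + 1` at its right end. -/
def rightFlag (k j : ℕ) : Prop := j < k ∧ p (j + 1) ≤ q j

/-- The earliest crossing time of path `j`. -/
def crossMin (j : ℕ) : ℝ≥0 := if 0 < j then max (p j) (q (j - 1)) else p j

/-- The latest crossing time of path `j`. -/
def crossMax (k j : ℕ) : ℝ≥0 := if j < k then min (q j) (p (j + 1)) else q j

/-- Once `p` and `q` are fixed, the constraints on the crossing times decouple: each `t j` ranges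
over `[crossMin, crossMax]` independently, and the gaps on the two lines regroup by path. The flags
account for touching intervals, whose gap has weight zero. -/
theorem lineWeight_add_lineWeight (f g : ℝ≥0 → ℝ) {t : ℕ → ℝ≥0}
    (h1 : ∀ j ≤ k, p j ≤ t j) (h2 : ∀ j ≤ k, t j ≤ q j)
    (h3 : ∀ j < k, q j ≤ t (j + 1)) (h4 : ∀ j < k, t j ≤ p (j + 1)) :
    lineWeight f k t q + lineWeight g k p t =
      ∑ j ∈ Finset.range (k + 1), f (q j) - ∑ j ∈ Finset.range (k + 1), leftVal g (p j) +
      ∑ j ∈ Finset.range (k + 1), crossGain f g (leftFlag p q j) (rightFlag p q k j)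
        (crossMin p q j) (crossMax p q k j) (t j) := by
  classical
  have e1 : ∀ j ∈ Finset.range k, gapWeight f (q j) (t (j + 1)) =
      f (q j) - if leftFlag p q (j + 1) ∧ t (j + 1) = crossMin p q (j + 1) then f (t (j + 1))
        else leftVal f (t (j + 1)) := by
    intro j hj
    have hj := Finset.mem_range.mp hj
    have a1 := h1 (j + 1) hj
    have a3 := h3 j hj
    simp only [gapWeight, leftFlag, crossMin, Nat.succ_pos, true_and, if_true,
      Nat.add_sub_cancel]
    rcases a3.lt_or_eq with h | h
    · rw [if_pos h, if_neg]
      rintro ⟨h5, h6⟩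
      rw [max_eq_right h5] at h6
      exact h.ne' h6
    · rw [if_neg h.not_lt, if_pos ⟨h ▸ a1, by rw [max_eq_right (h ▸ a1), h]⟩, h, sub_self]
  have e2 : ∀ j ∈ Finset.range k, gapWeight g (t j) (p (j + 1)) =
      (if rightFlag p q k j ∧ t j = crossMax p q k j then leftVal g (t j) else g (t j)) -
        leftVal g (p (j + 1)) := by
    intro j hj
    have hj := Finset.mem_range.mp hj
    have a1 := h2 j hj.le
    have a3 := h4 j hj
    simp only [gapWeight, rightFlag, crossMax, hj, true_and, if_true]
    rcases a3.lt_or_eq with h | h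
    · rw [if_pos h, if_neg]
      rintro ⟨h5, h6⟩
      rw [min_eq_right h5] at h6
      exact h.ne h6
    · rw [if_neg h.not_lt, if_pos ⟨h ▸ a1, by rw [min_eq_right (h ▸ a1), h]⟩, h, sub_self]
  have e3 : ¬ (leftFlag p q 0 ∧ t 0 = crossMin p q 0) := fun h => absurd h.1.1 (lt_irrefl _)
  have e4 : ¬ (rightFlag p q k k ∧ t k = crossMax p q k k) :=
    fun h => absurd h.1.1 (lt_irrefl _)
  simp only [lineWeight, crossGain, Finset.sum_sub_distrib]
  rw [Finset.sum_congr rfl e1, Finset.sum_congr rfl e2, Finset.sum_sub_distrib,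
    Finset.sum_sub_distrib, Finset.sum_range_succ (fun j => f (q j)),
    Finset.sum_range_succ' (fun j => leftVal g (p j)),
    Finset.sum_range_succ' (fun j => if leftFlag p q j ∧ t j = crossMin p q j then f (t j)
        else leftVal f (t j)),
    Finset.sum_range_succ (fun j => if rightFlag p q k j ∧ t j = crossMax p q k j
      then leftVal g (t j) else g (t j)), if_neg e3, if_neg e4]
  ring

/-- `crossMin` of path `j + 1` and `crossMax` of path `j` are the larger and the smaller of `p (j +
1)` and `q j`, and the flags assign the value to `q j` and the left value to `p (j + 1)` in either
order. The total is what the outer ends gain when `S` is added to the upper line and subtracted from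
the lower one. -/
theorem sum_leftEnd_add_rightEnd (S : ℝ≥0 → ℝ) :
    ∑ j ∈ Finset.range (k + 1), (leftEnd S (leftFlag p q j) (crossMin p q j) +
        rightEnd S (rightFlag p q k j) (crossMax p q k j)) =
      ∑ j ∈ Finset.range (k + 1), S (q j) + ∑ j ∈ Finset.range (k + 1), leftVal S (p j) := by
  classical
  have e : ∀ j ∈ Finset.range k, leftEnd S (leftFlag p q (j + 1)) (crossMin p q (j + 1)) +
      rightEnd S (rightFlag p q k j) (crossMax p q k j) = S (q j) + leftVal S (p (j + 1)) := by
    intro j hj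
    have hj := Finset.mem_range.mp hj
    simp only [leftEnd, rightEnd, leftFlag, rightFlag, crossMin, crossMax, hj, Nat.succ_pos,
      true_and, if_true, Nat.add_sub_cancel]
    rcases le_or_gt (p (j + 1)) (q j) with h | h
    · rw [if_pos h, if_pos h, max_eq_right h, min_eq_right h]
    · rw [if_neg h.not_ge, if_neg h.not_ge, max_eq_left h.le, min_eq_left h.le, add_comm]
  rw [Finset.sum_add_distrib, Finset.sum_range_succ', Finset.sum_range_succ (fun j =>
    rightEnd S (rightFlag p q k j) (crossMax p q k j))]
  have e' := Finset.sum_congr rfl e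
  rw [Finset.sum_add_distrib, Finset.sum_add_distrib] at e'
  have e3 : leftEnd S (leftFlag p q 0) (crossMin p q 0) = leftVal S (p 0) := by
    simp [leftEnd, leftFlag, crossMin]
  have e4 : rightEnd S (rightFlag p q k k) (crossMax p q k k) = S (q k) := by
    simp [rightEnd, rightFlag, crossMax]
  rw [e3, e4, Finset.sum_range_succ (fun j => S (q j)),
    Finset.sum_range_succ' (fun j => leftVal S (p j))]
  linarith

theorem crossMin_le {t : ℕ → ℝ≥0} (h1 : ∀ j ≤ k, p j ≤ t j) (h3 : ∀ j < k, q j ≤ t (j + 1))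
    {j : ℕ} (hj : j ≤ k) : crossMin p q j ≤ t j := by
  unfold crossMin
  split_ifs with h
  · obtain ⟨i, rfl⟩ := Nat.exists_eq_add_of_lt h
    simp only [zero_add] at *
    exact max_le (h1 _ hj) (h3 i hj)
  · exact h1 j hj

theorem le_crossMax {t : ℕ → ℝ≥0} (h2 : ∀ j ≤ k, t j ≤ q j) (h4 : ∀ j < k, t j ≤ p (j + 1))
    {j : ℕ} (hj : j ≤ k) : t j ≤ crossMax p q k j := by
  unfold crossMax
  split_ifs with h
  · exact le_min (h2 j hj) (h4 j h)
  · exact h2 j hj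

theorem of_crossMin_le {t : ℕ → ℝ≥0} (h : ∀ j ≤ k, crossMin p q j ≤ t j) :
    (∀ j ≤ k, p j ≤ t j) ∧ ∀ j < k, q j ≤ t (j + 1) := by
  refine ⟨fun j hj => le_trans ?_ (h j hj), fun j hj => le_trans ?_ (h (j + 1) hj)⟩
  · unfold crossMin; split_ifs
    · exact le_max_left _ _
    · exact le_rfl
  · simp [crossMin]

theorem of_le_crossMax {t : ℕ → ℝ≥0} (h : ∀ j ≤ k, t j ≤ crossMax p q k j) :
    (∀ j ≤ k, t j ≤ q j) ∧ ∀ j < k, t j ≤ p (j + 1) := by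
  refine ⟨fun j hj => le_trans (h j hj) ?_, fun j hj => le_trans (h j hj.le) ?_⟩
  · unfold crossMax; split_ifs
    · exact min_le_left _ _
    · exact le_rfl
  · simp [crossMax, hj]

variable {f g : ℝ≥0 → ℝ} (hf : IsCadlagPos f) (hg : IsCadlagPos g)
include hf hg

theorem exists_lineWeight_pitman_ge {t : ℕ → ℝ≥0}
    (h1 : ∀ j ≤ k, p j ≤ t j) (h2 : ∀ j ≤ k, t j ≤ q j)
    (h3 : ∀ j < k, q j ≤ t (j + 1)) (h4 : ∀ j < k, t j ≤ p (j + 1)) :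
    ∃ t' : ℕ → ℝ≥0, (∀ j ≤ k, p j ≤ t' j) ∧ (∀ j ≤ k, t' j ≤ q j) ∧
      (∀ j < k, q j ≤ t' (j + 1)) ∧ (∀ j < k, t' j ≤ p (j + 1)) ∧
      lineWeight f k t q + lineWeight g k p t ≤
        lineWeight (fun s => f s + runMax f g s) k t' q +
          lineWeight (fun s => g s - runMax f g s) k p t' := by
  have key : ∀ j, ∃ t', j ≤ k → crossMin p q j ≤ t' ∧ t' ≤ crossMax p q k j ∧ _ := fun j => by
    by_cases hj : j ≤ k
    · obtain ⟨t', h⟩ := exists_crossGain_pitman_ge hf hg (leftFlag p q j) (rightFlag p q k j)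
        (crossMin_le p q h1 h3 hj) (le_crossMax p q h2 h4 hj)
      exact ⟨t', fun _ => h⟩
    · exact ⟨0, fun h => absurd h hj⟩
  choose t' ht' using key
  obtain ⟨a1, a3⟩ := of_crossMin_le p q fun j hj => (ht' j hj).1
  obtain ⟨a2, a4⟩ := of_le_crossMax p q fun j hj => (ht' j hj).2.1
  refine ⟨t', a1, a2, a3, a4, ?_⟩
  rw [lineWeight_add_lineWeight p q f g h1 h2 h3 h4,
    lineWeight_add_lineWeight p q _ _ a1 a2 a3 a4]
  have hsum := Finset.sum_le_sum fun j (hj : j ∈ Finset.range (k + 1)) =>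
    (ht' j (Nat.lt_succ_iff.mp (Finset.mem_range.mp hj))).2.2
  have hends := sum_leftEnd_add_rightEnd (k := k) p q (runMax f g)
  simp only [hg.leftVal_sub (isCadlagPos_runMax hf hg), Finset.sum_add_distrib,
    Finset.sum_sub_distrib] at hsum hends ⊢
  linarith

theorem exists_lineWeight_ge_pitman {t : ℕ → ℝ≥0}
    (h1 : ∀ j ≤ k, p j ≤ t j) (h2 : ∀ j ≤ k, t j ≤ q j)
    (h3 : ∀ j < k, q j ≤ t (j + 1)) (h4 : ∀ j < k, t j ≤ p (j + 1)) :
    ∃ t' : ℕ → ℝ≥0, (∀ j ≤ k, p j ≤ t' j) ∧ (∀ j ≤ k, t' j ≤ q j) ∧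
      (∀ j < k, q j ≤ t' (j + 1)) ∧ (∀ j < k, t' j ≤ p (j + 1)) ∧
      lineWeight (fun s => f s + runMax f g s) k t q +
          lineWeight (fun s => g s - runMax f g s) k p t ≤
        lineWeight f k t' q + lineWeight g k p t' := by
  have key : ∀ j, ∃ t', j ≤ k → crossMin p q j ≤ t' ∧ t' ≤ crossMax p q k j ∧ _ := fun j => by
    by_cases hj : j ≤ k
    · obtain ⟨t', h⟩ := exists_crossGain_ge_pitman hf hg (leftFlag p q j) (rightFlag p q k j)
        (crossMin_le p q h1 h3 hj) (le_crossMax p q h2 h4 hj)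
      exact ⟨t', fun _ => h⟩
    · exact ⟨0, fun h => absurd h hj⟩
  choose t' ht' using key
  obtain ⟨a1, a3⟩ := of_crossMin_le p q fun j hj => (ht' j hj).1
  obtain ⟨a2, a4⟩ := of_le_crossMax p q fun j hj => (ht' j hj).2.1
  refine ⟨t', a1, a2, a3, a4, ?_⟩
  rw [lineWeight_add_lineWeight p q f g a1 a2 a3 a4,
    lineWeight_add_lineWeight p q _ _ h1 h2 h3 h4]
  have hsum := Finset.sum_le_sum fun j (hj : j ∈ Finset.range (k + 1)) =>
    (ht' j (Nat.lt_succ_iff.mp (Finset.mem_range.mp hj))).2.2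
  have hends := sum_leftEnd_add_rightEnd (k := k) p q (runMax f g)
  simp only [hg.leftVal_sub (isCadlagPos_runMax hf hg), Finset.sum_add_distrib,
    Finset.sum_sub_distrib] at hsum hends ⊢
  linarith

end TwoLines

/-! ### The Pitman transform as an isometry of all lines -/

/-- The Pitman transform of the lines `i` and `i + 1`. -/
def pitman (i : ℕ) (F : ℕ → ℝ≥0 → ℝ) (l : ℕ) : ℝ≥0 → ℝ :=
  if l = i then fun s => F i s + runMax (F i) (F (i + 1)) s
  else if l = i + 1 then fun s => F (i + 1) s - runMax (F i) (F (i + 1)) s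
  else F l

theorem pitman_self (i : ℕ) (F : ℕ → ℝ≥0 → ℝ) :
    pitman i F i = fun s => F i s + runMax (F i) (F (i + 1)) s := if_pos rfl

theorem pitman_succ (i : ℕ) (F : ℕ → ℝ≥0 → ℝ) :
    pitman i F (i + 1) = fun s => F (i + 1) s - runMax (F i) (F (i + 1)) s := by
  simp [pitman]

theorem pitman_of_ne {i l : ℕ} (F : ℕ → ℝ≥0 → ℝ) (h1 : l ≠ i) (h2 : l ≠ i + 1) :
    pitman i F l = F l := by
  simp [pitman, h1, h2]

theorem isCadlagPos_pitman {F : ℕ → ℝ≥0 → ℝ} (hF : ∀ l, IsCadlagPos (F l)) (i l : ℕ) :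
    IsCadlagPos (pitman i F l) := by
  unfold pitman
  split_ifs
  · exact isCadlagPos_pitmanTop (hF i) (hF (i + 1))
  · exact isCadlagPos_pitmanBot (hF i) (hF (i + 1))
  · exact hF l

/-- Every tuple of paths in the environment `F` has a counterpart in `G` that is as long. -/
def Dominated (n : ℕ) (F G : ℕ → ℝ≥0 → ℝ) : Prop :=
  ∀ k x y T, IsInterlaced n k x y T →
    ∃ T', IsInterlaced n k x y T' ∧ weight F n k T ≤ weight G n k T'

/-- `F` and `G` have the same last passage values. -/
def Isometric (n : ℕ) (F G : ℕ → ℝ≥0 → ℝ) : Prop := Dominated n F G ∧ Dominated n G F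

theorem Dominated.trans {n : ℕ} {F G H : ℕ → ℝ≥0 → ℝ} (h1 : Dominated n F G)
    (h2 : Dominated n G H) : Dominated n F H := fun k x y T hT => by
  obtain ⟨T', hT', h⟩ := h1 k x y T hT
  obtain ⟨T'', hT'', h'⟩ := h2 k x y T' hT'
  exact ⟨T'', hT'', h.trans h'⟩

theorem Isometric.refl (n : ℕ) (F : ℕ → ℝ≥0 → ℝ) : Isometric n F F :=
  ⟨fun _ _ _ T hT => ⟨T, hT, le_rfl⟩, fun _ _ _ T hT => ⟨T, hT, le_rfl⟩⟩

theorem Isometric.symm {n : ℕ} {F G : ℕ → ℝ≥0 → ℝ} (h : Isometric n F G) : Isometric n G F :=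
  ⟨h.2, h.1⟩

theorem Isometric.trans {n : ℕ} {F G H : ℕ → ℝ≥0 → ℝ} (h1 : Isometric n F G)
    (h2 : Isometric n G H) : Isometric n F H := ⟨h1.1.trans h2.1, h2.2.trans h1.2⟩

/-- A comparison on two adjacent lines carries over to all lines. -/
theorem dominated_of_two_lines {n i : ℕ} (hi : i + 1 < n) {F G : ℕ → ℝ≥0 → ℝ}
    (hFG : ∀ l, l ≠ i → l ≠ i + 1 → F l = G l)
    (h : ∀ (k : ℕ) (p q t : ℕ → ℝ≥0), (∀ j ≤ k, p j ≤ t j) → (∀ j ≤ k, t j ≤ q j) →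
      (∀ j < k, q j ≤ t (j + 1)) → (∀ j < k, t j ≤ p (j + 1)) →
      ∃ t' : ℕ → ℝ≥0, (∀ j ≤ k, p j ≤ t' j) ∧ (∀ j ≤ k, t' j ≤ q j) ∧
        (∀ j < k, q j ≤ t' (j + 1)) ∧ (∀ j < k, t' j ≤ p (j + 1)) ∧
        lineWeight (F i) k t q + lineWeight (F (i + 1)) k p t ≤
          lineWeight (G i) k t' q + lineWeight (G (i + 1)) k p t') :
    Dominated n F G := by
  intro k x y T hT
  -- Only the crossings between lines `i` and `i + 1` move; the entrances to the lower line and the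
  -- exits from the upper line stay fixed.
  obtain ⟨t', a1, a2, a3, a4, hle⟩ := h k (fun j => T j (i + 1 + 1)) (fun j => T j i)
    (fun j => T j (i + 1)) (fun j hj => hT.anti j hj _ hi)
    (fun j hj => hT.anti j hj _ (by omega)) (fun j hj => hT.inter j hj _ (by omega))
    (fun j hj => hT.inter j hj _ hi)
  set T' : ℕ → ℕ → ℝ≥0 := fun j l => if l = i + 1 then t' j else T j l with hT'
  have e1 : ∀ j, T' j (i + 1) = t' j := fun j => if_pos rfl
  have e2 : ∀ j l, l ≠ i + 1 → T' j l = T j l := fun j l hl => if_neg hl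
  refine ⟨T', ⟨?_, ?_, ?_, ?_⟩, ?_⟩
  · intro j hj; rw [e2 j 0 (by omega), hT.top j hj]
  · intro j hj; rw [e2 j n (by omega), hT.bot j hj]
  · intro j hj l hl
    by_cases h1 : l = i
    · subst h1; rw [e1, e2 j l (by omega)]; exact a2 j hj
    by_cases h2 : l = i + 1
    · subst h2; rw [e1, e2 j _ (by omega)]; exact a1 j hj
    · rw [e2 j l h2, e2 j (l + 1) (by omega)]; exact hT.anti j hj l hl
  · intro j hj l hl
    by_cases h1 : l = i
    · subst h1; rw [e1, e2 j l (by omega)]; exact a3 j hj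
    by_cases h2 : l = i + 1
    · subst h2; rw [e1, e2 (j + 1) _ (by omega)]; exact a4 j hj
    · rw [e2 j l h2, e2 (j + 1) (l + 1) (by omega)]; exact hT.inter j hj l hl
  · rw [← sub_nonneg, weight, weight, ← Finset.sum_sub_distrib,
      ← Finset.sum_subset (s₁ := {i, i + 1}), Finset.sum_pair (by omega)]
    · simp only [e1, e2 _ i (by omega : i ≠ i + 1), e2 _ (i + 1 + 1) (by omega : i + 1 + 1 ≠ i + 1)]
      linarith
    · intro l hl
      simp only [Finset.mem_insert, Finset.mem_singleton] at hl
      rw [Finset.mem_range]; omega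
    · intro l _ hl
      simp only [Finset.mem_insert, Finset.mem_singleton, not_or] at hl
      simp only [e2 _ l hl.2, e2 _ (l + 1) (by omega : l + 1 ≠ i + 1), hFG l hl.1 hl.2, sub_self]

/-- The Pitman transform is an isometry. -/
theorem isometric_pitman {n i : ℕ} (hi : i + 1 < n) {F : ℕ → ℝ≥0 → ℝ}
    (hF : ∀ l, IsCadlagPos (F l)) : Isometric n F (pitman i F) := by
  constructor
  · refine dominated_of_two_lines hi (fun l h1 h2 => (pitman_of_ne F h1 h2).symm) ?_
    intro k p q t h1 h2 h3 h4
    rw [pitman_self, pitman_succ]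
    exact exists_lineWeight_pitman_ge p q (hF i) (hF (i + 1)) h1 h2 h3 h4
  · refine dominated_of_two_lines hi (fun l h1 h2 => pitman_of_ne F h1 h2) ?_
    intro k p q t h1 h2 h3 h4
    rw [pitman_self, pitman_succ]
    exact exists_lineWeight_ge_pitman p q (hF i) (hF (i + 1)) h1 h2 h3 h4

/-! ### Sorting the lines by Pitman transforms -/

/-- The first `m` lines are Pitman ordered. -/
def Ordered (m : ℕ) (F : ℕ → ℝ≥0 → ℝ) : Prop :=
  ∀ l, l + 1 < m → ∀ y, F (l + 1) y ≤ leftVal (F l) y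

/-- Inserting the line `i` into the ordered lines above it. -/
theorem exists_ordered_insert {n m : ℕ} (hm : m < n) : ∀ (i : ℕ), i ≤ m →
    ∀ F : ℕ → ℝ≥0 → ℝ, (∀ l, IsCadlagPos (F l)) → Ordered i F →
    (∀ l, i < l → l < m → ∀ y, F (l + 1) y ≤ leftVal (F l) y) →
    (i < m → ∀ y, F (i + 1) y ≤ leftVal (F i) y) →
    (i < m → ∀ a, i = a + 1 → ∀ y, ∀ s < y,
      F (i + 1) y ≤ leftVal (F i) y - F i s + leftVal (F a) s) →
    ∃ G : ℕ → ℝ≥0 → ℝ, (∀ l, IsCadlagPos (G l)) ∧ Isometric n F G ∧ Ordered (m + 1) G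
  | 0, _, F, hF, _, h2, h3, _ => by
    refine ⟨F, hF, Isometric.refl n F, fun l hl y => ?_⟩
    rcases Nat.eq_zero_or_pos l with rfl | h
    · exact h3 (by omega) y
    · exact h2 l h (by omega) y
  | a + 1, ha, F, hF, h1, h2, h3, h4 => by
    have hS := isCadlagPos_runMax (hF a) (hF (a + 1))
    have hlvtop : ∀ y, leftVal (pitman a F a) y =
        leftVal (F a) y + leftVal (runMax (F a) (F (a + 1))) y := fun y => by
      rw [pitman_self, (hF a).leftVal_add hS]
    have hlvbot : ∀ y, leftVal (pitman a F (a + 1)) y =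
        leftVal (F (a + 1)) y - leftVal (runMax (F a) (F (a + 1))) y := fun y => by
      rw [pitman_succ, (hF (a + 1)).leftVal_sub hS]
    -- The transform orders lines `a` and `a + 1`, so that the only possible defect moves up to the
    -- pair above. The last hypothesis ensures that line `a + 1`, lowered by the running maximum,
    -- still dominates the line below it.
    refine Exists.elim (exists_ordered_insert hm a (by omega) (pitman a F)
      (isCadlagPos_pitman hF a) ?_ ?_ ?_ ?_) fun G h =>
        ⟨G, h.1, (isometric_pitman (by omega) hF).trans h.2.1, h.2.2⟩
    · intro l hl y
      rw [pitman_of_ne F (by omega) (by omega), pitman_of_ne F (by omega) (by omega)]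
      exact h1 l (by omega) y
    · intro l hl hlm y
      rcases eq_or_ne l (a + 1) with rfl | hne
      · rw [hlvbot, pitman_of_ne F (by omega) (by omega)]
        rcases eq_or_ne y 0 with rfl | hy
        · simpa using h3 hlm 0
        -- The running maximum before `y` consists of gains at times `r < y`, which are exactly what
        -- `h4` bounds.
        have : leftVal (runMax (F a) (F (a + 1))) y ≤
            leftVal (F (a + 1)) y - F (a + 1 + 1) y := by
          refine hS.leftVal_le_of_forall_lt hy fun s hs => ?_
          obtain ⟨r, hr, e⟩ := exists_jumpGain_eq_runMax (hF a) (hF (a + 1)) s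
          rw [← e, jumpGain]
          linarith [h4 hlm a rfl y r (hr.trans_lt hs)]
        linarith
      · rw [pitman_of_ne F (by omega) (by omega), pitman_of_ne F (by omega) (by omega)]
        exact h2 l (by omega) hlm y
    · intro _ y
      rw [hlvtop, pitman_succ]
      have b1 := jumpGain_le_runMax (hF a) (hF (a + 1)) (le_refl y)
      have b2 := leftVal_runMax_nonneg (hF a) (hF (a + 1)) y
      rw [jumpGain] at b1
      linarith
    · rintro _ b rfl y s hs
      rw [hlvtop, pitman_self, pitman_succ, pitman_of_ne F (by omega : b ≠ b + 1) (by omega)]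
      have b1 := jumpGain_le_runMax (hF (b + 1)) (hF (b + 1 + 1)) (le_refl y)
      have b2 := leftVal_runMax_mono (hF (b + 1)) (hF (b + 1 + 1)) hs
      have b3 := h1 b (by omega) s
      rw [jumpGain] at b1
      simp only
      linarith

/-- This is insertion sort: lines join one at a time, and each is carried upwards by transforms of
adjacent lines. -/
theorem exists_ordered_isometric (n : ℕ) {F : ℕ → ℝ≥0 → ℝ} (hF : ∀ l, IsCadlagPos (F l)) :
    ∃ G : ℕ → ℝ≥0 → ℝ, (∀ l, IsCadlagPos (G l)) ∧ Isometric n F G ∧ Ordered n G := by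
  have key : ∀ m ≤ n, ∃ G : ℕ → ℝ≥0 → ℝ,
      (∀ l, IsCadlagPos (G l)) ∧ Isometric n F G ∧ Ordered m G := by
    intro m
    induction m with
    | zero => exact fun _ => ⟨F, hF, Isometric.refl n F, fun l hl => absurd hl (by omega)⟩
    | succ m ih =>
      intro hm
      obtain ⟨G, hG, hiso, hord⟩ := ih (by omega)
      obtain ⟨H, hH, hiso', hord'⟩ := exists_ordered_insert hm m le_rfl G hG hord
        (fun l h h' => absurd h (by omega)) (fun h => absurd h (by omega))
        (fun h => absurd h (by omega))
      exact ⟨H, hH, hiso.trans hiso', hord'⟩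
  exact key n le_rfl

/-! ### Forced jumps, and the earliest and latest tuples -/

namespace IsInterlaced

variable {n k d : ℕ} {x y : ℝ≥0} {T : ℕ → ℕ → ℝ≥0}

theorem le_of_le (hT : IsInterlaced n k x y T) {j l m : ℕ} (hj : j ≤ k) (hlm : l ≤ m)
    (hm : m ≤ n) : T j m ≤ T j l := by
  induction m, hlm using Nat.le_induction with
  | base => exact le_rfl
  | succ m hm' ih => exact (hT.anti j hj m (by omega)).trans (ih (by omega))

theorem le_top (hT : IsInterlaced n k x y T) {j l : ℕ} (hj : j ≤ k) (hl : l ≤ n) : T j l ≤ y :=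
  hT.top j hj ▸ hT.le_of_le hj (Nat.zero_le l) hl

theorem bot_le (hT : IsInterlaced n k x y T) {j l : ℕ} (hj : j ≤ k) (hl : l ≤ n) : x ≤ T j l :=
  hT.bot j hj ▸ hT.le_of_le hj hl le_rfl

/-- Interlacing steps back one path and one line at a time: `T j l ≥ T (j - 1) (l - 1) ≥ ⋯ ≥ T (j -
l) 0 = y`. The bottom version `eq_bot` is the mirror image, and of each path only `d` jumps remain
free. -/
theorem eq_top (hT : IsInterlaced n k x y T) {j : ℕ} : ∀ {l : ℕ}, j ≤ k → l ≤ n → l ≤ j →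
    T j l = y := by
  induction j with
  | zero => intro l hj hl hlj; obtain rfl : l = 0 := by omega
            exact hT.top 0 hj
  | succ j ih =>
    intro l hj hl hlj
    rcases Nat.eq_zero_or_pos l with rfl | h
    · exact hT.top _ hj
    · obtain ⟨l, rfl⟩ : ∃ m, l = m + 1 := ⟨l - 1, by omega⟩
      refine le_antisymm (hT.le_top hj hl) ?_
      rw [← ih (l := l) (by omega) (by omega) (by omega)]
      exact hT.inter j (by omega) l (by omega)

theorem eq_bot_aux (hT : IsInterlaced n k x y T) (i : ℕ) : ∀ {j l : ℕ}, j + i = k → l ≤ n →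
    n ≤ l + i → T j l = x := by
  induction i with
  | zero => intro j l hj hl hlj; obtain rfl : l = n := by omega
            exact hT.bot j (by omega)
  | succ i ih =>
    intro j l hj hl hlj
    rcases hl.eq_or_lt with rfl | h
    · exact hT.bot _ (by omega)
    · refine le_antisymm ?_ (hT.bot_le (by omega) hl)
      rw [← ih (j := j + 1) (l := l + 1) (by omega) (by omega) (by omega)]
      exact hT.inter j (by omega) l (by omega)

theorem eq_bot (hT : IsInterlaced (d + k + 1) k x y T) {j l : ℕ} (hj : j ≤ k)
    (hl : l ≤ d + k + 1) (h : d + j < l) : T j l = x :=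
  hT.eq_bot_aux (k - j) (by omega) hl (by omega)

end IsInterlaced

theorem gapWeight_self (g : ℝ≥0 → ℝ) (a : ℝ≥0) : gapWeight g a a = 0 := if_neg (lt_irrefl a)

/-- For touching intervals the right side is a jump of `g`, which is nonnegative. -/
theorem gapWeight_le {g : ℝ≥0 → ℝ} (hg : IsCadlagPos g) {b a : ℝ≥0} (h : b ≤ a) :
    gapWeight g b a ≤ g b - leftVal g a := by
  unfold gapWeight
  split_ifs with h'
  · exact le_rfl
  · obtain rfl := le_antisymm h (not_lt.mp h')
    linarith [hg.jump_nonneg b]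

theorem weight_eq (F : ℕ → ℝ≥0 → ℝ) (n k : ℕ) (T : ℕ → ℕ → ℝ≥0) :
    weight F n k T = ∑ l ∈ Finset.range n, F l (T k l) -
      ∑ l ∈ Finset.range n, leftVal (F l) (T 0 (l + 1)) +
      ∑ j ∈ Finset.range k, ∑ l ∈ Finset.range n, gapWeight (F l) (T j l) (T (j + 1) (l + 1)) := by
  simp only [weight, lineWeight, Finset.sum_add_distrib, Finset.sum_sub_distrib]
  rw [Finset.sum_comm]

theorem sum_range_window {N j d : ℕ} (u : ℕ → ℝ) (hN : j + d ≤ N)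
    (h1 : ∀ l < j, u l = 0) (h2 : ∀ l < N, j + d ≤ l → u l = 0) :
    ∑ l ∈ Finset.range N, u l = ∑ e ∈ Finset.range d, u (j + e) := by
  obtain ⟨c, rfl⟩ := Nat.exists_eq_add_of_le hN
  rw [Finset.sum_range_add, Finset.sum_range_add,
    Finset.sum_eq_zero (s := Finset.range j) fun l hl => h1 l (Finset.mem_range.mp hl),
    Finset.sum_eq_zero (s := Finset.range c) fun l hl =>
      h2 _ (by have := Finset.mem_range.mp hl; omega) (by omega)]
  ring

/-- The length of a tuple of paths is at most a boundary term plus the sum of all the gains at the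
jumps that are not forced. -/
theorem weight_le {F : ℕ → ℝ≥0 → ℝ} (hF : ∀ l, IsCadlagPos (F l)) {d k : ℕ} {x y : ℝ≥0}
    {T : ℕ → ℕ → ℝ≥0} (hT : IsInterlaced (d + k + 1) k x y T) :
    weight F (d + k + 1) k T ≤
      ∑ l ∈ Finset.range (k + 1), F l y - ∑ e ∈ Finset.range (k + 1), leftVal (F (d + e)) x +
      ∑ j ∈ Finset.range (k + 1), ∑ e ∈ Finset.range d,
        (F (j + 1 + e) (T j (j + 1 + e)) - leftVal (F (j + e)) (T j (j + 1 + e))) := by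
  have e1 : ∑ l ∈ Finset.range (d + k + 1), F l (T k l) =
      ∑ l ∈ Finset.range (k + 1), F l y +
        ∑ e ∈ Finset.range d, F (k + 1 + e) (T k (k + 1 + e)) := by
    rw [show d + k + 1 = k + 1 + d by ring, Finset.sum_range_add]
    congr 1
    refine Finset.sum_congr rfl fun l hl => ?_
    have := Finset.mem_range.mp hl
    rw [hT.eq_top le_rfl (by omega) (by omega)]
  have e2 : ∑ l ∈ Finset.range (d + k + 1), leftVal (F l) (T 0 (l + 1)) =
      ∑ e ∈ Finset.range d, leftVal (F (0 + e)) (T 0 (0 + 1 + e)) +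
        ∑ e ∈ Finset.range (k + 1), leftVal (F (d + e)) x := by
    rw [show d + k + 1 = d + (k + 1) by ring, Finset.sum_range_add]
    congr 1
    · refine Finset.sum_congr rfl fun l hl => ?_
      rw [zero_add, show 0 + 1 + l = l + 1 by ring]
    · refine Finset.sum_congr rfl fun l hl => ?_
      have := Finset.mem_range.mp hl
      rw [hT.eq_bot (Nat.zero_le k) (by omega) (by omega)]
  have e3 : ∀ j ∈ Finset.range k, ∑ l ∈ Finset.range (d + k + 1),
      gapWeight (F l) (T j l) (T (j + 1) (l + 1)) ≤
      ∑ e ∈ Finset.range d, F (j + 1 + e) (T j (j + 1 + e)) -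
        ∑ e ∈ Finset.range d, leftVal (F (j + 1 + e)) (T (j + 1) (j + 1 + 1 + e)) := by
    intro j hj
    have hj := Finset.mem_range.mp hj
    -- Gaps on the lines outside `[j + 1, j + d]` lie between two forced jumps at the same time and
    -- vanish.
    rw [sum_range_window (j := j + 1) (d := d) _ (by omega), ← Finset.sum_sub_distrib]
    · refine Finset.sum_le_sum fun e he => ?_
      have he := Finset.mem_range.mp he
      rw [show j + 1 + 1 + e = j + 1 + e + 1 by ring]
      exact gapWeight_le (hF _) (hT.inter j hj _ (by omega))
    · intro l hl
      rw [hT.eq_top hj.le (by omega) (by omega), hT.eq_top (j := j + 1) hj (by omega) (by omega),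
        gapWeight_self]
    · intro l hl hjl
      rw [hT.eq_bot hj.le (by omega) (by omega), hT.eq_bot (j := j + 1) hj (by omega) (by omega),
        gapWeight_self]
  have e4 := Finset.sum_le_sum e3
  simp only [weight_eq, Finset.sum_sub_distrib] at e4 ⊢
  rw [Finset.sum_range_succ (fun j => ∑ e ∈ Finset.range d, F (j + 1 + e) (T j (j + 1 + e))),
    Finset.sum_range_succ'
      (fun j => ∑ e ∈ Finset.range d, leftVal (F (j + e)) (T j (j + 1 + e)))]
  rw [e1, e2]
  linarith

/-- The tuple that jumps as early as possible. -/
def earlyTuple (x y : ℝ≥0) (j l : ℕ) : ℝ≥0 := if l ≤ j then y else x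

theorem isInterlaced_earlyTuple {n k : ℕ} (hk : k < n) {x y : ℝ≥0} (hxy : x ≤ y) :
    IsInterlaced n k x y (earlyTuple x y) where
  top j _ := if_pos (Nat.zero_le j)
  bot j hj := if_neg (by omega)
  anti j _ l _ := by
    unfold earlyTuple
    split_ifs
    · exact le_rfl
    · omega
    · exact hxy
    · exact le_rfl
  inter j _ l _ := by simp [earlyTuple]

theorem weight_earlyTuple (F : ℕ → ℝ≥0 → ℝ) (d k : ℕ) (x y : ℝ≥0) :
    weight F (d + k + 1) k (earlyTuple x y) =
      ∑ l ∈ Finset.range (k + 1), F l y + ∑ e ∈ Finset.range d, F (k + 1 + e) x -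
        ∑ l ∈ Finset.range (d + k + 1), leftVal (F l) x := by
  have e3 : ∀ j l, gapWeight (F l) (earlyTuple x y j l) (earlyTuple x y (j + 1) (l + 1)) = 0 := by
    intro j l
    simp [earlyTuple, gapWeight_self]
  have e2 : ∀ l, earlyTuple x y 0 (l + 1) = x := fun l => by simp [earlyTuple]
  rw [weight_eq]
  simp only [e3, e2, Finset.sum_const_zero, add_zero]
  rw [show d + k + 1 = k + 1 + d by ring, Finset.sum_range_add (fun l => F l (earlyTuple x y k l))]
  congr 2
  · refine Finset.sum_congr rfl fun l hl => ?_
    have := Finset.mem_range.mp hl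
    rw [earlyTuple, if_pos (by omega)]
  · refine Finset.sum_congr rfl fun l hl => ?_
    rw [earlyTuple, if_neg (by omega)]

/-- The tuple that jumps as late as possible. -/
def lateTuple (d : ℕ) (x y : ℝ≥0) (j l : ℕ) : ℝ≥0 := if l ≤ d + j then y else x

theorem isInterlaced_lateTuple (d k : ℕ) {x y : ℝ≥0} (hxy : x ≤ y) :
    IsInterlaced (d + k + 1) k x y (lateTuple d x y) where
  top j _ := if_pos (Nat.zero_le _)
  bot j hj := if_neg (by omega)
  anti j _ l _ := by
    unfold lateTuple
    split_ifs
    · exact le_rfl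
    · omega
    · exact hxy
    · exact le_rfl
  inter j _ l _ := by
    unfold lateTuple
    rw [show d + (j + 1) = d + j + 1 by ring]
    simp

theorem weight_lateTuple (F : ℕ → ℝ≥0 → ℝ) (d k : ℕ) (x y : ℝ≥0) :
    weight F (d + k + 1) k (lateTuple d x y) =
      ∑ e ∈ Finset.range (k + 1), (F (d + e) y - leftVal (F (d + e)) x) +
        ∑ l ∈ Finset.range d, (F l y - leftVal (F l) y) := by
  have e3 : ∀ j l, gapWeight (F l) (lateTuple d x y j l) (lateTuple d x y (j + 1) (l + 1)) = 0 := by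
    intro j l
    simp only [lateTuple, show d + (j + 1) = d + j + 1 by ring, add_le_add_iff_right,
      gapWeight_self]
  rw [weight_eq]
  simp only [e3, Finset.sum_const_zero, add_zero]
  rw [show d + k + 1 = d + (k + 1) by ring,
    Finset.sum_range_add (fun l => F l (lateTuple d x y k l)),
    Finset.sum_range_add (fun l => leftVal (F l) (lateTuple d x y 0 (l + 1)))]
  have h1 : ∀ l ∈ Finset.range d, F l (lateTuple d x y k l) = F l y := fun l hl => by
    have := Finset.mem_range.mp hl
    rw [lateTuple, if_pos (by omega)]
  have h2 : ∀ e ∈ Finset.range (k + 1), F (d + e) (lateTuple d x y k (d + e)) = F (d + e) y :=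
    fun l hl => by
      have := Finset.mem_range.mp hl
      rw [lateTuple, if_pos (by omega)]
  have h3 : ∀ l ∈ Finset.range d, leftVal (F l) (lateTuple d x y 0 (l + 1)) = leftVal (F l) y :=
    fun l hl => by
      have := Finset.mem_range.mp hl
      rw [lateTuple, if_pos (by omega)]
  have h4 : ∀ e ∈ Finset.range (k + 1),
      leftVal (F (d + e)) (lateTuple d x y 0 (d + e + 1)) = leftVal (F (d + e)) x :=
    fun l hl => by rw [lateTuple, if_neg (by omega)]
  rw [Finset.sum_congr rfl h1, Finset.sum_congr rfl h2, Finset.sum_congr rfl h3,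
    Finset.sum_congr rfl h4, Finset.sum_sub_distrib, Finset.sum_sub_distrib]
  ring

/-! ### Last passage values, and their computation for ordered lines -/

/-- The lengths of all disjoint `(k + 1)`-tuples of paths. -/
def weights (F : ℕ → ℝ≥0 → ℝ) (n k : ℕ) (x y : ℝ≥0) : Set ℝ :=
  {v | ∃ T, IsInterlaced n k x y T ∧ weight F n k T = v}

/-- The last passage value of disjoint `(k + 1)`-tuples of paths. -/
def lastPassage (F : ℕ → ℝ≥0 → ℝ) (n k : ℕ) (x y : ℝ≥0) : ℝ := sSup (weights F n k x y)

theorem nonempty_weights (F : ℕ → ℝ≥0 → ℝ) {n k : ℕ} (hk : k < n) {x y : ℝ≥0} (hxy : x ≤ y) :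
    (weights F n k x y).Nonempty :=
  ⟨_, _, isInterlaced_earlyTuple hk hxy, rfl⟩

theorem bddAbove_weights {F : ℕ → ℝ≥0 → ℝ} (hF : ∀ l, IsCadlagPos (F l)) {n k : ℕ} (hk : k < n)
    (x y : ℝ≥0) : BddAbove (weights F n k x y) := by
  obtain ⟨d, rfl⟩ : ∃ d, n = d + k + 1 := ⟨n - (k + 1), by omega⟩
  refine ⟨∑ l ∈ Finset.range (k + 1), F l y -
    ∑ e ∈ Finset.range (k + 1), leftVal (F (d + e)) x +
    ∑ j ∈ Finset.range (k + 1), ∑ e ∈ Finset.range d,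
      runMax (F (j + e)) (F (j + 1 + e)) y, ?_⟩
  rintro _ ⟨T, hT, rfl⟩
  refine (weight_le hF hT).trans ?_
  gcongr with j hj e he
  have hj := Finset.mem_range.mp hj
  have he := Finset.mem_range.mp he
  exact jumpGain_le_runMax (hF _) (hF _) (hT.le_top (by omega) (by omega))

theorem weight_le_lastPassage {F : ℕ → ℝ≥0 → ℝ} (hF : ∀ l, IsCadlagPos (F l)) {n k : ℕ}
    (hk : k < n) {x y : ℝ≥0} {T : ℕ → ℕ → ℝ≥0} (hT : IsInterlaced n k x y T) :
    weight F n k T ≤ lastPassage F n k x y :=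
  le_csSup (bddAbove_weights hF hk x y) ⟨T, hT, rfl⟩

theorem lastPassage_le {F : ℕ → ℝ≥0 → ℝ} {n k : ℕ} (hk : k < n) {x y : ℝ≥0} (hxy : x ≤ y) {c : ℝ}
    (h : ∀ T, IsInterlaced n k x y T → weight F n k T ≤ c) : lastPassage F n k x y ≤ c :=
  csSup_le (nonempty_weights F hk hxy) (by rintro _ ⟨T, hT, rfl⟩; exact h T hT)

theorem Isometric.lastPassage_eq {F G : ℕ → ℝ≥0 → ℝ} (hF : ∀ l, IsCadlagPos (F l))
    (hG : ∀ l, IsCadlagPos (G l)) {n k : ℕ} (h : Isometric n F G) (hk : k < n) {x y : ℝ≥0}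
    (hxy : x ≤ y) : lastPassage F n k x y = lastPassage G n k x y := by
  refine le_antisymm (lastPassage_le hk hxy fun T hT => ?_)
    (lastPassage_le hk hxy fun T hT => ?_)
  · obtain ⟨T', hT', hle⟩ := h.1 k x y T hT
    exact hle.trans (weight_le_lastPassage hG hk hT')
  · obtain ⟨T', hT', hle⟩ := h.2 k x y T hT
    exact hle.trans (weight_le_lastPassage hF hk hT')

theorem weight_congr {F G : ℕ → ℝ≥0 → ℝ} {n : ℕ} (h : ∀ l < n, F l = G l) (k : ℕ)
    (T : ℕ → ℕ → ℝ≥0) : weight F n k T = weight G n k T :=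
  Finset.sum_congr rfl fun l hl => by rw [h l (Finset.mem_range.mp hl)]

theorem lastPassage_congr {F G : ℕ → ℝ≥0 → ℝ} {n : ℕ} (h : ∀ l < n, F l = G l) (k : ℕ)
    (x y : ℝ≥0) : lastPassage F n k x y = lastPassage G n k x y := by
  simp only [lastPassage, weights, weight_congr h]

/-- For ordered lines the earliest tuple from time `0` is optimal. -/
theorem weight_le_of_ordered {G : ℕ → ℝ≥0 → ℝ} (hG : ∀ l, IsCadlagPos (G l)) {n k : ℕ}
    (hk : k < n) (hord : Ordered n G) {y : ℝ≥0} {T : ℕ → ℕ → ℝ≥0} (hT : IsInterlaced n k 0 y T) :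
    weight G n k T ≤ ∑ l ∈ Finset.range (k + 1), G l y := by
  obtain ⟨d, rfl⟩ : ∃ d, n = d + k + 1 := ⟨n - (k + 1), by omega⟩
  have h := weight_le hG hT
  have h' : ∑ j ∈ Finset.range (k + 1), ∑ e ∈ Finset.range d,
      (G (j + 1 + e) (T j (j + 1 + e)) - leftVal (G (j + e)) (T j (j + 1 + e))) ≤ 0 := by
    refine Finset.sum_nonpos fun j hj => Finset.sum_nonpos fun e he => sub_nonpos.2 ?_
    have hj := Finset.mem_range.mp hj
    have he := Finset.mem_range.mp he
    rw [show j + 1 + e = j + e + 1 by ring]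
    exact hord _ (by omega) _
  simp only [leftVal_zero, Finset.sum_const_zero, sub_zero] at h
  linarith

theorem le_weight_earlyTuple {G : ℕ → ℝ≥0 → ℝ} (hG : ∀ l, IsCadlagPos (G l)) {n k : ℕ}
    (hk : k < n) (y : ℝ≥0) :
    ∑ l ∈ Finset.range (k + 1), G l y ≤ weight G n k (earlyTuple 0 y) := by
  obtain ⟨d, rfl⟩ : ∃ d, n = d + k + 1 := ⟨n - (k + 1), by omega⟩
  rw [weight_earlyTuple]
  simp only [leftVal_zero, Finset.sum_const_zero, sub_zero]
  linarith [Finset.sum_nonneg fun e (_ : e ∈ Finset.range d) => (hG (k + 1 + e)).nonneg_zero]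

theorem lastPassage_of_ordered {G : ℕ → ℝ≥0 → ℝ} (hG : ∀ l, IsCadlagPos (G l)) {n k : ℕ}
    (hk : k < n) (hord : Ordered n G) (y : ℝ≥0) :
    lastPassage G n k 0 y = ∑ l ∈ Finset.range (k + 1), G l y :=
  le_antisymm (lastPassage_le hk zero_le fun _ hT => weight_le_of_ordered hG hk hord hT)
    ((le_weight_earlyTuple hG hk y).trans
      (weight_le_lastPassage hG hk (isInterlaced_earlyTuple hk zero_le)))

/-- Last passage values from time `0` are attained. -/
theorem exists_optimizer {F : ℕ → ℝ≥0 → ℝ} (hF : ∀ l, IsCadlagPos (F l)) {n k : ℕ} (hk : k < n)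
    (y : ℝ≥0) : ∃ T, IsInterlaced n k 0 y T ∧ weight F n k T = lastPassage F n k 0 y := by
  obtain ⟨G, hG, hiso, hord⟩ := exists_ordered_isometric n hF
  -- The early tuple is optimal for the ordered lines, so its counterpart in `F` is optimal for `F`.
  obtain ⟨T, hT, hle⟩ := hiso.2 k 0 y _ (isInterlaced_earlyTuple hk zero_le)
  refine ⟨T, hT, le_antisymm (weight_le_lastPassage hF hk hT) ?_⟩
  rw [hiso.lastPassage_eq hF hG hk zero_le, lastPassage_of_ordered hG hk hord]
  exact (le_weight_earlyTuple hG hk y).trans hle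

/-! ### Restarting tuples, recurrence and uniqueness -/

/-- The sum of the left limits of the `k + 1` lines below the first `d` lines. -/
def lowSum (F : ℕ → ℝ≥0 → ℝ) (d k : ℕ) (x : ℝ≥0) : ℝ :=
  ∑ e ∈ Finset.range (k + 1), leftVal (F (d + e)) x

/-- The tuple `T` with a new starting time. -/
def restart (d : ℕ) (x : ℝ≥0) (T : ℕ → ℕ → ℝ≥0) (j l : ℕ) : ℝ≥0 := if l ≤ d + j then T j l else x

theorem IsInterlaced.restart {d k : ℕ} {x x' y : ℝ≥0} {T : ℕ → ℕ → ℝ≥0}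
    (hT : IsInterlaced (d + k + 1) k x y T) (h : ∀ j ≤ k, ∀ l ≤ d + j, x' ≤ T j l) :
    IsInterlaced (d + k + 1) k x' y (restart d x' T) where
  top j hj := by rw [Melon.restart, if_pos (Nat.zero_le _), hT.top j hj]
  bot j hj := if_neg (by omega)
  anti j hj l hl := by
    unfold Melon.restart
    split_ifs with h1 h2 h2
    · exact hT.anti j hj l hl
    · omega
    · exact h j hj l h2
    · exact le_rfl
  inter j hj l hl := by
    unfold Melon.restart
    split_ifs with h1 h2 h2
    · exact hT.inter j hj l hl
    · omega
    · omega
    · exact le_rfl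

/-- The starting time enters only through path `0` on the lowest `k + 1` lines. The other forced
initial jumps touch those of the neighbouring path and carry no weight. -/
theorem weight_restart (F : ℕ → ℝ≥0 → ℝ) {d k : ℕ} {x y : ℝ≥0} (x' : ℝ≥0) {T : ℕ → ℕ → ℝ≥0}
    (hT : IsInterlaced (d + k + 1) k x y T) :
    weight F (d + k + 1) k (restart d x' T) + lowSum F d k x' =
      weight F (d + k + 1) k T + lowSum F d k x := by
  have e1 : ∀ l ∈ Finset.range (d + k + 1), F l (restart d x' T k l) = F l (T k l) := by
    intro l hl
    have := Finset.mem_range.mp hl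
    rw [restart, if_pos (by omega)]
  have e3 : ∀ j ∈ Finset.range k, ∑ l ∈ Finset.range (d + k + 1),
      gapWeight (F l) (restart d x' T j l) (restart d x' T (j + 1) (l + 1)) =
      ∑ l ∈ Finset.range (d + k + 1), gapWeight (F l) (T j l) (T (j + 1) (l + 1)) := by
    intro j hj
    have hj := Finset.mem_range.mp hj
    refine Finset.sum_congr rfl fun l hl => ?_
    have hl := Finset.mem_range.mp hl
    by_cases h : l ≤ d + j
    · rw [restart, restart, if_pos h, if_pos (by omega)]
    · rw [restart, restart, if_neg h, if_neg (by omega), hT.eq_bot hj.le (by omega) (by omega),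
        hT.eq_bot (j := j + 1) hj (by omega) (by omega), gapWeight_self, gapWeight_self]
  have e2 : ∀ (x : ℝ≥0) (T : ℕ → ℕ → ℝ≥0), (∀ l, d < l → l ≤ d + k + 1 → T 0 l = x) →
      ∑ l ∈ Finset.range (d + k + 1), leftVal (F l) (T 0 (l + 1)) =
      ∑ l ∈ Finset.range d, leftVal (F l) (T 0 (l + 1)) + lowSum F d k x := by
    intro x T h
    rw [show d + k + 1 = d + (k + 1) by ring, Finset.sum_range_add]
    congr 1
    refine Finset.sum_congr rfl fun l hl => ?_
    have := Finset.mem_range.mp hl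
    rw [h _ (by omega) (by omega)]
  have e4 : ∀ l ∈ Finset.range d, leftVal (F l) (restart d x' T 0 (l + 1)) =
      leftVal (F l) (T 0 (l + 1)) := by
    intro l hl
    have := Finset.mem_range.mp hl
    rw [restart, if_pos (by omega)]
  rw [weight_eq, weight_eq, Finset.sum_congr rfl e1, Finset.sum_congr rfl e3,
    e2 x' (restart d x' T) (fun l h _ => if_neg (by omega)),
    e2 x T (fun l h h' => hT.eq_bot (Nat.zero_le k) h' (by omega)), Finset.sum_congr rfl e4]
  ring

/-- Any tuple from `x` can be prolonged backwards to `x'` along the lowest lines. -/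
theorem lastPassage_add_lowSum_le {F : ℕ → ℝ≥0 → ℝ} (hF : ∀ l, IsCadlagPos (F l)) {d k : ℕ}
    {x' x y : ℝ≥0} (h : x' ≤ x) (hxy : x ≤ y) :
    lastPassage F (d + k + 1) k x y + lowSum F d k x ≤
      lastPassage F (d + k + 1) k x' y + lowSum F d k x' := by
  rw [← le_sub_iff_add_le]
  refine lastPassage_le (by omega) hxy fun T hT => ?_
  have h1 := hT.restart (x' := x') fun j hj l hl => h.trans (hT.bot_le hj (by omega))
  have h2 := weight_le_lastPassage hF (by omega) h1
  have h3 := weight_restart F x' hT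
  linarith

/-- The lowest lines asymptotically carry optimal tuples of paths. -/
def Recurrent (n : ℕ) (F : ℕ → ℝ≥0 → ℝ) : Prop :=
  ∀ k d, n = d + k + 1 → ∀ x X : ℝ≥0, ∀ δ : ℝ, 0 < δ → ∃ T, X ≤ T ∧ x ≤ T ∧
    lastPassage F n k 0 T ≤ lowSum F d k x + lastPassage F n k x T + δ

/-- Optimal tuples of paths exist with all jumps that are not forced arbitrarily late. -/
def HasLateOptimizers (n : ℕ) (F : ℕ → ℝ≥0 → ℝ) : Prop :=
  ∀ k d, n = d + k + 1 → ∀ X : ℝ≥0, ∃ y A, X ≤ y ∧ IsInterlaced n k 0 y A ∧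
    weight F n k A = lastPassage F n k 0 y ∧ ∀ j ≤ k, ∀ l ≤ d + j, X ≤ A j l

/-- An optimizer from `0` whose free jumps all come after `x` runs along the lowest lines until
then, so it can be restarted at `x` without losing anything but `lowSum`. -/
theorem HasLateOptimizers.lastPassage_le {n k d : ℕ} {F : ℕ → ℝ≥0 → ℝ}
    (h : HasLateOptimizers n F) (hF : ∀ l, IsCadlagPos (F l)) (hn : n = d + k + 1) (x X : ℝ≥0) :
    ∃ T, X ≤ T ∧ x ≤ T ∧
      lastPassage F n k 0 T ≤ lowSum F d k x + lastPassage F n k x T := by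
  subst hn
  obtain ⟨T, A, hXT, hA, hopt, hlate⟩ := h k d rfl (max x X)
  refine ⟨T, (le_max_right _ _).trans hXT, (le_max_left _ _).trans hXT, ?_⟩
  have h1 := hA.restart (x' := x) fun j hj l hl => (le_max_left _ _).trans (hlate j hj l hl)
  have h2 := weight_le_lastPassage hF (by omega) h1
  have h3 := weight_restart F x hA
  simp only [lowSum, leftVal_zero, Finset.sum_const_zero] at h3 ⊢
  linarith

theorem abs_lowSum_sub_le {F G : ℕ → ℝ≥0 → ℝ} (hF : ∀ l, IsCadlagPos (F l))
    (hG : ∀ l, IsCadlagPos (G l)) {d k : ℕ} {x : ℝ≥0} {ε : ℝ} (hε : 0 ≤ ε)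
    (h : ∀ l < d + k + 1, ∀ s ≤ x, |F l s - G l s| ≤ ε) :
    |lowSum F d k x - lowSum G d k x| ≤ (k + 1) * ε := by
  rw [lowSum, lowSum, ← Finset.sum_sub_distrib]
  refine (Finset.abs_sum_le_sum_abs _ _).trans ?_
  calc _ ≤ ∑ e ∈ Finset.range (k + 1), ε := Finset.sum_le_sum fun e he =>
        (hF _).abs_leftVal_sub_le (hG _) hε fun s hs =>
          h _ (by have := Finset.mem_range.mp he; omega) s hs.le
    _ = _ := by simp

/-- The constant counts evaluations: on each of `n` lines a tuple has at most `2 * (k + 1)` interval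
ends. -/
theorem abs_weight_sub_le {F G : ℕ → ℝ≥0 → ℝ} (hF : ∀ l, IsCadlagPos (F l))
    (hG : ∀ l, IsCadlagPos (G l)) {n k : ℕ} {x y : ℝ≥0} {ε : ℝ} (hε : 0 ≤ ε)
    (h : ∀ l < n, ∀ s ≤ y, |F l s - G l s| ≤ ε) {T : ℕ → ℕ → ℝ≥0}
    (hT : IsInterlaced n k x y T) :
    |weight F n k T - weight G n k T| ≤ n * (2 * (k + 1)) * ε := by
  have hl : ∀ l < n, ∀ s ≤ y, |leftVal (F l) s - leftVal (G l) s| ≤ ε := fun l hl s hs =>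
    (hF l).abs_leftVal_sub_le (hG l) hε fun r hr => h l hl r (hr.le.trans hs)
  have hgap : ∀ l < n, ∀ b ≤ y, ∀ a ≤ y,
      |gapWeight (F l) b a - gapWeight (G l) b a| ≤ 2 * ε := by
    intro l hln b hb a ha
    unfold gapWeight
    split_ifs
    · have h1 := abs_le.mp (h l hln b hb)
      have h2 := abs_le.mp (hl l hln a ha)
      rw [abs_le]
      constructor <;> linarith [h1.1, h1.2, h2.1, h2.2]
    · simpa using hε
  have hline : ∀ l < n, |lineWeight (F l) k (fun j => T j (l + 1)) (fun j => T j l) -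
      lineWeight (G l) k (fun j => T j (l + 1)) (fun j => T j l)| ≤ 2 * (k + 1) * ε := by
    intro l hln
    have h1 := abs_le.mp (h l hln (T k l) (hT.le_top le_rfl hln.le))
    have h2 := abs_le.mp (hl l hln (T 0 (l + 1)) (hT.le_top (Nat.zero_le k) hln))
    have h3 : |∑ j ∈ Finset.range k, (gapWeight (F l) (T j l) (T (j + 1) (l + 1)) -
        gapWeight (G l) (T j l) (T (j + 1) (l + 1)))| ≤ k * (2 * ε) := by
      refine (Finset.abs_sum_le_sum_abs _ _).trans ?_
      calc _ ≤ ∑ e ∈ Finset.range k, 2 * ε := Finset.sum_le_sum fun j hj => by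
            have hj := Finset.mem_range.mp hj
            exact hgap l hln _ (hT.le_top hj.le hln.le) _ (hT.le_top (j := j + 1) hj hln)
        _ = _ := by simp
    rw [Finset.sum_sub_distrib] at h3
    have h3 := abs_le.mp h3
    rw [lineWeight, lineWeight, abs_le]
    constructor <;> linarith [h1.1, h1.2, h2.1, h2.2, h3.1, h3.2]
  rw [weight, weight, ← Finset.sum_sub_distrib]
  refine (Finset.abs_sum_le_sum_abs _ _).trans ?_
  calc _ ≤ ∑ e ∈ Finset.range n, 2 * (k + 1) * ε :=
        Finset.sum_le_sum fun l hl => hline l (Finset.mem_range.mp hl)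
    _ = _ := by simp; ring

theorem lastPassage_le_add {F G : ℕ → ℝ≥0 → ℝ} (hF : ∀ l, IsCadlagPos (F l))
    (hG : ∀ l, IsCadlagPos (G l)) {n k : ℕ} (hk : k < n) {x y : ℝ≥0} (hxy : x ≤ y) {ε : ℝ}
    (hε : 0 ≤ ε) (h : ∀ l < n, ∀ s ≤ y, |F l s - G l s| ≤ ε) :
    lastPassage F n k x y ≤ lastPassage G n k x y + n * (2 * (k + 1)) * ε :=
  lastPassage_le hk hxy fun T hT => by
    have h1 := abs_le.mp (abs_weight_sub_le hF hG hε h hT)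
    have h2 := weight_le_lastPassage hG hk hT
    linarith [h1.1, h1.2]

theorem abs_lastPassage_sub_le {F G : ℕ → ℝ≥0 → ℝ} (hF : ∀ l, IsCadlagPos (F l))
    (hG : ∀ l, IsCadlagPos (G l)) {n k : ℕ} (hk : k < n) {x y : ℝ≥0} (hxy : x ≤ y) {ε : ℝ}
    (hε : 0 ≤ ε) (h : ∀ l < n, ∀ s ≤ y, |F l s - G l s| ≤ ε) :
    |lastPassage F n k x y - lastPassage G n k x y| ≤ n * (2 * (k + 1)) * ε := by
  have h1 := lastPassage_le_add hF hG hk hxy hε h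
  have h2 := lastPassage_le_add hG hF hk hxy hε
    fun l hl s hs => by rw [abs_sub_comm]; exact h l hl s hs
  rw [abs_le]
  constructor <;> linarith

/-- Uniform limits of lines with late optimizers are recurrent. -/
theorem recurrent_of_approx {n : ℕ} {F : ℕ → ℝ≥0 → ℝ} (hF : ∀ l, IsCadlagPos (F l))
    (h : ∀ ε : ℝ, 0 < ε → ∃ H : ℕ → ℝ≥0 → ℝ, (∀ l, IsCadlagPos (H l)) ∧ HasLateOptimizers n H ∧
      ∀ l t, |F l t - H l t| ≤ ε) : Recurrent n F := by
  intro k d hn x X δ hδ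
  subst hn
  set C : ℝ := ((d + k + 1 : ℕ) : ℝ) * (2 * (k + 1)) with hC
  have hC0 : 0 ≤ C := by positivity
  have hK : 0 < 2 * C + (k + 1) := by positivity
  -- Two last passage values are compared, each with error at most `C * ε`, and one `lowSum`, with
  -- error at most `(k + 1) * ε`.
  obtain ⟨H, hH, hlate, hclose⟩ := h (δ / (2 * C + (k + 1))) (by positivity)
  set ε := δ / (2 * C + (k + 1)) with hε
  have hε0 : 0 ≤ ε := by positivity
  have hεδ : (2 * C + (k + 1)) * ε = δ := by rw [hε]; field_simp
  obtain ⟨T, h1, h2, h3⟩ := hlate.lastPassage_le hH rfl x X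
  refine ⟨T, h1, h2, ?_⟩
  have b1 := lastPassage_le_add hF hH (n := d + k + 1) (k := k) (by omega) (zero_le (a := T)) hε0
    fun l _ s _ => hclose l s
  have b2 := lastPassage_le_add hH hF (n := d + k + 1) (k := k) (by omega) h2 hε0
    fun l _ s _ => by rw [abs_sub_comm]; exact hclose l s
  have b3 := abs_le.mp (abs_lowSum_sub_le hF hH (d := d) (k := k) (x := x) hε0
    fun l _ s _ => hclose l s)
  linarith [b3.1, b3.2]

/-- Two recurrent families of lines with the same last passage values agree. -/
theorem Recurrent.eq {n : ℕ} {F G : ℕ → ℝ≥0 → ℝ} (hF : ∀ l, IsCadlagPos (F l))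
    (hG : ∀ l, IsCadlagPos (G l)) (rF : Recurrent n F) (rG : Recurrent n G)
    (h : ∀ k < n, ∀ x y, x ≤ y → lastPassage F n k x y = lastPassage G n k x y) :
    ∀ l < n, F l = G l := by
  -- At a suitable `T`, `lowSum G ≤ L(0, T) - L(x, T) ≤ lowSum F + δ`: the first inequality holds
  -- for every `G`, the second by recurrence of `F`.
  have key : ∀ (F G : ℕ → ℝ≥0 → ℝ), (∀ l, IsCadlagPos (G l)) → Recurrent n F →
      (∀ k < n, ∀ x y, x ≤ y → lastPassage F n k x y = lastPassage G n k x y) →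
      ∀ k d, n = d + k + 1 → ∀ x, lowSum G d k x ≤ lowSum F d k x := by
    intro F G hG rF h k d hn x
    subst hn
    refine le_of_forall_pos_le_add fun δ hδ => ?_
    obtain ⟨T, -, hxT, hle⟩ := rF k d rfl x 0 δ hδ
    have h1 := lastPassage_add_lowSum_le hG (d := d) (k := k) (zero_le (a := x)) hxT
    rw [h k (by omega) 0 T zero_le, h k (by omega) x T hxT] at hle
    simp only [lowSum, leftVal_zero, Finset.sum_const_zero] at h1 hle ⊢
    linarith
  have low : ∀ k d, n = d + k + 1 → ∀ x, lowSum F d k x = lowSum G d k x := fun k d hn x =>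
    le_antisymm (key G F hF rG (fun k hk x y hxy => (h k hk x y hxy).symm) k d hn x)
      (key F G hG rF h k d hn x)
  intro l hl
  refine (hF l).eq_of_leftVal_eq (hG l) fun x => ?_
  have h1 := low (n - l - 1) l (by omega) x
  have hsucc : ∀ F : ℕ → ℝ≥0 → ℝ, lowSum F l (n - l - 1) x = leftVal (F l) x +
      ∑ e ∈ Finset.range (n - l - 1), leftVal (F (l + 1 + e)) x := fun F => by
    rw [lowSum, Finset.sum_range_succ', add_comm, add_zero]
    congr 1
    exact Finset.sum_congr rfl fun e _ => by rw [show l + (e + 1) = l + 1 + e by ring]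
  rw [hsucc, hsucc] at h1
  rcases Nat.eq_zero_or_pos (n - l - 1) with h0 | h0
  · simpa [h0] using h1
  · have h2 := low (n - l - 1 - 1) (l + 1) (by omega) x
    rw [lowSum, lowSum, Nat.sub_add_cancel h0] at h2
    linarith

/-! ### A bonus for late jumps -/

section Perturbation

/-- A bounded strictly increasing function. -/
def ramp (t : ℝ≥0) : ℝ := t / (1 + t)

theorem ramp_zero : ramp 0 = 0 := by simp [ramp]

theorem ramp_eq (t : ℝ≥0) : ramp t = 1 - 1 / (1 + (t : ℝ)) := by
  have : (0 : ℝ) < 1 + t := by positivity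
  unfold ramp
  field_simp
  ring

theorem ramp_nonneg (t : ℝ≥0) : 0 ≤ ramp t := by unfold ramp; positivity

theorem ramp_lt_one (t : ℝ≥0) : ramp t < 1 := by
  rw [ramp_eq]
  have : (0 : ℝ) < 1 / (1 + t) := by positivity
  linarith

theorem strictMono_ramp : StrictMono ramp := by
  intro a b hab
  rw [ramp_eq, ramp_eq]
  have : (a : ℝ) < b := hab
  have : 1 / (1 + (b : ℝ)) < 1 / (1 + (a : ℝ)) :=
    one_div_lt_one_div_of_lt (by positivity) (by linarith)
  linarith

theorem continuous_ramp : Continuous ramp := by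
  unfold ramp
  refine Continuous.div (by fun_prop) (by fun_prop) fun t => ?_
  positivity

theorem exists_lt_ramp {c : ℝ} (hc : c < 1) : ∃ x, c < ramp x := by
  obtain ⟨m, hm⟩ := exists_nat_gt (1 / (1 - c))
  refine ⟨m, ?_⟩
  rw [ramp_eq]
  have h1 : 0 < 1 - c := by linarith
  have h2 : 1 / (1 + ((m : ℝ≥0) : ℝ)) < 1 - c := by
    rw [div_lt_iff₀ (by positivity)]
    rw [div_lt_iff₀ h1] at hm
    simp only [NNReal.coe_natCast]
    nlinarith
  linarith

/-- A bonus for paths that jump late. -/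
def bonus (κ : ℝ) (l : ℕ) (t : ℝ≥0) : ℝ := κ * (l + 1) * ramp t

theorem isCadlagPos_bonus {κ : ℝ} (hκ : 0 ≤ κ) (l : ℕ) : IsCadlagPos (bonus κ l) :=
  .of_monotone
    (fun _ _ h => mul_le_mul_of_nonneg_left (strictMono_ramp.monotone h) (by positivity))
    (by simp [bonus, ramp_zero])
    fun _ => (continuous_const.mul continuous_ramp).continuousWithinAt

theorem leftVal_bonus (κ : ℝ) (l : ℕ) (x : ℝ≥0) : leftVal (bonus κ l) x = bonus κ l x := by
  rcases eq_or_ne x 0 with rfl | hx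
  · simp [bonus, ramp_zero]
  · exact leftVal_eq_of_tendsto hx
      ((continuous_const.mul continuous_ramp).continuousAt.tendsto.mono_left nhdsWithin_le_nhds)

theorem sum_succ_mul_sub (u : ℕ → ℝ) (n : ℕ) :
    ∑ l ∈ Finset.range n, ((l : ℝ) + 1) * (u l - u (l + 1)) =
      ∑ l ∈ Finset.range n, u l - n * u n := by
  induction n with
  | zero => simp
  | succ n ih =>
    rw [Finset.sum_range_succ, ih, Finset.sum_range_succ]
    push_cast
    ring

/-- The coefficient of `ramp` drops by `κ` at every jump to the line above, so summation by parts
credits `κ * ramp (T j l)` to each jump time. The bonus is continuous, so touching intervals need no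
correction. -/
theorem weight_bonus (κ : ℝ) {n k : ℕ} {x y : ℝ≥0} {T : ℕ → ℕ → ℝ≥0}
    (hT : IsInterlaced n k x y T) :
    weight (bonus κ) n k T =
      κ * ∑ j ∈ Finset.range (k + 1), (∑ l ∈ Finset.range n, ramp (T j l) - n * ramp x) := by
  have hgap : ∀ l, ∀ b a : ℝ≥0, b ≤ a →
      gapWeight (bonus κ l) b a = bonus κ l b - bonus κ l a := by
    intro l b a hba
    unfold gapWeight
    rw [leftVal_bonus]
    split_ifs with h
    · rfl
    · rw [le_antisymm hba (not_lt.mp h), sub_self]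
  have hline : ∀ l ∈ Finset.range n,
      lineWeight (bonus κ l) k (fun j => T j (l + 1)) (fun j => T j l) =
      ∑ j ∈ Finset.range (k + 1), κ * (((l : ℝ) + 1) * (ramp (T j l) - ramp (T j (l + 1)))) := by
    intro l hl
    have hl := Finset.mem_range.mp hl
    have e : ∀ j ∈ Finset.range k, gapWeight (bonus κ l) (T j l) (T (j + 1) (l + 1)) =
        bonus κ l (T j l) - bonus κ l (T (j + 1) (l + 1)) := fun j hj =>
      hgap l _ _ (hT.inter j (Finset.mem_range.mp hj) l hl)
    rw [lineWeight, Finset.sum_congr rfl e, leftVal_bonus, Finset.sum_sub_distrib]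
    have e1 := Finset.sum_range_succ (fun j => bonus κ l (T j l)) k
    have e2 := Finset.sum_range_succ' (fun j => bonus κ l (T j (l + 1))) k
    have e3 : ∑ j ∈ Finset.range (k + 1),
        κ * (((l : ℝ) + 1) * (ramp (T j l) - ramp (T j (l + 1)))) =
        ∑ j ∈ Finset.range (k + 1), bonus κ l (T j l) -
          ∑ j ∈ Finset.range (k + 1), bonus κ l (T j (l + 1)) := by
      rw [← Finset.sum_sub_distrib]
      exact Finset.sum_congr rfl fun j _ => by simp only [bonus]; ring
    rw [e3, e1, e2]
    ring
  rw [weight, Finset.sum_congr rfl hline, Finset.sum_comm, Finset.mul_sum]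
  refine Finset.sum_congr rfl fun j hj => ?_
  rw [← Finset.mul_sum, sum_succ_mul_sub (fun l => ramp (T j l)),
    hT.bot j (Nat.lt_succ_iff.mp (Finset.mem_range.mp hj))]

theorem weight_add {F G : ℕ → ℝ≥0 → ℝ} (hF : ∀ l, IsCadlagPos (F l))
    (hG : ∀ l, IsCadlagPos (G l)) (n k : ℕ) (T : ℕ → ℕ → ℝ≥0) :
    weight (fun l s => F l s + G l s) n k T = weight F n k T + weight G n k T := by
  have hgap : ∀ l b a, gapWeight (fun s => F l s + G l s) b a =
      gapWeight (F l) b a + gapWeight (G l) b a := by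
    intro l b a
    unfold gapWeight
    rw [(hF l).leftVal_add (hG l)]
    split_ifs <;> ring
  simp only [weight, ← Finset.sum_add_distrib]
  refine Finset.sum_congr rfl fun l _ => ?_
  simp only [lineWeight, hgap, Finset.sum_add_distrib, (hF l).leftVal_add (hG l)]
  ring

/-- The bonus turns recurrent lines into lines with late optimizers. -/
theorem Recurrent.hasLateOptimizers_add_bonus {n : ℕ} {F : ℕ → ℝ≥0 → ℝ}
    (hF : ∀ l, IsCadlagPos (F l)) (rF : Recurrent n F) {κ : ℝ} (hκ : 0 < κ) :
    HasLateOptimizers n fun l s => F l s + bonus κ l s := by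
  intro k d hn X
  subst hn
  have hB : ∀ l, IsCadlagPos (bonus κ l) := isCadlagPos_bonus hκ.le
  have hH : ∀ l, IsCadlagPos fun s => F l s + bonus κ l s := fun l => (hF l).add (hB l)
  -- `N` is the number of pairs `(j, l)` with `l ≤ d + j`, the times that are to be late. It is also
  -- the coefficient of `κ * ramp x` in the `lowSum` of the bonus.
  set N : ℝ := ∑ e ∈ Finset.range (k + 1), ((d + e : ℕ) + 1 : ℝ) with hN
  have hN0 : 0 < N := Finset.sum_pos (fun e _ => by positivity) ⟨0, by simp⟩
  have hX := ramp_lt_one X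
  set η := 1 - ramp X with hη
  have hη0 : 0 < η := by linarith
  obtain ⟨x, hx⟩ := exists_lt_ramp (c := 1 - η / (2 * N)) (by
    have : 0 < η / (2 * N) := by positivity
    linarith)
  -- The choice of `x` and the error in the recurrence each cost at most `κ * (η / 2)`, together `κ
  -- * η`, while a single late time before `X` would cost more than `κ * η`.
  obtain ⟨y, hXy, hxy, hrec⟩ := rF k d rfl x X (κ * (η / 2)) (by positivity)
  obtain ⟨A, hA, hopt⟩ := exists_optimizer hH (n := d + k + 1) (k := k) (by omega) y
  refine ⟨y, A, hXy, hA, hopt, fun j hj l hl => ?_⟩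
  have b1 := lastPassage_add_lowSum_le hH (d := d) (k := k) (zero_le (a := x)) hxy
  have b2 : lastPassage F (d + k + 1) k x y ≤
      lastPassage (fun l s => F l s + bonus κ l s) (d + k + 1) k x y := by
    refine lastPassage_le (by omega) hxy fun T hT => ?_
    refine le_trans ?_ (weight_le_lastPassage hH (by omega) hT)
    rw [weight_add hF hB, weight_bonus κ hT, le_add_iff_nonneg_right]
    refine mul_nonneg hκ.le (Finset.sum_nonneg fun j hj => ?_)
    have hj := Finset.mem_range.mp hj
    rw [sub_nonneg]
    calc _ = ∑ l ∈ Finset.range (d + k + 1), ramp x := by simp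
      _ ≤ _ := Finset.sum_le_sum fun l hl => strictMono_ramp.monotone
        (hT.bot_le (by omega) (Finset.mem_range.mp hl).le)
  have b3 : lowSum (fun l s => F l s + bonus κ l s) d k x =
      lowSum F d k x + κ * (N * ramp x) := by
    have e : ∀ l, leftVal (fun s => F l s + bonus κ l s) x = leftVal (F l) x + bonus κ l x :=
      fun l => by rw [(hF l).leftVal_add (hB l), leftVal_bonus]
    simp only [lowSum, e, Finset.sum_add_distrib]
    rw [hN, Finset.sum_mul, Finset.mul_sum]
    congr 1
    exact Finset.sum_congr rfl fun e _ => by rw [bonus]; ring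
  have b4 : lowSum (fun l s => F l s + bonus κ l s) d k 0 = 0 := by simp [lowSum]
  have b5 := weight_le_lastPassage hF (by omega) hA
  rw [← hopt, weight_add hF hB, weight_bonus κ hA, ramp_zero, b3, b4] at b1
  simp only [mul_zero, sub_zero, add_zero] at b1
  -- `v j l` is the bonus missed at `(j, l)`, up to the factor `κ`. All these deficits are
  -- nonnegative, so each is at most their sum.
  set v : ℕ → ℕ → ℝ := fun j l => (if l ≤ d + j then 1 else 0) - ramp (A j l) with hv
  have hv0 : ∀ j ≤ k, ∀ l < d + k + 1, 0 ≤ v j l := by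
    intro j hj l hl
    rw [hv]
    simp only
    split_ifs with h
    · linarith [ramp_lt_one (A j l)]
    · rw [hA.eq_bot hj hl.le (by omega), ramp_zero, sub_zero]
  have hvN : ∑ j ∈ Finset.range (k + 1), ∑ l ∈ Finset.range (d + k + 1), v j l =
      N - ∑ j ∈ Finset.range (k + 1), ∑ l ∈ Finset.range (d + k + 1), ramp (A j l) := by
    simp only [hv, Finset.sum_sub_distrib]
    congr 1
    refine Finset.sum_congr rfl fun j hj => ?_
    have hj := Finset.mem_range.mp hj
    rw [← Finset.sum_filter, show (Finset.range (d + k + 1)).filter (· ≤ d + j) =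
      Finset.range (d + j + 1) by ext; simp; omega]
    simp
  have hsingle : v j l ≤ ∑ j ∈ Finset.range (k + 1), ∑ l ∈ Finset.range (d + k + 1), v j l := by
    refine le_trans ?_ (Finset.single_le_sum (f := fun j => ∑ l ∈ Finset.range (d + k + 1), v j l)
      (fun j hj => Finset.sum_nonneg fun l hl =>
        hv0 j (Nat.lt_succ_iff.mp (Finset.mem_range.mp hj)) l (Finset.mem_range.mp hl))
      (Finset.mem_range.mpr (Nat.lt_succ_iff.mpr hj)))
    exact Finset.single_le_sum (f := fun l => v j l)
      (fun l hl => hv0 j hj l (Finset.mem_range.mp hl)) (Finset.mem_range.mpr (by omega))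
  have hvj : v j l = 1 - ramp (A j l) := by simp [hv, hl]
  have hcmp : N * ramp x - η / 2 ≤
      ∑ j ∈ Finset.range (k + 1), ∑ l ∈ Finset.range (d + k + 1), ramp (A j l) := by
    refine le_of_mul_le_mul_left ?_ hκ
    linarith
  have hNx : N - η / 2 ≤ N * ramp x := by
    have := mul_le_mul_of_nonneg_left hx.le hN0.le
    have e : N * (1 - η / (2 * N)) = N - η / 2 := by field_simp
    linarith
  by_contra! hlt
  have := strictMono_ramp hlt
  linarith

end Perturbation

/-! ### Future suprema and the reverse Pitman transform of two lines -/

/-- The supremum of the jump gain from time `x` on. -/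
def futureSup (f g : ℝ≥0 → ℝ) (x : ℝ≥0) : ℝ := sSup (jumpGain f g '' Ici x)

/-- The supremum of the jump gain after time `x`. -/
def strictFutureSup (f g : ℝ≥0 → ℝ) (x : ℝ≥0) : ℝ := sSup (jumpGain f g '' Ioi x)

/-- The amount that the reverse Pitman transform moves from the upper to the lower line. -/
def futureDrop (f g : ℝ≥0 → ℝ) (x : ℝ≥0) : ℝ := futureSup f g 0 - strictFutureSup f g x

section Future

variable {f g : ℝ≥0 → ℝ} {T : ℝ≥0} (hf : IsCadlagPos f) (hg : IsCadlagPos g)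
  (hfT : ∀ s, T ≤ s → f s = f T) (hgT : ∀ s, T ≤ s → g s = g T)

include hf hfT in
theorem leftVal_of_stopped {x : ℝ≥0} (hx : T < x) : leftVal f x = f T := by
  have hx0 : x ≠ 0 := (lt_of_le_of_lt zero_le hx).ne'
  have := nhdsLT_neBot_of_ne_zero hx0
  refine tendsto_nhds_unique (hf.tendsto_left hx0) (tendsto_const_nhds.congr' ?_)
  filter_upwards [Ioo_mem_nhdsLT hx] with s hs using (hfT s hs.1.le).symm

include hf hfT hgT in
theorem jumpGain_of_stopped {x : ℝ≥0} (hx : T < x) : jumpGain f g x = g T - f T := by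
  rw [jumpGain, leftVal_of_stopped hf hfT hx, hgT x hx.le]

include hf hg hfT hgT

/-- Stopping makes suprema over the unbounded future finite: after `T` the gain is constant. -/
theorem bddAbove_range_jumpGain : BddAbove (range (jumpGain f g)) := by
  refine ⟨max (runMax f g T) (g T - f T), ?_⟩
  rintro _ ⟨s, rfl⟩
  rcases le_or_gt s T with h | h
  · exact le_max_of_le_left (jumpGain_le_runMax hf hg h)
  · exact le_max_of_le_right (jumpGain_of_stopped hf hfT hgT h).le

theorem bddAbove_image_jumpGain (K : Set ℝ≥0) : BddAbove (jumpGain f g '' K) :=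
  (bddAbove_range_jumpGain hf hg hfT hgT).mono (image_subset_range _ _)

theorem jumpGain_le_futureSup {x s : ℝ≥0} (h : x ≤ s) : jumpGain f g s ≤ futureSup f g x :=
  le_csSup (bddAbove_image_jumpGain hf hg hfT hgT _) ⟨s, h, rfl⟩

theorem jumpGain_le_strictFutureSup {x s : ℝ≥0} (h : x < s) :
    jumpGain f g s ≤ strictFutureSup f g x :=
  le_csSup (bddAbove_image_jumpGain hf hg hfT hgT _) ⟨s, h, rfl⟩

omit hf hg hfT hgT in
theorem strictFutureSup_le {x : ℝ≥0} {c : ℝ} (h : ∀ s, x < s → jumpGain f g s ≤ c) :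
    strictFutureSup f g x ≤ c :=
  csSup_le ⟨_, x + 1, by simp, rfl⟩ (by rintro _ ⟨s, hs, rfl⟩; exact h s hs)

omit hf hg hfT hgT in
theorem exists_lt_jumpGain_of_lt_strictFutureSup {x : ℝ≥0} {c : ℝ}
    (h : c < strictFutureSup f g x) : ∃ s, x < s ∧ c < jumpGain f g s := by
  obtain ⟨_, ⟨s, hs, rfl⟩, h'⟩ := exists_lt_of_lt_csSup (⟨_, x + 1, by simp, rfl⟩ :
    (jumpGain f g '' Ioi x).Nonempty) h
  exact ⟨s, hs, h'⟩

theorem futureSup_eq (x : ℝ≥0) :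
    futureSup f g x = max (jumpGain f g x) (strictFutureSup f g x) := by
  refine le_antisymm (csSup_le ⟨_, x, le_refl x, rfl⟩ ?_) (max_le ?_ ?_)
  · rintro _ ⟨s, hs, rfl⟩
    rcases (show x ≤ s from hs).eq_or_lt with rfl | h
    · exact le_max_left _ _
    · exact le_max_of_le_right (jumpGain_le_strictFutureSup hf hg hfT hgT h)
  · exact jumpGain_le_futureSup hf hg hfT hgT le_rfl
  · exact strictFutureSup_le fun s hs => jumpGain_le_futureSup hf hg hfT hgT hs.le

theorem antitone_strictFutureSup : Antitone (strictFutureSup f g) := fun _ _ h =>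
  strictFutureSup_le fun _ hs => jumpGain_le_strictFutureSup hf hg hfT hgT (h.trans_lt hs)

theorem antitone_futureSup : Antitone (futureSup f g) := fun _ y h =>
  csSup_le ⟨_, y, le_refl y, rfl⟩ (by
    rintro _ ⟨s, hs, rfl⟩
    exact jumpGain_le_futureSup hf hg hfT hgT (h.trans hs))

theorem monotone_futureDrop : Monotone (futureDrop f g) := fun _ _ h =>
  sub_le_sub_left (antitone_strictFutureSup hf hg hfT hgT h) _

theorem sub_le_strictFutureSup (x : ℝ≥0) : g x - f x ≤ strictFutureSup f g x :=
  le_of_tendsto (tendsto_jumpGain_right hf hg x) (by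
    filter_upwards [self_mem_nhdsWithin] with s hs using
      jumpGain_le_strictFutureSup hf hg hfT hgT hs)

theorem strictFutureSup_of_le {x : ℝ≥0} (hx : T ≤ x) : strictFutureSup f g x = g T - f T := by
  refine le_antisymm (strictFutureSup_le fun s hs =>
    (jumpGain_of_stopped hf hfT hgT (hx.trans_lt hs)).le) ?_
  have := sub_le_strictFutureSup hf hg hfT hgT x
  rwa [hgT x hx, hfT x hx] at this

theorem isCadlagPos_futureDrop : IsCadlagPos (futureDrop f g) := by
  have hm := monotone_futureDrop hf hg hfT hgT
  refine .of_monotone hm ?_ fun x => ?_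
  · rw [futureDrop, futureSup_eq hf hg hfT hgT]
    exact sub_nonneg.2 (le_max_right _ _)
  · rw [← continuousWithinAt_Ioi_iff_Ici]
    refine tendsto_order.2 ⟨fun c hc => ?_, fun c hc => ?_⟩
    · filter_upwards [self_mem_nhdsWithin] with s hs using hc.trans_le (hm (le_of_lt hs))
    · obtain ⟨s, hs, h⟩ := exists_lt_jumpGain_of_lt_strictFutureSup
        (show futureSup f g 0 - c < strictFutureSup f g x by rw [futureDrop] at hc; linarith)
      filter_upwards [Ioo_mem_nhdsGT hs] with r hr
      have := jumpGain_le_strictFutureSup hf hg hfT hgT hr.2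
      rw [futureDrop]
      linarith

/-- Seen from the left, the strict future of times `s ↑ x` includes `x`. The gain just before `x`
adds nothing in the limit, because its left limit is at most its value at `x`. -/
theorem leftVal_futureDrop (x : ℝ≥0) :
    leftVal (futureDrop f g) x = futureSup f g 0 - futureSup f g x := by
  rcases eq_or_ne x 0 with rfl | hx
  · simp
  have hc := isCadlagPos_futureDrop hf hg hfT hgT
  refine le_antisymm (hc.leftVal_le_of_forall_lt hx fun s hs => ?_) ?_
  · rw [futureDrop, sub_le_sub_iff_left, futureSup_eq hf hg hfT hgT x]
    exact max_le (jumpGain_le_strictFutureSup hf hg hfT hgT hs)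
      (antitone_strictFutureSup hf hg hfT hgT hs.le)
  · refine le_of_forall_pos_le_add fun ε hε => ?_
    have hlt : leftVal g x - leftVal f x < futureSup f g x + ε := by
      have h1 := hg.leftVal_sub_leftVal_le_jumpGain f x
      have h2 := jumpGain_le_futureSup hf hg hfT hgT (le_refl x)
      linarith
    obtain ⟨a, ha, hsub⟩ := (mem_nhdsLT_iff_exists_Ioo_subset' (pos_iff_ne_zero.mpr hx)).1
      ((tendsto_jumpGain_left hf hg hx).eventually_lt_const hlt)
    have h1 : strictFutureSup f g a ≤ futureSup f g x + ε := by
      refine strictFutureSup_le fun s hs => ?_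
      rcases lt_or_ge s x with h | h
      · exact le_of_lt (hsub ⟨hs, h⟩)
      · linarith [jumpGain_le_futureSup hf hg hfT hgT h]
    have h2 := IsCadlagPos.le_leftVal_of_monotone (monotone_futureDrop hf hg hfT hgT)
      (show a < x from ha)
    rw [futureDrop] at h2
    linarith

/-- If `futureDrop` jumps at `x`, the supremum from `x` on is `g x - leftVal f x`, attained at `x`,
while the supremum after `x` is at least `g x - f x`. So the jump is no larger than that of `f`. -/
theorem isCadlagPos_reverseTop : IsCadlagPos fun s => f s - futureDrop f g s := by
  refine hf.sub (isCadlagPos_futureDrop hf hg hfT hgT) fun x => ?_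
  have h1 := hf.jump_nonneg x
  have h2 := sub_le_strictFutureSup hf hg hfT hgT x
  rw [leftVal_futureDrop hf hg hfT hgT, futureDrop]
  rcases le_total (jumpGain f g x) (strictFutureSup f g x) with h | h
  · rw [futureSup_eq hf hg hfT hgT x, max_eq_right h]
    linarith
  · rw [futureSup_eq hf hg hfT hgT x, max_eq_left h, jumpGain]
    linarith

theorem isCadlagPos_reverseBot : IsCadlagPos fun s => g s + futureDrop f g s :=
  hg.add (isCadlagPos_futureDrop hf hg hfT hgT)

theorem jumpGain_reverse (s : ℝ≥0) :
    jumpGain (fun s => f s - futureDrop f g s) (fun s => g s + futureDrop f g s) s =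
      jumpGain f g s + 2 * futureSup f g 0 - strictFutureSup f g s - futureSup f g s := by
  rw [jumpGain, hf.leftVal_sub (isCadlagPos_futureDrop hf hg hfT hgT),
    leftVal_futureDrop hf hg hfT hgT, jumpGain, futureDrop]
  ring

theorem futureSup_zero_eq (y : ℝ≥0) :
    futureSup f g 0 = max (runMax f g y) (strictFutureSup f g y) := by
  refine le_antisymm (csSup_le ⟨_, 0, self_mem_Ici, rfl⟩ ?_) (max_le ?_ ?_)
  · rintro _ ⟨s, -, rfl⟩
    rcases le_or_gt s y with h | h
    · exact le_max_of_le_left (jumpGain_le_runMax hf hg h)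
    · exact le_max_of_le_right (jumpGain_le_strictFutureSup hf hg hfT hgT h)
  · obtain ⟨s, -, e⟩ := exists_jumpGain_eq_runMax hf hg y
    exact e ▸ jumpGain_le_futureSup hf hg hfT hgT zero_le
  · exact strictFutureSup_le fun s _ => jumpGain_le_futureSup hf hg hfT hgT zero_le

/-- The running maximum of the reversed lines restores exactly what `futureDrop` moved, so a pair
and its reversal have the same Pitman transform. The proof distinguishes whether the overall
supremum `futureSup f g 0` is the past maximum or the future supremum at `y`. -/
theorem runMax_reverse (y : ℝ≥0) :
    runMax (fun s => f s - futureDrop f g s) (fun s => g s + futureDrop f g s) y =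
      runMax f g y + futureDrop f g y := by
  have hf' := isCadlagPos_reverseTop hf hg hfT hgT
  have hg' := isCadlagPos_reverseBot hf hg hfT hgT
  have hM0 := futureSup_zero_eq hf hg hfT hgT y
  rw [futureDrop]
  apply le_antisymm
  · obtain ⟨s, hs, e⟩ := exists_jumpGain_eq_runMax hf' hg' y
    rw [← e, jumpGain_reverse hf hg hfT hgT]
    have h1 := antitone_strictFutureSup hf hg hfT hgT hs
    have h2 := jumpGain_le_futureSup hf hg hfT hgT (le_refl s)
    have h3 := jumpGain_le_runMax hf hg hs
    have h4 : strictFutureSup f g s ≤ futureSup f g s := by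
      rw [futureSup_eq hf hg hfT hgT]; exact le_max_right _ _
    rcases le_total (runMax f g y) (strictFutureSup f g y) with h | h
    · rw [max_eq_right h] at hM0
      linarith
    · rw [max_eq_left h] at hM0
      linarith
  · rcases le_or_gt (runMax f g y) (strictFutureSup f g y) with h | h
    · rw [max_eq_right h] at hM0
      obtain ⟨s, hs, e⟩ := exists_jumpGain_eq_runMax hf hg y
      have h1 := jumpGain_le_runMax hf' hg' hs
      rw [jumpGain_reverse hf hg hfT hgT] at h1
      have h2 : futureSup f g s ≤ futureSup f g 0 :=
        antitone_futureSup hf hg hfT hgT zero_le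
      have h3 : strictFutureSup f g s ≤ futureSup f g s := by
        rw [futureSup_eq hf hg hfT hgT]; exact le_max_right _ _
      linarith
    · rw [max_eq_left h.le] at hM0
      obtain ⟨r, hr, e⟩ := exists_jumpGain_eq_runMax hf hg y
      -- Take the last time up to `y` whose gain reaches the future supremum at `y`. After it no
      -- gain exceeds that supremum, and from it on the supremum is the gain at `s` itself.
      obtain ⟨s, hs, hc, hlast⟩ := exists_last_le_jumpGain hf hg
        ⟨r, hr, (h.trans_eq e.symm).le⟩
      have h1 := jumpGain_le_runMax hf' hg' hs
      rw [jumpGain_reverse hf hg hfT hgT] at h1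
      have h2 : strictFutureSup f g s ≤ strictFutureSup f g y := by
        refine strictFutureSup_le fun q hq => ?_
        rcases le_or_gt q y with h' | h'
        · exact (hlast q h' hq).le
        · exact jumpGain_le_strictFutureSup hf hg hfT hgT h'
      have h3 := futureSup_eq hf hg hfT hgT s
      rw [max_eq_left (h2.trans hc)] at h3
      linarith

end Future

/-! ### The reverse Pitman transform as an isometry of stopped lines -/

/-- The reverse Pitman transform of the lines `i` and `i + 1`. -/
def reversePitman (i : ℕ) (F : ℕ → ℝ≥0 → ℝ) (l : ℕ) : ℝ≥0 → ℝ :=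
  if l = i then fun s => F i s - futureDrop (F i) (F (i + 1)) s
  else if l = i + 1 then fun s => F (i + 1) s + futureDrop (F i) (F (i + 1)) s
  else F l

theorem reversePitman_self (i : ℕ) (F : ℕ → ℝ≥0 → ℝ) :
    reversePitman i F i = fun s => F i s - futureDrop (F i) (F (i + 1)) s := if_pos rfl

theorem reversePitman_succ (i : ℕ) (F : ℕ → ℝ≥0 → ℝ) :
    reversePitman i F (i + 1) = fun s => F (i + 1) s + futureDrop (F i) (F (i + 1)) s := by
  simp [reversePitman]

theorem reversePitman_of_ne {i l : ℕ} (F : ℕ → ℝ≥0 → ℝ) (h1 : l ≠ i) (h2 : l ≠ i + 1) :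
    reversePitman i F l = F l := by
  simp [reversePitman, h1, h2]

/-- Families of lines that are constant from time `T` on. -/
structure IsStopped (T : ℝ≥0) (F : ℕ → ℝ≥0 → ℝ) : Prop where
  cadlag : ∀ l, IsCadlagPos (F l)
  const : ∀ l s, T ≤ s → F l s = F l T

section Stopped

variable {T : ℝ≥0} {F : ℕ → ℝ≥0 → ℝ} (hF : IsStopped T F)
include hF

theorem IsStopped.futureDrop_const (i : ℕ) (s : ℝ≥0) (hs : T ≤ s) :
    futureDrop (F i) (F (i + 1)) s = futureDrop (F i) (F (i + 1)) T := by
  rw [futureDrop, futureDrop, strictFutureSup_of_le (hF.cadlag i) (hF.cadlag (i + 1))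
    (hF.const i) (hF.const (i + 1)) hs, strictFutureSup_of_le (hF.cadlag i) (hF.cadlag (i + 1))
    (hF.const i) (hF.const (i + 1)) le_rfl]

theorem IsStopped.reversePitman (i : ℕ) : IsStopped T (reversePitman i F) where
  cadlag l := by
    unfold Melon.reversePitman
    split_ifs
    · exact isCadlagPos_reverseTop (hF.cadlag i) (hF.cadlag (i + 1)) (hF.const i)
        (hF.const (i + 1))
    · exact isCadlagPos_reverseBot (hF.cadlag i) (hF.cadlag (i + 1)) (hF.const i)
        (hF.const (i + 1))
    · exact hF.cadlag l
  const l s hs := by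
    unfold Melon.reversePitman
    have h1 := hF.futureDrop_const i s hs
    split_ifs
    · simp only [hF.const i s hs, h1]
    · simp only [hF.const (i + 1) s hs, h1]
    · exact hF.const l s hs

theorem pitman_reversePitman (i : ℕ) : pitman i (reversePitman i F) = pitman i F := by
  have h := runMax_reverse (hF.cadlag i) (hF.cadlag (i + 1)) (hF.const i) (hF.const (i + 1))
  funext l s
  by_cases h1 : l = i
  · subst h1
    simp only [pitman_self, reversePitman_self, reversePitman_succ, h]
    ring
  by_cases h2 : l = i + 1
  · subst h2
    simp only [pitman_succ, reversePitman_self, reversePitman_succ, h]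
    ring
  · rw [pitman_of_ne _ h1 h2, pitman_of_ne _ h1 h2, reversePitman_of_ne _ h1 h2]

/-- The reverse Pitman transform is an isometry. -/
theorem isometric_reversePitman {n i : ℕ} (hi : i + 1 < n) :
    Isometric n F (reversePitman i F) := by
  have h1 := isometric_pitman hi hF.cadlag
  have h2 := isometric_pitman hi (hF.reversePitman i).cadlag
  rw [pitman_reversePitman hF] at h2
  exact h1.trans h2.symm

end Stopped

/-! ### Sorting backwards from a final time -/

/-- The lines from `m` to `n - 1` are Pitman ordered when viewed backwards from time `T`. -/
def ReverseOrdered (T : ℝ≥0) (m n : ℕ) (F : ℕ → ℝ≥0 → ℝ) : Prop :=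
  ∀ l, m ≤ l → l + 1 < n → ∀ s, F (l + 1) s - leftVal (F l) s ≤ F (l + 1) T - F l T

/-- Inserting the line `i` into the reverse ordered lines below it. -/
theorem exists_reverseOrdered_insert {n m : ℕ} {T : ℝ≥0} (e : ℕ) : ∀ (i : ℕ), i + 1 + e = n →
    ∀ F : ℕ → ℝ≥0 → ℝ, IsStopped T F → ReverseOrdered T m i F → ReverseOrdered T (i + 1) n F →
    (∀ c, i = c + 1 → m ≤ c → ∀ t, F c T - leftVal (F c) t ≤ F i T - F i t) →
    (i + 1 < n → ∀ c, i = c + 1 → m ≤ c → ∀ t r, t < r →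
      F c T - leftVal (F c) t ≤ leftVal (F i) r - F i t + F (i + 1) T - F (i + 1) r) →
    ∃ G : ℕ → ℝ≥0 → ℝ, IsStopped T G ∧ Isometric n F G ∧ ReverseOrdered T m n G := by
  induction e with
  | zero =>
    intro i hi F hF h1 h2 h3 h4
    refine ⟨F, hF, Isometric.refl n F, fun l hml hl s => ?_⟩
    rcases eq_or_ne (l + 1) i with rfl | hne
    · linarith [h3 l rfl hml s]
    · exact h1 l hml (by omega) s
  | succ e ih =>
    intro i hi F hF h1 h2 h3 h4
    have hc := hF.cadlag i
    have hc' := hF.cadlag (i + 1)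
    have hs := hF.const i
    have hs' := hF.const (i + 1)
    have hR := isCadlagPos_futureDrop hc hc' hs hs'
    have hRm := monotone_futureDrop hc hc' hs hs'
    have hRT : ∀ t, futureDrop (F i) (F (i + 1)) t ≤ futureDrop (F i) (F (i + 1)) T := fun t =>
      (le_total t T).elim (fun h => hRm h) fun h => (hF.futureDrop_const i t h).le
    have hRTe : futureDrop (F i) (F (i + 1)) T =
        futureSup (F i) (F (i + 1)) 0 - (F (i + 1) T - F i T) := by
      rw [futureDrop, strictFutureSup_of_le hc hc' hs hs' le_rfl]
    have hlvtop : ∀ y, leftVal (reversePitman i F i) y =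
        leftVal (F i) y - leftVal (futureDrop (F i) (F (i + 1))) y := fun y => by
      rw [reversePitman_self, hc.leftVal_sub hR]
    have hlvbot : ∀ y, leftVal (reversePitman i F (i + 1)) y =
        leftVal (F (i + 1)) y + leftVal (futureDrop (F i) (F (i + 1))) y := fun y => by
      rw [reversePitman_succ, hc'.leftVal_add hR]
    have hlvR := leftVal_futureDrop hc hc' hs hs'
    have hM : ∀ t, F (i + 1) t - leftVal (F i) t ≤ futureSup (F i) (F (i + 1)) t := fun t =>
      jumpGain_le_futureSup hc hc' hs hs' (le_refl t)
    -- The transform puts lines `i` and `i + 1` in reverse order, so that the only possible defect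
    -- moves down to the pair below. By `h4`, the line above `i` stays in reverse order with the
    -- lowered line `i`.
    refine Exists.elim (ih (i + 1) (by omega) (reversePitman i F) (hF.reversePitman i) ?_ ?_ ?_ ?_)
      fun G h => ⟨G, h.1, (isometric_reversePitman hF (by omega)).trans h.2.1, h.2.2⟩
    · intro l hml hl s
      rcases eq_or_ne (l + 1) i with rfl | hne
      · rw [reversePitman_self, reversePitman_of_ne F (by omega) (by omega)]
        have : strictFutureSup (F (l + 1)) (F (l + 1 + 1)) s ≤ leftVal (F l) s - F l T -
            F (l + 1) s + F (l + 1 + 1) T := by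
          refine strictFutureSup_le fun r hr => ?_
          have := h4 (by omega) l rfl hml s r hr
          rw [jumpGain]
          linarith
        simp only [futureDrop, strictFutureSup_of_le hc hc' hs hs' le_rfl]
        linarith
      · rw [reversePitman_of_ne F (by omega) (by omega), reversePitman_of_ne F (by omega) (by omega)]
        exact h1 l hml (by omega) s
    · intro l hml hl s
      rw [reversePitman_of_ne F (by omega) (by omega), reversePitman_of_ne F (by omega) (by omega)]
      exact h2 l (by omega) hl s
    · intro c hci hmc t
      obtain rfl : i = c := by omega
      rw [hlvtop, hlvR, reversePitman_self, reversePitman_succ]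
      simp only
      linarith [hM t, hRT t]
    · intro hin c hci hmc t r htr
      obtain rfl : i = c := by omega
      rw [hlvtop, hlvbot, reversePitman_self, reversePitman_succ,
        reversePitman_of_ne F (by omega) (by omega)]
      have b1 := h2 (i + 1) le_rfl hin r
      have b2 := IsCadlagPos.le_leftVal_of_monotone hRm htr
      have b3 := hlvR t
      simp only
      linarith [hM t]

/-- Insertion sort again, now from the bottom: each new top line is carried downwards into the lines
already in reverse order. -/
theorem exists_reverseOrdered_isometric (n : ℕ) {T : ℝ≥0} {F : ℕ → ℝ≥0 → ℝ}
    (hF : IsStopped T F) :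
    ∃ G : ℕ → ℝ≥0 → ℝ, IsStopped T G ∧ Isometric n F G ∧ ReverseOrdered T 0 n G := by
  have key : ∀ c m, m + c = n → ∃ G : ℕ → ℝ≥0 → ℝ,
      IsStopped T G ∧ Isometric n F G ∧ ReverseOrdered T m n G := by
    intro c
    induction c with
    | zero => exact fun m hm => ⟨F, hF, Isometric.refl n F, fun l hl hl' => absurd hl (by omega)⟩
    | succ c ih =>
      intro m hm
      obtain ⟨G, hG, hiso, hord⟩ := ih (m + 1) (by omega)
      obtain ⟨H, hH, hiso', hord'⟩ := exists_reverseOrdered_insert (m := m) c m (by omega) G hG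
        (fun l h h' => absurd h (by omega)) hord (fun c h h' => absurd h (by omega))
        (fun _ c h h' => absurd h (by omega))
      exact ⟨H, hH, hiso.trans hiso', hord'⟩
  exact key n 0 (by omega)

/-- For reverse ordered lines the latest tuple is optimal. -/
theorem lastPassage_of_reverseOrdered {T : ℝ≥0} {F : ℕ → ℝ≥0 → ℝ} (hF : ∀ l, IsCadlagPos (F l))
    {d k : ℕ} (hord : ReverseOrdered T 0 (d + k + 1) F) {x : ℝ≥0} (hx : x ≤ T) :
    lastPassage F (d + k + 1) k x T + lowSum F d k x =
      ∑ e ∈ Finset.range (k + 1), F (d + e) T := by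
  rw [← eq_sub_iff_add_eq]
  refine le_antisymm (lastPassage_le (by omega) hx fun A hA => (weight_le hF hA).trans ?_) ?_
  · have h : ∑ j ∈ Finset.range (k + 1), ∑ e ∈ Finset.range d,
        (F (j + 1 + e) (A j (j + 1 + e)) - leftVal (F (j + e)) (A j (j + 1 + e))) ≤
        ∑ j ∈ Finset.range (k + 1), (F (d + j) T - F j T) := by
      refine Finset.sum_le_sum fun j hj => ?_
      have hj := Finset.mem_range.mp hj
      calc _ ≤ ∑ e ∈ Finset.range d, (F (j + (e + 1)) T - F (j + e) T) := by
            -- In reverse order each gain is at most its value with both lines taken at `T`, and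
            -- these values telescope along a path.
            refine Finset.sum_le_sum fun e he => ?_
            have he := Finset.mem_range.mp he
            rw [show j + 1 + e = j + e + 1 by ring, show j + (e + 1) = j + e + 1 by ring]
            exact hord (j + e) (Nat.zero_le _) (by omega) _
        _ = _ := by
            rw [Finset.sum_range_sub (fun e => F (j + e) T), add_zero, add_comm d j]
    rw [Finset.sum_sub_distrib] at h
    rw [lowSum]
    linarith
  · refine le_trans ?_ (weight_le_lastPassage hF (by omega) (isInterlaced_lateTuple d k hx))
    rw [weight_lateTuple, Finset.sum_sub_distrib, lowSum, le_add_iff_nonneg_right]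
    exact Finset.sum_nonneg fun l _ => sub_nonneg.2 ((hF l).jump_nonneg T)

/-! ### Existence of a recurrent family with given last passage values -/

theorem IsCadlagPos.stoppedAt {g : ℝ≥0 → ℝ} (hg : IsCadlagPos g) (T : ℝ≥0) :
    IsCadlagPos fun s => g (min s T) := by
  have hlim : ∀ x, x ≤ T → Tendsto g (𝓝[<] x) = Tendsto (fun s => g (min s T)) (𝓝[<] x) := by
    intro x hx
    funext l
    refine propext (tendsto_congr' ?_)
    filter_upwards [self_mem_nhdsWithin] with s hs
    rw [min_eq_left ((le_of_lt hs).trans hx)]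
  have hlate : ∀ x, T < x → Tendsto (fun s => g (min s T)) (𝓝[<] x) (𝓝 (g T)) := by
    intro x hx
    refine tendsto_const_nhds.congr' ?_
    filter_upwards [Ioo_mem_nhdsLT hx] with s hs
    rw [min_eq_right hs.1.le]
  refine ⟨fun x => ?_, fun x => ?_, fun x => ?_⟩
  · rcases lt_or_ge x T with h | h
    · have := hg.right_cont x
      rw [ContinuousWithinAt, min_eq_left h.le]
      refine this.tendsto.congr' ?_
      filter_upwards [mem_nhdsWithin_of_mem_nhds (Iio_mem_nhds h)] with s hs
      rw [min_eq_left (le_of_lt hs)]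
    · rw [ContinuousWithinAt, min_eq_right h]
      refine tendsto_const_nhds.congr' ?_
      filter_upwards [self_mem_nhdsWithin] with s hs
      rw [min_eq_right (h.trans hs)]
  · rcases le_or_gt x T with h | h
    · obtain ⟨l, hl⟩ := hg.left_lim x
      exact ⟨l, by rwa [← hlim x h]⟩
    · exact ⟨_, hlate x h⟩
  · rcases eq_or_ne x 0 with rfl | hx
    · simpa using hg.nonneg_zero
    rcases le_or_gt x T with h | h
    · rw [min_eq_left h]
      refine (le_of_eq ?_).trans (hg.jump_nonneg x)
      exact leftVal_eq_of_tendsto hx (by rw [← hlim x h]; exact hg.tendsto_left hx)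
    · rw [min_eq_right h.le]
      exact (leftVal_eq_of_tendsto hx (hlate x h)).le

theorem isCadlagPos_of_approx {h : ℝ≥0 → ℝ}
    (H : ∀ (X : ℝ≥0) (ε : ℝ), 0 < ε → ∃ g, IsCadlagPos g ∧ ∀ s ≤ X, |g s - h s| ≤ ε) :
    IsCadlagPos h := by
  have hleft : ∀ x, x ≠ 0 → ∃ l, Tendsto h (𝓝[<] x) (𝓝 l) := by
    intro x hx
    have := nhdsLT_neBot_of_ne_zero hx
    rw [← cauchy_map_iff_exists_tendsto, Metric.cauchy_iff]
    refine ⟨inferInstance, fun ε hε => ?_⟩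
    obtain ⟨g, hg, hclose⟩ := H x (ε / 5) (by positivity)
    refine ⟨h '' {s | s < x ∧ |g s - leftVal g x| < ε / 5}, image_mem_map ?_, ?_⟩
    · filter_upwards [self_mem_nhdsWithin,
        (hg.tendsto_left hx).eventually (Metric.ball_mem_nhds _ (by positivity : 0 < ε / 5))]
        with s h1 h2 using ⟨h1, by simpa [Real.dist_eq] using h2⟩
    · rintro _ ⟨s, ⟨hs, hs'⟩, rfl⟩ _ ⟨r, ⟨hr, hr'⟩, rfl⟩
      have a1 := abs_le.mp (hclose s hs.le)
      have a2 := abs_le.mp (hclose r hr.le)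
      have a3 := abs_lt.mp hs'
      have a4 := abs_lt.mp hr'
      rw [Real.dist_eq, abs_lt]
      constructor <;> linarith [a1.1, a1.2, a2.1, a2.2, a3.1, a3.2, a4.1, a4.2]
  refine ⟨fun x => ?_, fun x => ?_, fun x => ?_⟩
  · rw [ContinuousWithinAt, Metric.tendsto_nhds]
    intro ε hε
    obtain ⟨g, hg, hclose⟩ := H (x + 1) (ε / 4) (by positivity)
    filter_upwards [mem_nhdsWithin_of_mem_nhds (Iio_mem_nhds (show x < x + 1 by simp)),
      (hg.right_cont x).tendsto.eventually (Metric.ball_mem_nhds _ (by positivity : 0 < ε / 4))]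
      with s h1 h2
    have a1 := abs_le.mp (hclose s (le_of_lt h1))
    have a2 := abs_le.mp (hclose x (by simp))
    rw [Real.dist_eq] at h2
    have a3 := abs_lt.mp h2
    rw [Real.dist_eq, abs_lt]
    constructor <;> linarith [a1.1, a1.2, a2.1, a2.2, a3.1, a3.2]
  · rcases eq_or_ne x 0 with rfl | hx
    · exact ⟨0, by simp⟩
    · exact hleft x hx
  · refine le_of_forall_pos_le_add fun ε hε => ?_
    obtain ⟨g, hg, hclose⟩ := H x (ε / 2) (by positivity)
    have a2 := abs_le.mp (hclose x le_rfl)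
    rcases eq_or_ne x 0 with rfl | hx
    · have := hg.nonneg_zero
      rw [leftVal_zero]
      linarith [a2.1]
    · obtain ⟨l, hl⟩ := hleft x hx
      have := nhdsLT_neBot_of_ne_zero hx
      have h1 : l ≤ leftVal g x + ε / 2 :=
        le_of_tendsto_of_tendsto hl ((hg.tendsto_left hx).add_const _) (by
          filter_upwards [self_mem_nhdsWithin] with s hs
          linarith [(abs_le.mp (hclose s (le_of_lt hs))).1])
      rw [leftVal_eq_of_tendsto hx hl]
      linarith [hg.jump_nonneg x, a2.2]

theorem leftVal_eq_lowSum_sub {n l : ℕ} (hl : l + 1 < n) (F : ℕ → ℝ≥0 → ℝ) (x : ℝ≥0) :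
    leftVal (F l) x = lowSum F l (n - l - 1) x - lowSum F (l + 1) (n - (l + 1) - 1) x := by
  rw [lowSum, Finset.sum_range_succ', lowSum, show n - (l + 1) - 1 + 1 = n - l - 1 by omega,
    add_zero, eq_sub_iff_add_eq, add_comm]
  congr 1
  exact Finset.sum_congr rfl fun e _ => by rw [show l + (e + 1) = l + 1 + e by ring]

theorem abs_leftVal_sub_le_of_lowSum {n : ℕ} {F G : ℕ → ℝ≥0 → ℝ} {x : ℝ≥0} {ε : ℝ}
    (h : ∀ d k, n = d + k + 1 → |lowSum F d k x - lowSum G d k x| ≤ ε) {l : ℕ} (hl : l < n) :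
    |leftVal (F l) x - leftVal (G l) x| ≤ 2 * ε := by
  have h1 := h l (n - l - 1) (by omega)
  rcases (show l + 1 ≤ n from hl).eq_or_lt with h0 | h0
  · have e : n - l - 1 = 0 := by omega
    simp only [e, lowSum, zero_add, Finset.sum_range_one, add_zero] at h1
    linarith [abs_nonneg (leftVal (F l) x - leftVal (G l) x)]
  · have h1 := abs_le.mp h1
    have h2 := abs_le.mp (h (l + 1) (n - (l + 1) - 1) (by omega))
    rw [leftVal_eq_lowSum_sub h0, leftVal_eq_lowSum_sub h0, abs_le]
    constructor <;> linarith [h1.1, h1.2, h2.1, h2.2]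

/-- The approximations of the inverse of the melon map converge locally uniformly. -/
theorem exists_locally_uniform_limit {n : ℕ} {G : ℕ → ℕ → ℝ≥0 → ℝ}
    (hG : ∀ m l, IsCadlagPos (G m l))
    (hlow : ∀ d k, n = d + k + 1 → ∀ (X : ℝ≥0) (ε : ℝ), 0 < ε → ∃ M : ℕ, ∀ m ≥ M, ∀ m' ≥ M,
      ∀ x ≤ X, |lowSum (G m) d k x - lowSum (G m') d k x| ≤ ε) :
    ∃ f : ℕ → ℝ≥0 → ℝ, (∀ l, IsCadlagPos (f l)) ∧ ∀ (X : ℝ≥0) (ε : ℝ), 0 < ε →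
      ∃ M : ℕ, ∀ m ≥ M, ∀ l < n, ∀ x ≤ X, |G m l x - f l x| ≤ ε := by
  have hcauchy : ∀ (X : ℝ≥0) (ε : ℝ), 0 < ε → ∃ M : ℕ, ∀ m ≥ M, ∀ m' ≥ M, ∀ l < n, ∀ x ≤ X,
      |G m l x - G m' l x| ≤ ε := by
    intro X ε hε
    -- The bound is taken up to `X + 1` because the value at `x` is recovered from left values at
    -- times after `x`.
    choose! M hM using fun d k hn => hlow d k hn (X + 1) (ε / 2) (by positivity)
    refine ⟨(Finset.range (n + 1)).sup fun d => (Finset.range (n + 1)).sup fun k => M d k,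
      fun m hm m' hm' l hl x hx => ?_⟩
    have hMle : ∀ d k, n = d + k + 1 → M d k ≤
        (Finset.range (n + 1)).sup fun d => (Finset.range (n + 1)).sup fun k => M d k :=
      fun d k hn => (Finset.le_sup (f := fun k => M d k)
        (Finset.mem_range.mpr (by omega))).trans (Finset.le_sup
          (f := fun d => (Finset.range (n + 1)).sup fun k => M d k)
          (Finset.mem_range.mpr (by omega)))
    refine (hG m l).abs_sub_le_of_leftVal (hG m' l) (y := X + 1) (hx.trans_lt (by simp))
      fun s hs => ?_
    have := abs_leftVal_sub_le_of_lowSum (n := n) (F := G m) (G := G m') (x := s) (ε := ε / 2)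
      (fun d k hn => hM d k hn m ((hMle d k hn).trans hm) m' ((hMle d k hn).trans hm') s hs) hl
    linarith
  have hlim : ∀ l < n, ∀ x, ∃ v, Tendsto (fun m => G m l x) atTop (𝓝 v) := by
    intro l hl x
    refine cauchySeq_tendsto_of_complete (Metric.cauchySeq_iff'.2 fun ε hε => ?_)
    obtain ⟨M, hM⟩ := hcauchy x (ε / 2) (by positivity)
    refine ⟨M, fun m hm => ?_⟩
    rw [Real.dist_eq]
    exact (hM m hm M le_rfl l hl x le_rfl).trans_lt (by linarith)
  choose! v hv using hlim
  have hunif : ∀ (X : ℝ≥0) (ε : ℝ), 0 < ε → ∃ M : ℕ, ∀ m ≥ M, ∀ l < n, ∀ x ≤ X,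
      |G m l x - v l x| ≤ ε := by
    intro X ε hε
    obtain ⟨M, hM⟩ := hcauchy X ε hε
    refine ⟨M, fun m hm l hl x hx => ?_⟩
    refine le_of_tendsto (tendsto_const_nhds.sub (hv l hl x)).abs ?_
    filter_upwards [eventually_ge_atTop M] with m' hm' using hM m hm m' hm' l hl x hx
  refine ⟨fun l => if l < n then v l else fun _ => 0, fun l => ?_, fun X ε hε => ?_⟩
  · by_cases hl : l < n
    · simp only [if_pos hl]
      refine isCadlagPos_of_approx fun X ε hε => ?_
      obtain ⟨M, hM⟩ := hunif X ε hε
      exact ⟨G M l, hG M l, fun s hs => hM M le_rfl l hl s hs⟩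
    · simp only [if_neg hl]
      exact .zero
  · obtain ⟨M, hM⟩ := hunif X ε hε
    refine ⟨M, fun m hm l hl x hx => ?_⟩
    simp only [if_pos hl]
    exact hM m hm l hl x hx

/-- Every family of lines has the same last passage values as a recurrent one. -/
theorem exists_recurrent (n : ℕ) {g : ℕ → ℝ≥0 → ℝ} (hg : ∀ l, IsCadlagPos (g l)) :
    ∃ f : ℕ → ℝ≥0 → ℝ, (∀ l, IsCadlagPos (f l)) ∧ Recurrent n f ∧
      ∀ k < n, ∀ x y, x ≤ y → lastPassage f n k x y = lastPassage g n k x y := by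
  have hstopped : ∀ m : ℕ, IsStopped (m : ℝ≥0) fun l s => g l (min s m) := fun m =>
    ⟨fun l => (hg l).stoppedAt m, fun l s hs => by simp [hs]⟩
  choose G hGs hGi hGo using fun m : ℕ => exists_reverseOrdered_isometric n (hstopped m)
  have hGc : ∀ m l, IsCadlagPos (G m l) := fun m l => (hGs m).cadlag l
  have hlp : ∀ m : ℕ, ∀ k < n, ∀ x y : ℝ≥0, x ≤ y → y ≤ m →
      lastPassage (G m) n k x y = lastPassage g n k x y := by
    intro m k hk x y hxy hym
    rw [← (hGi m).lastPassage_eq (hstopped m).cadlag (hGc m) hk hxy, ← sub_eq_zero, ← abs_nonpos_iff]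
    have := abs_lastPassage_sub_le (hstopped m).cadlag hg hk hxy le_rfl fun l _ s hs => by
      rw [min_eq_left (hs.trans hym), sub_self, abs_zero]
    simpa using this
  have hlow : ∀ d k, n = d + k + 1 → ∀ (m : ℕ) (x : ℝ≥0), x ≤ m →
      lowSum (G m) d k x = lastPassage g n k 0 m - lastPassage g n k x m := by
    intro d k hn m x hx
    subst hn
    have h1 := lastPassage_of_reverseOrdered (hGc m) (hGo m) hx
    have h2 := lastPassage_of_reverseOrdered (hGc m) (hGo m) (zero_le (a := (m : ℝ≥0)))
    rw [hlp m k (by omega) _ _ hx le_rfl] at h1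
    rw [hlp m k (by omega) _ _ zero_le le_rfl, lowSum] at h2
    simp only [leftVal_zero, Finset.sum_const_zero, add_zero] at h2
    linarith
  -- `G m` attains equality in `lastPassage_add_lowSum_le` at time `m`, while `G m'` only satisfies
  -- the inequality there with the same last passage values. So the increments of `lowSum` decrease
  -- in `m`.
  have hmono : ∀ d k, n = d + k + 1 → ∀ m m' : ℕ, m ≤ m' → ∀ x' x : ℝ≥0, x' ≤ x → x ≤ m →
      lowSum (G m') d k x - lowSum (G m') d k x' ≤ lowSum (G m) d k x - lowSum (G m) d k x' := by
    intro d k hn m m' hm x' x hx hxm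
    have hm' : (m : ℝ≥0) ≤ m' := by exact_mod_cast hm
    rw [hlow d k hn m x hxm, hlow d k hn m x' (hx.trans hxm)]
    subst hn
    have h := lastPassage_add_lowSum_le (hGc m') (d := d) (k := k) hx hxm
    rw [hlp m' k (by omega) _ _ hxm hm', hlp m' k (by omega) _ _ (hx.trans hxm) hm'] at h
    linarith
  have hlow0 : ∀ F : ℕ → ℝ≥0 → ℝ, ∀ d k, lowSum F d k 0 = 0 := fun F d k => by simp [lowSum]
  obtain ⟨f, hf, hunif⟩ := exists_locally_uniform_limit (n := n) hGc (by
    intro d k hn X ε hε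
    obtain ⟨N, hN⟩ := exists_nat_ge X
    have hNm : ∀ m, N ≤ m → X ≤ (m : ℝ≥0) := fun m hm => hN.trans (by exact_mod_cast hm)
    have hanti : Antitone fun i : ℕ => lowSum (G (N + i)) d k X := by
      intro i i' hi
      have := hmono d k hn (N + i) (N + i') (by omega) 0 X zero_le (hNm _ (by omega))
      simpa [hlow0] using this
    have hbdd : BddBelow (range fun i : ℕ => lowSum (G (N + i)) d k X) := by
      refine ⟨lowSum g d k X, ?_⟩
      rintro _ ⟨i, rfl⟩
      simp only
      rw [hlow d k hn _ _ (hNm (N + i) (by omega))]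
      subst hn
      have := lastPassage_add_lowSum_le hg (d := d) (k := k) (zero_le (a := X))
        (hNm (N + i) (by omega))
      rw [hlow0] at this
      linarith
    obtain ⟨I, hI⟩ := Metric.cauchySeq_iff.1 (tendsto_atTop_ciInf hanti hbdd).cauchySeq ε hε
    -- The difference of the two `lowSum`s is nonnegative and nondecreasing in `x`, so its size at
    -- `X` controls it on all of `[0, X]`.
    have key : ∀ m m', N + I ≤ m → m ≤ m' → ∀ x ≤ X,
        |lowSum (G m) d k x - lowSum (G m') d k x| ≤ ε := by
      intro m m' hm hmm' x hx
      have hXm := hNm m (by omega)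
      have h1 := hmono d k hn m m' hmm' 0 x zero_le (hx.trans hXm)
      have h2 := hmono d k hn m m' hmm' x X hx hXm
      have h3 := hI (m - N) (by omega) (m' - N) (by omega)
      rw [show N + (m - N) = m by omega, show N + (m' - N) = m' by omega, Real.dist_eq] at h3
      have h3 := abs_lt.mp h3
      rw [hlow0, hlow0] at h1
      rw [abs_le]
      constructor <;> linarith [h3.1, h3.2]
    refine ⟨N + I, fun m hm m' hm' x hx => ?_⟩
    rcases le_total m m' with h | h
    · exact key m m' hm h x hx
    · rw [abs_sub_comm]
      exact key m' m hm' h x hx)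
  have hlpf : ∀ k < n, ∀ x y, x ≤ y → lastPassage f n k x y = lastPassage g n k x y := by
    intro k hk x y hxy
    have hC : (0 : ℝ) < n * (2 * (k + 1)) + 1 := by positivity
    rw [← sub_eq_zero, ← abs_nonpos_iff]
    refine le_of_forall_pos_le_add fun δ hδ => ?_
    obtain ⟨M, hM⟩ := hunif y (δ / (n * (2 * (k + 1)) + 1)) (by positivity)
    obtain ⟨N, hN⟩ := exists_nat_ge y
    have hy : y ≤ ((max M N : ℕ) : ℝ≥0) := hN.trans (by exact_mod_cast le_max_right M N)
    have h1 := abs_lastPassage_sub_le hf (hGc (max M N)) hk hxy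
      (by positivity : 0 ≤ δ / (n * (2 * (k + 1)) + 1)) fun l hl s hs => by
        rw [abs_sub_comm]
        exact hM (max M N) (le_max_left _ _) l hl s hs
    rw [hlp _ k hk x y hxy hy] at h1
    refine h1.trans ?_
    rw [zero_add, mul_div_assoc', div_le_iff₀ hC]
    nlinarith
  refine ⟨f, hf, ?_, hlpf⟩
  -- The recurrence time is a large `m` itself: there `lowSum (G m) d k x` is exactly a difference
  -- of last passage values, and `G m` is close to `f` up to `x`.
  intro k d hn x X δ hδ
  obtain ⟨M, hM⟩ := hunif x (δ / (k + 1)) (by positivity)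
  obtain ⟨N, hN⟩ := exists_nat_ge (max x X)
  have hm : max x X ≤ ((max M N : ℕ) : ℝ≥0) := hN.trans (by exact_mod_cast le_max_right M N)
  have hxm := (le_max_left x X).trans hm
  refine ⟨(max M N : ℕ), (le_max_right _ _).trans hm, hxm, ?_⟩
  have h1 := hlow d k hn _ _ hxm
  rw [hlpf k (by omega) _ _ zero_le, hlpf k (by omega) _ _ hxm]
  have h2 := abs_le.mp (abs_lowSum_sub_le (hGc (max M N)) hf (d := d) (k := k) (x := x)
    (by positivity : 0 ≤ δ / (k + 1)) fun l hl s hs =>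
      hM _ (le_max_left _ _) l (by omega) s hs)
  have h3 : ((k : ℝ) + 1) * (δ / (k + 1)) = δ := by field_simp
  linarith [h2.2]

/-! ### From paths as sets to interlaced arrays -/

/-- An `n`-tuple of lines as a sequence, continued by zero. -/
def extend {n : ℕ} (f : Fin n → ℝ≥0 → ℝ) (l : ℕ) : ℝ≥0 → ℝ :=
  if h : l < n then f ⟨l, h⟩ else fun _ => 0

theorem extend_of_lt {n : ℕ} (f : Fin n → ℝ≥0 → ℝ) {l : ℕ} (h : l < n) :
    extend f l = f ⟨l, h⟩ := dif_pos h

theorem extend_val {n : ℕ} (f : Fin n → ℝ≥0 → ℝ) (i : Fin n) : extend f i = f i :=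
  extend_of_lt f i.2

theorem isCadlagPos_extend {n : ℕ} {f : Fin n → ℝ≥0 → ℝ} (hf : f ∈ D n) (l : ℕ) :
    IsCadlagPos (extend f l) := by
  unfold extend
  split_ifs with h
  · exact hf _
  · exact .zero

/-- Adding intervals from left to right, the new one meets the earlier union at most in the point `b
k`; inclusion and exclusion then produces the gap weight. -/
theorem dg_biUnion_Icc (g : ℝ≥0 → ℝ) (a b : ℕ → ℝ≥0) (k : ℕ) (h1 : ∀ j ≤ k, a j ≤ b j)
    (h2 : ∀ j < k, b j ≤ a (j + 1)) :
    dg g {s | ∃ j ≤ k, s ∈ Icc (a j) (b j)} = lineWeight g k a b ∧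
      IsElementary {s | ∃ j ≤ k, s ∈ Icc (a j) (b j)} ∧
      ∀ s, (∃ j ≤ k, s ∈ Icc (a j) (b j)) → s ≤ b k := by
  induction k with
  | zero =>
    have e : {s | ∃ j ≤ 0, s ∈ Icc (a j) (b j)} = Icc (a 0) (b 0) := by
      ext s
      simp
    rw [e]
    refine ⟨?_, isElementary_Icc _ _, fun s hs => ?_⟩
    · rw [dg_Icc g (h1 0 le_rfl)]
      simp [lineWeight]
    · obtain ⟨j, hj, hs⟩ := hs
      obtain rfl : j = 0 := by omega
      exact hs.2
  | succ k ih =>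
    obtain ⟨i1, i2, i3⟩ := ih (fun j hj => h1 j (by omega)) fun j hj => h2 j (by omega)
    have e : {s | ∃ j ≤ k + 1, s ∈ Icc (a j) (b j)} =
        {s | ∃ j ≤ k, s ∈ Icc (a j) (b j)} ∪ Icc (a (k + 1)) (b (k + 1)) := by
      ext s
      constructor
      · rintro ⟨j, hj, hs⟩
        rcases hj.eq_or_lt with rfl | h
        · exact Or.inr hs
        · exact Or.inl ⟨j, by omega, hs⟩
      · rintro (⟨j, hj, hs⟩ | hs)
        · exact ⟨j, by omega, hs⟩
        · exact ⟨k + 1, le_rfl, hs⟩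
    have hba := h2 k (by omega)
    have hab := h1 (k + 1) le_rfl
    refine ⟨?_, ?_, ?_⟩
    · have hadd := dg_union_add_dg_inter g i2 (isElementary_Icc (a (k + 1)) (b (k + 1)))
      rw [← e, i1, dg_Icc g hab] at hadd
      have hinter : dg g ({s | ∃ j ≤ k, s ∈ Icc (a j) (b j)} ∩ Icc (a (k + 1)) (b (k + 1))) =
          g (b k) - leftVal g (a (k + 1)) - gapWeight g (b k) (a (k + 1)) := by
        unfold gapWeight
        split_ifs with h
        · have : {s | ∃ j ≤ k, s ∈ Icc (a j) (b j)} ∩ Icc (a (k + 1)) (b (k + 1)) = ∅ := by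
            ext s
            simp only [mem_inter_iff, mem_empty_iff_false, iff_false, not_and]
            intro hs hs'
            exact absurd ((i3 s hs).trans_lt h) (not_lt.mpr hs'.1)
          rw [this, dg_empty, sub_self]
        · have he : b k = a (k + 1) := le_antisymm hba (not_lt.mp h)
          have : {s | ∃ j ≤ k, s ∈ Icc (a j) (b j)} ∩ Icc (a (k + 1)) (b (k + 1)) =
              Icc (b k) (b k) := by
            ext s
            constructor
            · rintro ⟨hs, hs'⟩
              exact ⟨he ▸ hs'.1, i3 s hs⟩
            · intro hs
              obtain rfl : s = b k := le_antisymm hs.2 hs.1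
              exact ⟨⟨k, le_rfl, h1 k (by omega), le_rfl⟩, he.ge, he ▸ hab⟩
          rw [this, dg_Icc g le_rfl, he]
          ring
      rw [hinter] at hadd
      simp only [lineWeight] at hadd ⊢
      rw [Finset.sum_range_succ]
      linarith
    · rw [e]
      exact i2.union (isElementary_Icc _ _)
    · rintro s ⟨j, hj, hs⟩
      rcases hj.eq_or_lt with rfl | h
      · exact hs.2
      · exact (i3 s ⟨j, by omega, hs⟩).trans (hba.trans hab)

namespace UpPath

variable {n : ℕ} {x y : ℝ≥0}

/-- Lying to the left orders the jump times of the two paths. If `ρ` then entered a line before `π`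
left it, they would share an interval of positive length, which is infinite. -/
theorem leftOf_and_essDisjoint_iff (π ρ : UpPath n x y) :
    π.LeftOf ρ ∧ π.EssDisjoint ρ ↔ ∀ l : Fin n, π.times l.castSucc ≤ ρ.times l.succ := by
  constructor
  · rintro ⟨hl, hd⟩
    have hle : ∀ r, π.times r ≤ ρ.times r := by
      intro r
      refine Fin.cases ?_ (fun i => ?_) r
      · rw [π.times_zero, ρ.times_zero]
      · by_cases hi : (i : ℕ) + 1 < n
        · have h1 : (π.times i.succ, (⟨i + 1, hi⟩ : Fin n)) ∈ π.carrier :=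
            ⟨π.antitone (by simp [Fin.le_def]), le_rfl⟩
          have h2 : (ρ.times i.succ, i) ∈ ρ.carrier :=
            ⟨le_rfl, ρ.antitone (Fin.castSucc_lt_succ).le⟩
          rcases hl _ h1 _ h2 with h | h
          · exact absurd (Fin.le_def.mp h) (by simp)
          · exact h
        · have : i.succ = Fin.last n := by
            ext
            have := i.2
            simp
            omega
          rw [this, π.times_last, ρ.times_last]
    intro l
    by_contra! hlt
    refine (Icc_infinite hlt) (Finite.of_finite_image (f := fun s => (s, l))
      (hd.subset ?_) fun s _ t _ h => (Prod.mk.inj h).1)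
    rintro _ ⟨s, hs, rfl⟩
    exact ⟨⟨(hle _).trans hs.1, hs.2⟩, ⟨hs.1, hs.2.trans (hle _)⟩⟩
  · intro h
    refine ⟨?_, ?_⟩
    · rintro ⟨s, a⟩ hs ⟨t, b⟩ ht
      by_contra! hcon
      obtain ⟨h1, h2⟩ := hcon
      have h3 : ρ.times a.succ ≤ ρ.times b.succ :=
        ρ.antitone (Fin.succ_le_succ_iff.mpr (le_of_lt h1))
      exact absurd ((hs.2.trans (h a)).trans (h3.trans ht.1)) (not_le.mpr h2)
    · refine (finite_range fun l : Fin n => (π.times l.castSucc, l)).subset ?_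
      rintro ⟨s, l⟩ ⟨h1, h2⟩
      refine ⟨l, ?_⟩
      have : s = π.times l.castSucc := le_antisymm h1.2 ((h l).trans h2.1)
      rw [this]

end UpPath

section Tuples

variable {n k : ℕ} {x y : ℝ≥0}

theorem isDisjointTuple_iff {π : Fin (k + 1) → UpPath n x y} {T : ℕ → ℕ → ℝ≥0}
    (h : ∀ (j : Fin (k + 1)) (l : Fin (n + 1)), (π j).times l = T j l) :
    IsDisjointTuple π ↔ IsInterlaced n k x y T := by
  simp only [IsDisjointTuple, UpPath.leftOf_and_essDisjoint_iff]
  constructor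
  · intro hd
    refine ⟨fun j hj => ?_, fun j hj => ?_, fun j hj l hl => ?_, fun j hj l hl => ?_⟩
    · exact (h ⟨j, by omega⟩ 0).symm.trans (π _).times_zero
    · exact (h ⟨j, by omega⟩ (Fin.last n)).symm.trans (π _).times_last
    · have := (π ⟨j, by omega⟩).antitone (Fin.castSucc_lt_succ (i := ⟨l, hl⟩)).le
      rwa [h, h] at this
    · have := hd ⟨j, by omega⟩ ⟨j + 1, by omega⟩ (by simp [Fin.lt_def]) ⟨l, hl⟩
      rwa [h, h] at this
  · intro hT i j hij l
    rw [h, h]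
    -- Interlacing of consecutive paths passes to all pairs, since jump times are monotone along
    -- each path.
    have key : ∀ m i : ℕ, i + 1 + m ≤ k → T i l ≤ T (i + 1 + m) (l + 1) := by
      intro m
      induction m with
      | zero => exact fun i hi => hT.inter i (by omega) l l.2
      | succ m ih =>
        intro i hi
        exact (ih i (by omega)).trans ((hT.anti _ (by omega) l l.2).trans
          (hT.inter (i + 1 + m) (by omega) l l.2))
    have hij' : (i : ℕ) < j := hij
    obtain ⟨m, hm⟩ := Nat.exists_eq_add_of_lt hij'
    have hj := j.2
    have := key m i (by omega)
    rw [show (i : ℕ) + 1 + m = j by omega] at this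
    simpa using this

theorem tupleLength_eq (f : Fin n → ℝ≥0 → ℝ) {π : Fin (k + 1) → UpPath n x y}
    {T : ℕ → ℕ → ℝ≥0} (h : ∀ (j : Fin (k + 1)) (l : Fin (n + 1)), (π j).times l = T j l)
    (hT : IsInterlaced n k x y T) : tupleLength f π = weight (extend f) n k T := by
  rw [tupleLength, weight, Finset.sum_range]
  refine Finset.sum_congr rfl fun i _ => ?_
  rw [extend_val, ← (dg_biUnion_Icc (f i) (fun j => T j (i + 1)) (fun j => T j i) k
    (fun j hj => hT.anti j hj i i.2) (fun j hj => hT.inter j hj i i.2)).1]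
  congr 1
  ext s
  simp only [mem_iUnion, UpPath.interval, h, Fin.val_succ, Fin.val_castSucc]
  constructor
  · rintro ⟨j, hj⟩
    exact ⟨j, by omega, hj⟩
  · rintro ⟨j, hj, hs⟩
    exact ⟨⟨j, by omega⟩, hs⟩

/-- The tuple of paths with given jump times. -/
def IsInterlaced.toPaths {T : ℕ → ℕ → ℝ≥0} (hT : IsInterlaced n k x y T) (j : Fin (k + 1)) :
    UpPath n x y where
  times l := T j l
  antitone l m h := hT.le_of_le (by omega) h (by omega)
  times_zero := hT.top j (by omega)
  times_last := hT.bot j (by omega)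

theorem tupleLengths_succ (f : Fin n → ℝ≥0 → ℝ) (k : ℕ) (x y : ℝ≥0) :
    tupleLengths f (k + 1) x y = weights (extend f) n k x y := by
  ext L
  constructor
  · rintro ⟨π, hπ, rfl⟩
    set T : ℕ → ℕ → ℝ≥0 := fun j l =>
      if h : j < k + 1 ∧ l < n + 1 then (π ⟨j, h.1⟩).times ⟨l, h.2⟩ else 0
    have h : ∀ (j : Fin (k + 1)) (l : Fin (n + 1)), (π j).times l = T j l := fun j l =>
      (dif_pos ⟨j.2, l.2⟩ : T j l = _).symm
    have hT := (isDisjointTuple_iff h).1 hπ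
    exact ⟨T, hT, (tupleLength_eq f h hT).symm⟩
  · rintro ⟨T, hT, rfl⟩
    have h : ∀ (j : Fin (k + 1)) (l : Fin (n + 1)), (hT.toPaths j).times l = T j l :=
      fun _ _ => rfl
    exact ⟨hT.toPaths, (isDisjointTuple_iff h).2 hT, tupleLength_eq f h hT⟩

theorem multiLpp_succ (f : Fin n → ℝ≥0 → ℝ) (k : ℕ) (x y : ℝ≥0) :
    multiLpp f (k + 1) x y = lastPassage (extend f) n k x y := by
  rw [multiLpp, tupleLengths_succ, lastPassage]

theorem pathLengths_eq (f : Fin n → ℝ≥0 → ℝ) (x y : ℝ≥0) :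
    pathLengths f x y = weights (extend f) n 0 x y := by
  rw [← tupleLengths_succ]
  have hlen : ∀ π : Fin 1 → UpPath n x y, tupleLength f π = (π 0).length f := by
    intro π
    exact Finset.sum_congr rfl fun i _ => congrArg (dg (f i)) (iSup_unique _)
  ext L
  constructor
  · rintro ⟨π, rfl⟩
    exact ⟨fun _ => π, fun i j hij => absurd hij (by omega), hlen _⟩
  · rintro ⟨π, -, rfl⟩
    exact ⟨π 0, (hlen π).symm⟩

theorem lpp_eq (f : Fin n → ℝ≥0 → ℝ) (x y : ℝ≥0) :
    lpp f x y = lastPassage (extend f) n 0 x y := by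
  rw [lpp, pathLengths_eq, lastPassage]

end Tuples

/-! ### The melon as the sorted family -/

section MelonMap

variable {n : ℕ}

theorem W_congr {f g : Fin n → ℝ≥0 → ℝ}
    (h : ∀ k < n, ∀ y, lastPassage (extend f) n k 0 y = lastPassage (extend g) n k 0 y) :
    W f = W g := by
  have key : ∀ k ≤ n, ∀ y, multiLpp f k 0 y = multiLpp g k 0 y := by
    rintro (_ | k) hk y
    · rw [multiLpp_zero, multiLpp_zero]
    · rw [multiLpp_succ, multiLpp_succ, h k hk y]
  funext k y
  rw [W, W, key _ (by omega), key _ (by omega)]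

theorem W_of_ordered {f : Fin n → ℝ≥0 → ℝ} {G : ℕ → ℝ≥0 → ℝ} (hG : ∀ l, IsCadlagPos (G l))
    (hord : Ordered n G)
    (h : ∀ k < n, ∀ y, lastPassage (extend f) n k 0 y = lastPassage G n k 0 y) (i : Fin n) :
    W f i = G i := by
  have key : ∀ k ≤ n, ∀ y, multiLpp f k 0 y = ∑ l ∈ Finset.range k, G l y := by
    rintro (_ | k) hk y
    · rw [multiLpp_zero, Finset.range_zero, Finset.sum_empty]
    · rw [multiLpp_succ, h k hk y, lastPassage_of_ordered hG hk hord]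
  funext y
  rw [W, key _ (by omega), key _ (by omega), Finset.sum_range_succ]
  ring

/-- Sorting and `W` give the same lines, because sorted lines are successive differences of last
passage values from time `0`. So `W f` inherits the order and the isometry, the latter for every
starting time and every number of paths. -/
theorem W_spec {f : Fin n → ℝ≥0 → ℝ} (hf : f ∈ D n) :
    W f ∈ Dup n ∧ ∀ k < n, ∀ x y, x ≤ y →
      lastPassage (extend f) n k x y = lastPassage (extend (W f)) n k x y := by
  have hF := isCadlagPos_extend hf
  obtain ⟨G, hG, hiso, hord⟩ := exists_ordered_isometric n hF
  have hlp : ∀ k < n, ∀ x y, x ≤ y → lastPassage (extend f) n k x y = lastPassage G n k x y :=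
    fun k hk x y hxy => hiso.lastPassage_eq hF hG hk hxy
  have hW := W_of_ordered hG hord fun k hk y => hlp k hk 0 y zero_le
  refine ⟨⟨fun i => hW i ▸ hG i, fun i j hij y => ?_⟩, fun k hk x y hxy => ?_⟩
  · rw [hW, hW, ← hij]
    exact hord i (by omega) y
  · rw [hlp k hk x y hxy]
    refine lastPassage_congr (fun l hl => ?_) k x y
    rw [extend_of_lt _ hl, hW]

theorem W_of_mem_Dup {g : Fin n → ℝ≥0 → ℝ} (hg : g ∈ Dup n) : W g = g := by
  funext i
  rw [W_of_ordered (isCadlagPos_extend hg.1) (fun l hl y => ?_) (fun _ _ _ => rfl) i, extend_val]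
  rw [extend_of_lt _ hl, extend_of_lt _ (show l < n by omega)]
  exact hg.2 _ _ rfl y

end MelonMap

/-! ### The bijection -/

section Down

variable {n : ℕ}

theorem HasLateOptimizers.congr {F G : ℕ → ℝ≥0 → ℝ} (hF : HasLateOptimizers n F)
    (h : ∀ l < n, F l = G l) : HasLateOptimizers n G := by
  intro k d hn X
  obtain ⟨y, A, hXy, hA, hopt, hlate⟩ := hF k d hn X
  refine ⟨y, A, hXy, hA, ?_, hlate⟩
  rw [← weight_congr h, ← lastPassage_congr h, hopt]

theorem hasLateOptimizers_of_mem_DdownMinus {f : Fin n → ℝ≥0 → ℝ} (hf : f ∈ DdownMinus n) :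
    HasLateOptimizers n (extend f) := by
  intro k d hn X
  obtain ⟨T, π, hT, hopt, hlim⟩ := hf.2 (k + 1) (by omega) (by omega)
  have hev : ∀ᶠ m in atTop, ∀ (j : Fin (k + 1)) (l : Fin (n + 1)), (l : ℕ) ≤ d + j →
      X ≤ (π m j).times l := by
    refine eventually_all.2 fun j => eventually_all.2 fun l => ?_
    by_cases hl : (l : ℕ) ≤ d + j
    · have := hlim j l
      rw [lowestTimes, if_pos (by omega)] at this
      filter_upwards [this.eventually (lt_mem_nhds (ENNReal.coe_lt_top (r := X)))] with m hm _
      exact (ENNReal.coe_lt_coe.1 hm).le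
    · exact Eventually.of_forall fun m h => absurd h hl
  obtain ⟨m, hm, hXm⟩ := (hev.and (hT.eventually_ge_atTop X)).exists
  set A : ℕ → ℕ → ℝ≥0 := fun j l =>
    if h : j < k + 1 ∧ l < n + 1 then (π m ⟨j, h.1⟩).times ⟨l, h.2⟩ else 0
  have h : ∀ (j : Fin (k + 1)) (l : Fin (n + 1)), (π m j).times l = A j l := fun j l =>
    (dif_pos ⟨j.2, l.2⟩ : A j l = _).symm
  have hA := (isDisjointTuple_iff h).1 (hopt m).1
  refine ⟨T m, A, hXm, hA, ?_, fun j hj l hl => ?_⟩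
  · rw [← tupleLength_eq f h hA, (hopt m).2, multiLpp_succ]
  · have := hm ⟨j, by omega⟩ ⟨l, by omega⟩ hl
    rwa [h] at this

theorem mem_DdownMinus_of_hasLateOptimizers {f : Fin n → ℝ≥0 → ℝ} (hf : f ∈ D n)
    (h : HasLateOptimizers n (extend f)) : f ∈ DdownMinus n := by
  refine ⟨hf, ?_⟩
  rintro (_ | k) hk1 hkn
  · omega
  obtain ⟨d, hd⟩ : ∃ d, n = d + k + 1 := ⟨n - (k + 1), by omega⟩
  choose T A hT hA hopt hlate using fun m : ℕ => h k d hd (m : ℝ≥0)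
  have hcast : Tendsto (fun m : ℕ => (m : ℝ≥0)) atTop atTop := tendsto_natCast_atTop_atTop
  have hpaths : ∀ (m : ℕ) (j : Fin (k + 1)) (l : Fin (n + 1)),
      ((hA m).toPaths j).times l = A m j l := fun _ _ _ => rfl
  refine ⟨T, fun m => (hA m).toPaths, tendsto_atTop_mono hT hcast, fun m => ⟨?_, ?_⟩,
    fun j l => ?_⟩
  · exact (isDisjointTuple_iff (hpaths m)).2 (hA m)
  · rw [tupleLength_eq f (hpaths m) (hA m), hopt, multiLpp_succ]
  · rw [lowestTimes]
    split_ifs with hl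
    · refine tendsto_nhds_top_mono' (f := fun m : ℕ => (m : ℝ≥0∞)) ENNReal.tendsto_nat_nhds_top
        fun m => ?_
      simp only [hpaths]
      rw [← ENNReal.coe_natCast, ENNReal.coe_le_coe]
      exact hlate m j (by omega) l (by omega)
    · refine tendsto_const_nhds.congr fun m => ?_
      have hAm := hA m
      subst hd
      rw [hpaths, hAm.eq_bot (by omega) (by omega) (by omega), ENNReal.coe_zero]

theorem recurrent_of_mem_Ddown {f : Fin n → ℝ≥0 → ℝ} (hf : f ∈ Ddown n) :
    Recurrent n (extend f) := by
  refine recurrent_of_approx (isCadlagPos_extend hf.1) fun ε hε => ?_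
  obtain ⟨h, hh, hclose⟩ := hf.2 ε hε
  refine ⟨extend h, isCadlagPos_extend hh.1, hasLateOptimizers_of_mem_DdownMinus hh, ?_⟩
  intro l t
  unfold extend
  split_ifs
  · exact hclose _ t
  · simpa using hε.le

theorem mem_Ddown_of_recurrent {F : ℕ → ℝ≥0 → ℝ} (hF : ∀ l, IsCadlagPos (F l))
    (rF : Recurrent n F) : (fun i : Fin n => F i) ∈ Ddown n := by
  refine ⟨fun i => hF i, fun ε hε => ?_⟩
  rcases Nat.eq_zero_or_pos n with rfl | hn
  · exact ⟨fun i => F i, ⟨fun i => hF i, fun k h1 h2 => by omega⟩, fun i => i.elim0⟩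
  have hn' : (0 : ℝ) < n := by exact_mod_cast hn
  -- The largest coefficient of the bonus is `n * κ`, and `ramp < 1`, so this `κ` keeps the
  -- perturbation below `ε`.
  have hκ : 0 < ε / n := by positivity
  have hH : (fun (i : Fin n) s => F i s + bonus (ε / n) i s) ∈ D n := fun i =>
    (hF i).add (isCadlagPos_bonus hκ.le i)
  refine ⟨fun i s => F i s + bonus (ε / n) i s, mem_DdownMinus_of_hasLateOptimizers hH
    ((rF.hasLateOptimizers_add_bonus hF hκ).congr fun l hl =>
      (extend_of_lt (fun (i : Fin n) s => F i s + bonus (ε / n) i s) hl).symm), ?_⟩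
  intro i t
  have h1 : bonus (ε / n) i t ≤ ε := by
    have hi : ((i : ℕ) : ℝ) + 1 ≤ n := by exact_mod_cast i.2
    calc bonus (ε / n) i t ≤ ε / n * n * 1 := by
          unfold bonus
          gcongr
          · exact ramp_nonneg t
          · exact (ramp_lt_one t).le
      _ = ε := by field_simp
  have h2 : 0 ≤ bonus (ε / n) i t := by
    have := ramp_nonneg t
    unfold bonus
    positivity
  rw [abs_le]
  constructor <;> linarith

theorem injOn_W : InjOn W (Ddown n) := by
  intro f hf g hg hfg
  have h := (recurrent_of_mem_Ddown hf).eq (isCadlagPos_extend hf.1) (isCadlagPos_extend hg.1)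
    (recurrent_of_mem_Ddown hg) fun k hk x y hxy => by
      rw [(W_spec hf.1).2 k hk x y hxy, (W_spec hg.1).2 k hk x y hxy, hfg]
  funext i
  rw [← extend_val f, h i i.2, extend_val]

/-- The preimage of `g` is its recurrent representative: `W` depends only on last passage values
from time `0`, and it fixes `g`. -/
theorem surjOn_W : SurjOn W (Ddown n) (Dup n) := by
  intro g hg
  obtain ⟨F, hF, rF, hlp⟩ := exists_recurrent n (isCadlagPos_extend hg.1)
  refine ⟨fun i => F i, mem_Ddown_of_recurrent hF rF, ?_⟩
  refine (W_congr (g := g) fun k hk y => ?_).trans (W_of_mem_Dup hg)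
  rw [← hlp k hk 0 y zero_le]
  exact lastPassage_congr (fun l hl => extend_of_lt _ hl) k 0 y

end Down

end

end Melon

theorem theorem1 (n : ℕ) (hn : 1 ≤ n) :
    -- the last passage values are finite and the melon map is a map from `𝒟ⁿ` to itself
    (∀ f ∈ Melon.D n,
      (∀ x y : NNReal, x ≤ y →
        ((Melon.pathLengths f x y).Nonempty ∧ BddAbove (Melon.pathLengths f x y)) ∧
        ∀ k ≤ n, (Melon.tupleLengths f k x y).Nonempty ∧
          BddAbove (Melon.tupleLengths f k x y)) ∧
      Melon.W f ∈ Melon.D n) ∧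
    -- isometry
    (∀ f ∈ Melon.D n, ∀ x y : NNReal, x ≤ y →
      Melon.lpp f x y = Melon.lpp (Melon.W f) x y) ∧
    -- idempotence
    (∀ f ∈ Melon.D n, Melon.W (Melon.W f) = Melon.W f) ∧
    -- image
    Melon.W '' Melon.D n = Melon.Dup n ∧
    -- bijection
    Set.BijOn Melon.W (Melon.Ddown n) (Melon.Dup n) := by
  refine ⟨fun f hf => ⟨fun x y hxy => ⟨?_, ?_⟩, (Melon.W_spec hf).1.1⟩, fun f hf x y hxy => ?_,
    fun f hf => Melon.W_of_mem_Dup (Melon.W_spec hf).1, ?_,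
    fun f hf => (Melon.W_spec hf.1).1, Melon.injOn_W, Melon.surjOn_W⟩
  · rw [Melon.pathLengths_eq]
    exact ⟨Melon.nonempty_weights _ hn hxy,
      Melon.bddAbove_weights (Melon.isCadlagPos_extend hf) hn x y⟩
  · rintro (_ | k) hk
    · have : Melon.tupleLengths f 0 x y = {0} := by
        ext L
        simp [Melon.tupleLengths, Melon.tupleLength, Melon.IsDisjointTuple, Melon.dg_empty,
          eq_comm]
      rw [this]
      exact ⟨singleton_nonempty 0, bddAbove_singleton⟩
    · rw [Melon.tupleLengths_succ]
      exact ⟨Melon.nonempty_weights _ hk hxy,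
        Melon.bddAbove_weights (Melon.isCadlagPos_extend hf) hk x y⟩
  · rw [Melon.lpp_eq, Melon.lpp_eq, (Melon.W_spec hf).2 0 hn x y hxy]
  · ext g
    constructor
    · rintro ⟨f, hf, rfl⟩
      exact (Melon.W_spec hf).1
    · exact fun hg => ⟨g, hg.1, Melon.W_of_mem_Dup hg⟩
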